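/- Let $d\ge 1$ and $\alpha_1,\dots,\alpha_d\in(0,1)$, and put $b_i=1-\alpha_i/2$. For each $i$ let $Z^i$ be the continuous process on $[0,\infty)$ associated with the operator $\mathcal A_i f(x)=x^{\alpha_i}f''(x)$ with reflection at $0$ and spending zero time at $0$: for every starting point it solves the submartingale problem for $\mathcal A_i$ (that is, $f(Z^i_t)-f(Z^i_0)-\int_0^t\mathcal A_i f(Z^i_s)\,ds$ is a submartingale for every compactly supported $f\in C^2$ with $f'(0)\ge 0$), and almost surely $\int_0^\infty 1_{\{Z^i_s=0\}}\,ds=0$. Let $Z=(Z^1,\dots,Z^d)$ with independent coordinates, let $P_tf(x)=\mathbb E^x f(Z_t)$, let $R_\lambda f=\int_0^\infty e^{-\lambda t}P_tf\,dt$ for $\lambda>0$, and let $\mu(dx)=\prod_{i=1}^d x_i^{-\alpha_i}\,dx_i$ on $\mathbb R_+^d=[0,\infty)^d$. Let $1<p<\infty$. Then there is a constant $c$, depending only on $d$, $p$ and $\alpha_1,\dots,\alpha_d$, such that for every $\lambda>0$ and every $f\in L^p(\mathbb R_+^d,\mu)$ the integrals that define $R_\lambda f(x)$ converge for $\mu$-almost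 every $x$ and, for each $i$, the partial derivative $\partial(R_\lambda f)/\partial x_i$ exists (pointwise $\mu$-almost everywhere, and in the weak sense on $(0,\infty)^d$, the two being equal), belongs to $L^p(\mu)$, and satisfies $$\Bigl\|\frac{\partial (R_\lambda f)}{\partial x_i}\Bigr\|_{L^p(\mu)}\le c\,\lambda^{\frac1{2b_i}-1}\,\|f\|_{L^p(\mu)} .$$ -/

import Mathlib

open MeasureTheory ProbabilityTheory Set
open scoped NNReal ENNReal

noncomputable section

namespace DegenerateOrthant

/-- The closed orthant `[0, ∞)^d`. -/
def orthant (d : ℕ) : Set (Fin d → ℝ) := {x | ∀ i, 0 ≤ x i}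

/-- The open orthant `(0, ∞)^d`. -/
def openOrthant (d : ℕ) : Set (Fin d → ℝ) := {x | ∀ i, 0 < x i}

/-- The continuous process `Z` on `[0, ∞)`, under the law `P`, is the diffusion started at `z` that
is associated with the operator `x ^ α * f''` with reflection at `0`: it solves the submartingale
problem for this operator (for compactly supported `C²` functions `f` whose inward derivative at
the boundary point `0` is nonnegative) and spends zero time at `0`. -/
structure IsReflectingDiffusion {Ω : Type*} [mΩ : MeasurableSpace Ω] (α : ℝ) (P : Measure Ω)
    (Z : ℝ≥0 → Ω → ℝ) (z : ℝ) : Prop where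
  continuous_paths : ∀ ω, Continuous fun t => Z t ω
  nonneg : ∀ t ω, 0 ≤ Z t ω
  start : ∀ᵐ ω ∂P, Z 0 ω = z
  submartingale : ∃ F : Filtration ℝ≥0 mΩ, StronglyAdapted F Z ∧
    ∀ f : ℝ → ℝ, ContDiff ℝ 2 f → HasCompactSupport f → 0 ≤ deriv f 0 →
      Submartingale
        (fun t ω => f (Z t ω) - f (Z 0 ω)
          - ∫ s in (0 : ℝ)..(t : ℝ), Z s.toNNReal ω ^ α * iteratedDeriv 2 f (Z s.toNNReal ω))
        F P
  zero_time_at_zero : ∀ᵐ ω ∂P, volume {s : ℝ | 0 ≤ s ∧ Z s.toNNReal ω = 0} = 0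

/-- The process `X` on the orthant, with the family of laws `P x` (`x` the starting point), has
independent coordinates, and the `i`-th coordinate is the reflecting diffusion associated with the
operator `x ^ α i * f''`. -/
structure IsProductDiffusion {Ω : Type*} [MeasurableSpace Ω] {d : ℕ} (α : Fin d → ℝ)
    (P : (Fin d → ℝ) → Measure Ω) (X : ℝ≥0 → Ω → Fin d → ℝ) : Prop where
  prob : ∀ x ∈ orthant d, IsProbabilityMeasure (P x)
  coord : ∀ x ∈ orthant d, ∀ i, IsReflectingDiffusion (α i) (P x) (fun t ω => X t ω i) (x i)
  indep : ∀ x ∈ orthant d, iIndepFun (fun (i : Fin d) (ω : Ω) (t : ℝ≥0) => X t ω i) (P x)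

/-- The semigroup `P_t f (x) = E^x f(X_t)`. -/
def semigroup {Ω : Type*} [MeasurableSpace Ω] {d : ℕ} (P : (Fin d → ℝ) → Measure Ω)
    (X : ℝ≥0 → Ω → Fin d → ℝ) (t : ℝ≥0) (f : (Fin d → ℝ) → ℝ) (x : Fin d → ℝ) : ℝ :=
  ∫ ω, f (X t ω) ∂(P x)

/-- The resolvent `R_l f = ∫_0^∞ e^{-l t} P_t f dt`. -/
def resolvent {Ω : Type*} [MeasurableSpace Ω] {d : ℕ} (P : (Fin d → ℝ) → Measure Ω)
    (X : ℝ≥0 → Ω → Fin d → ℝ) (l : ℝ) (f : (Fin d → ℝ) → ℝ) (x : Fin d → ℝ) : ℝ :=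
  ∫ t in Ioi (0 : ℝ), Real.exp (-l * t) * semigroup P X t.toNNReal f x

/-- The product measure on the orthant with factors `x ^ (-α i) dx` on `[0, ∞)`. -/
def weightedMeasure {d : ℕ} (α : Fin d → ℝ) : Measure (Fin d → ℝ) :=
  Measure.pi fun i =>
    (volume.restrict (Ici (0 : ℝ))).withDensity fun s => ENNReal.ofReal (s ^ (-α i))

/-- `g` is the weak (distributional) partial derivative of `u` in the direction `i` on the open
set `U`. -/
def HasWeakPartialDeriv {d : ℕ} (U : Set (Fin d → ℝ)) (i : Fin d) (u g : (Fin d → ℝ) → ℝ) : Prop :=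
  LocallyIntegrableOn u U ∧ LocallyIntegrableOn g U ∧
    ∀ φ : (Fin d → ℝ) → ℝ, ContDiff ℝ (⊤ : ℕ∞) φ → HasCompactSupport φ → tsupport φ ⊆ U →
      ∫ x in U, u x * fderiv ℝ φ x (Pi.single i 1) = -∫ x in U, g x * φ x

end DegenerateOrthant

end

/-! In the coordinate `y = x ^ (2 - α) / (2 - α) ^ 2` the operator `x ^ α f''` becomes `y ψ'' + a
ψ'` with `a = (1 - α) / (2 - α)`, the generator of a squared Bessel process up to scaling. The
submartingale problem and the zero time at `0` therefore determine `V(t, θ) = E exp(-θ Y_t)`. It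
solves the first order equation `∂_t V + θ² ∂_θ V + a θ V = 0`, which is integrated along
characteristics (`integral_exp_neg_eq`). Inverting the Laplace transform identifies the law of each
coordinate at a positive time (`IsReflectingDiffusion.map_eq`). Its density relative to `x ^ (-α)
dx` is a Bessel series, that is, a mixture over a Poisson index `k` of Gamma laws of shape `a + k`
in the variable `r z ^ (2 - α)`, with `r` a constant times `1 / t`.

Differentiation in the starting point inserts a factor `(k - u) / x`, where `u = r x ^ (2 - α)` is
the Poisson mean. The smallness of `E |N - u|` gives an `L¹` bound `C t ^ (-1 / (2 - α))` for the
differentiated density in the target variable (`lintegral_enorm_densityDeriv_le`), and Gamma moments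
give the same order in the starting variable (`lintegral_enorm_densityDeriv_le'`).

By independence the density on the orthant is a product, whose other factors have mass one in either
variable. Because `1 / (2 - α) < 1`, the integral of `exp (-λ t) t ^ (-1 / (2 - α))` converges and
is a constant times `λ ^ (1 / (2 - α) - 1)`; here `2 - α = 2 b`. The Schur test
(`lintegral_rpow_kernel_le`) turns the two marginal bounds into the `L^p` bound.

It remains to see that the integrated derivative kernel really is the derivative. On almost every
line parallel to an axis the resolvent is a primitive of it (`ae_line_resolventIntegral`). Lebesgue
differentiation then gives the pointwise derivative, and integration by parts on lines gives the
weak one. -/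

namespace DegenerateOrthant

open Filter Topology
open scoped Nat BoundedContinuousFunction

/-! ### Expectation identities from the submartingale problem -/

section Martingale

variable {Ω : Type*} [MeasurableSpace Ω] {α : ℝ} {P : Measure Ω} {Z : ℝ≥0 → Ω → ℝ} {z : ℝ}

/-- When `f'(0) = 0`, both `f` and `-f` are admissible, so the compensated process is a
submartingale and a supermartingale that starts from `0`. -/
theorem IsReflectingDiffusion.integral_generator_eq_zero [IsFiniteMeasure P]
    (hZ : IsReflectingDiffusion α P Z z) {f : ℝ → ℝ} (hf : ContDiff ℝ 2 f)
    (hc : HasCompactSupport f) (h0 : deriv f 0 = 0) (t : ℝ≥0) :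
    Integrable (fun ω => f (Z t ω) - f (Z 0 ω)
          - ∫ s in (0 : ℝ)..(t : ℝ), Z s.toNNReal ω ^ α * iteratedDeriv 2 f (Z s.toNNReal ω)) P ∧
    ∫ ω, (f (Z t ω) - f (Z 0 ω)
          - ∫ s in (0 : ℝ)..(t : ℝ), Z s.toNNReal ω ^ α * iteratedDeriv 2 f (Z s.toNNReal ω)) ∂P
      = 0 := by
  obtain ⟨F, -, hF⟩ := hZ.submartingale
  have h1 := hF f hf hc h0.ge
  have h2 := hF (-f) hf.neg hc.neg (by rw [deriv.neg, h0, neg_zero])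
  refine ⟨h1.integrable t, le_antisymm ?_ ?_⟩
  · have := h2.setIntegral_le (zero_le : 0 ≤ t) (s := univ) MeasurableSet.univ
    simp only [setIntegral_univ, iteratedDeriv_neg, Pi.neg_apply, NNReal.coe_zero,
      intervalIntegral.integral_same, sub_self, mul_neg, intervalIntegral.integral_neg,
      sub_neg_eq_add, integral_zero] at this
    have h3 : ∀ ω, -f (Z t ω) + f (Z 0 ω) + ∫ s in (0 : ℝ)..(t : ℝ),
        Z s.toNNReal ω ^ α * iteratedDeriv 2 f (Z s.toNNReal ω)
        = -(f (Z t ω) - f (Z 0 ω)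
          - ∫ s in (0 : ℝ)..(t : ℝ), Z s.toNNReal ω ^ α * iteratedDeriv 2 f (Z s.toNNReal ω)) := by
      intro ω; ring
    simp only [h3] at this
    rw [integral_neg] at this
    linarith
  · have := h1.setIntegral_le (zero_le : 0 ≤ t) (s := univ) MeasurableSet.univ
    simpa using this

end Martingale

/-! ### Smooth approximations of the squared Bessel coordinate -/

section Smoothing

/-- A smooth even approximation of `|x| ^ (2 - α) / (2 - α) ^ 2`. -/
noncomputable def smoothedPower (α ε x : ℝ) : ℝ := (x ^ 2 + ε) ^ (1 - α / 2) / (2 - α) ^ 2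

variable {α ε : ℝ}

theorem hasDerivAt_smoothedPower (hα : α < 2) (hε : 0 < ε) (x : ℝ) :
    HasDerivAt (smoothedPower α ε) (x * (x ^ 2 + ε) ^ (-(α / 2)) / (2 - α)) x := by
  have hw : 0 < x ^ 2 + ε := by positivity
  have h1 : HasDerivAt (fun x : ℝ => x ^ 2 + ε) (2 * x) x := by
    simpa using (hasDerivAt_pow 2 x).add_const ε
  have h2 := (h1.rpow_const (p := 1 - α / 2) (Or.inl hw.ne')).div_const ((2 - α) ^ 2)
  refine h2.congr_deriv ?_
  rw [show (1 - α / 2 - 1) = -(α / 2) by ring]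
  have : 2 - α ≠ 0 := by linarith
  field_simp

theorem hasDerivAt_deriv_smoothedPower (hα : α < 2) (hε : 0 < ε) (x : ℝ) :
    HasDerivAt (fun x => x * (x ^ 2 + ε) ^ (-(α / 2)) / (2 - α))
      (((x ^ 2 + ε) ^ (-(α / 2)) - α * x ^ 2 * (x ^ 2 + ε) ^ (-(α / 2) - 1)) / (2 - α)) x := by
  have hw : 0 < x ^ 2 + ε := by positivity
  have h1 : HasDerivAt (fun x : ℝ => x ^ 2 + ε) (2 * x) x := by
    simpa using (hasDerivAt_pow 2 x).add_const ε
  have h2 := (((hasDerivAt_id x).mul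
    (h1.rpow_const (p := -(α / 2)) (Or.inl hw.ne'))).div_const (2 - α))
  refine h2.congr_deriv ?_
  have : 2 - α ≠ 0 := by linarith
  simp only [id]
  field_simp
  ring

theorem contDiff_smoothedPower (hε : 0 < ε) : ContDiff ℝ 2 (smoothedPower α ε) := by
  unfold smoothedPower
  refine ContDiff.div_const (ContDiff.rpow_const_of_ne (by fun_prop) fun x => ?_) _
  positivity

variable {ψ : ℝ → ℝ}

theorem deriv_comp_smoothedPower (hα : α < 2) (hε : 0 < ε) (hψ : ContDiff ℝ 2 ψ) :
    deriv (fun x => ψ (smoothedPower α ε x)) = fun x =>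
      deriv ψ (smoothedPower α ε x) * (x * (x ^ 2 + ε) ^ (-(α / 2)) / (2 - α)) := by
  ext x
  exact (((hψ.differentiable (by norm_num)).differentiableAt.hasDerivAt).comp x
    (hasDerivAt_smoothedPower hα hε x)).deriv

theorem iteratedDeriv_two_comp_smoothedPower (hα : α < 2) (hε : 0 < ε) (hψ : ContDiff ℝ 2 ψ)
    (x : ℝ) :
    iteratedDeriv 2 (fun x => ψ (smoothedPower α ε x)) x =
      iteratedDeriv 2 ψ (smoothedPower α ε x) * (x * (x ^ 2 + ε) ^ (-(α / 2)) / (2 - α)) ^ 2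
      + deriv ψ (smoothedPower α ε x) *
        (((x ^ 2 + ε) ^ (-(α / 2)) - α * x ^ 2 * (x ^ 2 + ε) ^ (-(α / 2) - 1)) / (2 - α)) := by
  have hd : Differentiable ℝ (deriv ψ) := by
    have := hψ.differentiable_iteratedDeriv 1 (by norm_num)
    rwa [iteratedDeriv_one] at this
  have h2 : iteratedDeriv 2 ψ = deriv (deriv ψ) := by
    rw [iteratedDeriv_succ, iteratedDeriv_one]
  rw [iteratedDeriv_succ, iteratedDeriv_one, deriv_comp_smoothedPower hα hε hψ, h2]
  have h := (((hd _).hasDerivAt).comp x (hasDerivAt_smoothedPower hα hε x)).mul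
    (hasDerivAt_deriv_smoothedPower hα hε x)
  exact h.deriv.trans (by simp only [Function.comp_apply]; ring)

/-- Apart from the smoothed coordinate itself, `ε` enters only through powers of the ratio `x² / (x²
+ ε)`, which lies in `[0, 1]`. This gives bounds uniform in `ε`, and a limit as `ε → 0` at each `x >
0`, where the ratio tends to `1`. At `x = 0` the ratio is `0` and the term in `ψ'` is lost. -/
theorem generator_comp_smoothedPower (hα0 : 0 < α) (hα : α < 2) (hε : 0 < ε)
    (hψ : ContDiff ℝ 2 ψ) {x : ℝ} (hx : 0 ≤ x) :
    x ^ α * iteratedDeriv 2 (fun x => ψ (smoothedPower α ε x)) x =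
      smoothedPower α ε x * iteratedDeriv 2 ψ (smoothedPower α ε x)
        * (x ^ 2 / (x ^ 2 + ε)) ^ (1 + α / 2)
      + deriv ψ (smoothedPower α ε x) *
        (((x ^ 2 / (x ^ 2 + ε)) ^ (α / 2) - α * (x ^ 2 / (x ^ 2 + ε)) ^ (1 + α / 2)) / (2 - α)) := by
  rw [iteratedDeriv_two_comp_smoothedPower hα hε hψ]
  have hw : 0 < x ^ 2 + ε := by positivity
  have h2 : 2 - α ≠ 0 := by linarith
  have e1 : (x ^ 2 / (x ^ 2 + ε)) ^ (α / 2) = x ^ α * (x ^ 2 + ε) ^ (-(α / 2)) := by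
    rw [Real.div_rpow (by positivity) hw.le, Real.rpow_neg hw.le, ← Real.rpow_natCast,
      ← Real.rpow_mul hx, div_eq_mul_inv]
    congr 2; push_cast; ring
  have e2 : (x ^ 2 / (x ^ 2 + ε)) ^ (1 + α / 2)
      = x ^ 2 / (x ^ 2 + ε) * (x ^ α * (x ^ 2 + ε) ^ (-(α / 2))) := by
    rw [← e1, Real.rpow_add' (by positivity) (by positivity), Real.rpow_one]
  have e3 : (x ^ 2 + ε) ^ (-(α / 2) - 1) = (x ^ 2 + ε) ^ (-(α / 2)) / (x ^ 2 + ε) := by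
    rw [Real.rpow_sub_one hw.ne']
  have e4 : smoothedPower α ε x = (x ^ 2 + ε) * (x ^ 2 + ε) ^ (-(α / 2)) / (2 - α) ^ 2 := by
    rw [smoothedPower, sub_eq_add_neg, Real.rpow_add hw, Real.rpow_one]
  rw [e1, e2, e3]
  generalize iteratedDeriv 2 ψ (smoothedPower α ε x) = p
  generalize deriv ψ (smoothedPower α ε x) = q
  rw [e4]
  field_simp

theorem hasCompactSupport_comp_smoothedPower (hα : α < 2)
    (hc : HasCompactSupport ψ) : HasCompactSupport fun x => ψ (smoothedPower α ε x) := by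
  rw [hasCompactSupport_iff_eventuallyEq, coclosedCompact_eq_cocompact] at hc ⊢
  have h1 : Tendsto (fun x : ℝ => ‖x‖ ^ 2 + ε) (cocompact ℝ) atTop :=
    tendsto_atTop_add_const_right _ _
      ((tendsto_pow_atTop two_ne_zero).comp tendsto_norm_cocompact_atTop)
  have h2 : Tendsto (smoothedPower α ε) (cocompact ℝ) atTop := by
    refine (((tendsto_rpow_atTop (show 0 < 1 - α / 2 by linarith)).comp h1).atTop_div_const
      (show 0 < (2 - α) ^ 2 from pow_pos (by linarith) 2)).congr fun x => ?_
    simp [smoothedPower]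
  exact (h2.mono_right atTop_le_cocompact).eventually hc

end Smoothing

/-! ### Passage to the squared Bessel generator -/

section Limit

variable {Ω : Type*} [MeasurableSpace Ω] {α : ℝ} {P : Measure Ω} {Z : ℝ≥0 → Ω → ℝ} {z : ℝ}

/-- Dominated convergence, in time and then in `ω`. Convergence of `g n` is asked only for `x > 0`:
almost every path spends Lebesgue-null time at `0`. This is where the zero-time condition enters. -/
theorem IsReflectingDiffusion.integral_generator_limit [IsFiniteMeasure P]
    (hZ : IsReflectingDiffusion α P Z z) {f g : ℕ → ℝ → ℝ} {f₀ g₀ : ℝ → ℝ} {C : ℝ} (t : ℝ≥0)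
    (hg : ∀ n, Measurable (g n)) (hfC : ∀ n x, 0 ≤ x → |f n x| ≤ C)
    (hgC : ∀ n x, 0 ≤ x → |g n x| ≤ C)
    (hf₀ : ∀ x, 0 ≤ x → Tendsto (fun n => f n x) atTop (𝓝 (f₀ x)))
    (hg₀ : ∀ x, 0 < x → Tendsto (fun n => g n x) atTop (𝓝 (g₀ x)))
    (hm : ∀ n, AEStronglyMeasurable (fun ω => f n (Z t ω) - f n (Z 0 ω)
          - ∫ s in (0 : ℝ)..(t : ℝ), g n (Z s.toNNReal ω)) P)
    (hi : ∀ n, ∫ ω, (f n (Z t ω) - f n (Z 0 ω)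
          - ∫ s in (0 : ℝ)..(t : ℝ), g n (Z s.toNNReal ω)) ∂P = 0) :
    AEStronglyMeasurable (fun ω => f₀ (Z t ω) - f₀ (Z 0 ω)
          - ∫ s in (0 : ℝ)..(t : ℝ), g₀ (Z s.toNNReal ω)) P ∧
    ∫ ω, (f₀ (Z t ω) - f₀ (Z 0 ω)
          - ∫ s in (0 : ℝ)..(t : ℝ), g₀ (Z s.toNNReal ω)) ∂P = 0 := by
  have hlim : ∀ᵐ ω ∂P, Tendsto (fun n => f n (Z t ω) - f n (Z 0 ω)
      - ∫ s in (0 : ℝ)..(t : ℝ), g n (Z s.toNNReal ω)) atTop (𝓝 (f₀ (Z t ω) - f₀ (Z 0 ω)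
      - ∫ s in (0 : ℝ)..(t : ℝ), g₀ (Z s.toNNReal ω))) := by
    filter_upwards [hZ.zero_time_at_zero] with ω hω
    refine ((hf₀ _ (hZ.nonneg t ω)).sub (hf₀ _ (hZ.nonneg 0 ω))).sub ?_
    refine intervalIntegral.tendsto_integral_filter_of_dominated_convergence (fun _ => C)
      (Eventually.of_forall fun n => ?_) (Eventually.of_forall fun n => ?_) (by simp) ?_
    · exact ((hg n).comp ((hZ.continuous_paths ω).comp
        continuous_real_toNNReal).measurable).aestronglyMeasurable
    · exact Eventually.of_forall fun s _ => hgC n _ (hZ.nonneg _ ω)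
    · have h0 : ∀ᵐ s : ℝ, ¬ (0 ≤ s ∧ Z s.toNNReal ω = 0) := ae_iff.mpr (by simpa using hω)
      filter_upwards [h0] with s hs hst
      rw [uIoc_of_le t.coe_nonneg] at hst
      exact hg₀ _ ((hZ.nonneg _ ω).lt_of_ne fun h => hs ⟨hst.1.le, h.symm⟩)
  refine ⟨aestronglyMeasurable_of_tendsto_ae atTop hm hlim, ?_⟩
  have := tendsto_integral_of_dominated_convergence (fun _ => C + C + C * t) hm
    (integrable_const _) (fun n => Eventually.of_forall fun ω => ?_) hlim
  · simp only [hi] at this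
    exact (tendsto_nhds_unique this tendsto_const_nhds)
  · have h1 : ‖∫ s in (0 : ℝ)..(t : ℝ), g n (Z s.toNNReal ω)‖ ≤ C * |(t : ℝ) - 0| :=
      intervalIntegral.norm_integral_le_of_norm_le_const fun s _ => hgC n _ (hZ.nonneg _ ω)
    rw [sub_zero, abs_of_nonneg t.coe_nonneg] at h1
    exact (norm_sub_le _ _).trans (add_le_add ((norm_sub_le _ _).trans
      (add_le_add (hfC n _ (hZ.nonneg _ ω)) (hfC n _ (hZ.nonneg _ ω)))) h1)

/-- The coordinate in which the diffusion becomes a squared Bessel process. -/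
noncomputable def powerCoord (α x : ℝ) : ℝ := x ^ (2 - α) / (2 - α) ^ 2

theorem powerCoord_nonneg {x : ℝ} (hx : 0 ≤ x) : 0 ≤ powerCoord α x := by
  unfold powerCoord; positivity

theorem measurable_powerCoord : Measurable (powerCoord α) := by
  unfold powerCoord; fun_prop

theorem continuous_powerCoord (hα : α < 2) : Continuous (powerCoord α) := by
  unfold powerCoord
  exact (Real.continuous_rpow_const (by linarith)).div_const _

theorem tendsto_smoothedPower {x : ℝ} (hα : α < 2) (hx : 0 ≤ x) :
    Tendsto (fun n : ℕ => smoothedPower α (1 / ((n : ℝ) + 1)) x) atTop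
      (𝓝 (powerCoord α x)) := by
  have h1 : Tendsto (fun n : ℕ => x ^ 2 + 1 / ((n : ℝ) + 1)) atTop (𝓝 (x ^ 2)) := by
    simpa using tendsto_const_nhds.add (tendsto_one_div_add_atTop_nhds_zero_nat (𝕜 := ℝ))
  have h2 := (h1.rpow_const (p := 1 - α / 2) (Or.inr (by linarith))).div_const ((2 - α) ^ 2)
  have : powerCoord α x = (x ^ 2) ^ (1 - α / 2) / (2 - α) ^ 2 := by
    rw [powerCoord, ← Real.rpow_natCast x 2, ← Real.rpow_mul hx]
    congr 2; push_cast; ring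
  rw [this]
  exact h2

/-- No boundary condition on `ψ` is needed: the smoothed coordinate is even in `x`, so its
composition with `ψ` has zero derivative at `0`. -/
theorem IsReflectingDiffusion.integral_comp_powerCoord [IsFiniteMeasure P]
    (hZ : IsReflectingDiffusion α P Z z) (hα : α ∈ Ioo (0 : ℝ) 1) {ψ : ℝ → ℝ}
    (hψ : ContDiff ℝ 2 ψ) (hc : HasCompactSupport ψ) (t : ℝ≥0) :
    AEStronglyMeasurable (fun ω => ψ (powerCoord α (Z t ω)) - ψ (powerCoord α (Z 0 ω))
      - ∫ s in (0 : ℝ)..(t : ℝ),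
        (powerCoord α (Z s.toNNReal ω) * iteratedDeriv 2 ψ (powerCoord α (Z s.toNNReal ω))
          + (1 - α) / (2 - α) * deriv ψ (powerCoord α (Z s.toNNReal ω)))) P ∧
    ∫ ω, (ψ (powerCoord α (Z t ω)) - ψ (powerCoord α (Z 0 ω))
      - ∫ s in (0 : ℝ)..(t : ℝ),
        (powerCoord α (Z s.toNNReal ω) * iteratedDeriv 2 ψ (powerCoord α (Z s.toNNReal ω))
          + (1 - α) / (2 - α) * deriv ψ (powerCoord α (Z s.toNNReal ω)))) ∂P = 0 := by
  have hα2 : α < 2 := by linarith [hα.2]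
  have hα0 := hα.1
  have hε : ∀ n : ℕ, 0 < 1 / ((n : ℝ) + 1) := fun n => by positivity
  have hd1 : Continuous (deriv ψ) := hψ.continuous_deriv (by norm_num)
  have hd2 : Continuous (iteratedDeriv 2 ψ) := hψ.continuous_iteratedDeriv 2 (by norm_num)
  have hc2 : HasCompactSupport (iteratedDeriv 2 ψ) := by
    rw [iteratedDeriv_succ, iteratedDeriv_one]; exact hc.deriv.deriv
  obtain ⟨C0, hC0⟩ := hc.exists_bound_of_continuous hψ.continuous
  obtain ⟨C1, hC1⟩ := hc.deriv.exists_bound_of_continuous hd1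
  obtain ⟨C2, hC2⟩ := (hc2.mul_left (f := fun y : ℝ => y)).exists_bound_of_continuous
    (continuous_id.mul hd2)
  have hC0' : 0 ≤ C0 := (norm_nonneg _).trans (hC0 0)
  have hC1' : 0 ≤ C1 := (norm_nonneg _).trans (hC1 0)
  have hC2' : 0 ≤ C2 := (norm_nonneg _).trans (hC2 0)
  have key : ∀ n : ℕ, _ := fun n : ℕ => hZ.integral_generator_eq_zero
    (hψ.comp (contDiff_smoothedPower (α := α) (hε n)))
    (hasCompactSupport_comp_smoothedPower (ε := 1 / ((n : ℝ) + 1)) hα2 hc)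
    (by
      have := congrFun (deriv_comp_smoothedPower hα2 (hε n) hψ) 0
      simpa [Function.comp_def] using this) t
  refine hZ.integral_generator_limit (C := C0 + C2 + C1 * 2)
    (f := fun n x => ψ (smoothedPower α (1 / ((n : ℝ) + 1)) x))
    (g := fun n x => x ^ α *
      iteratedDeriv 2 (fun x => ψ (smoothedPower α (1 / ((n : ℝ) + 1)) x)) x)
    (f₀ := fun x => ψ (powerCoord α x)) (g₀ := fun x => powerCoord α x *
      iteratedDeriv 2 ψ (powerCoord α x) + (1 - α) / (2 - α) * deriv ψ (powerCoord α x))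
    t (fun n => ?_) (fun n x hx => ?_) (fun n x hx => ?_) (fun x hx => ?_) (fun x hx => ?_)
    (fun n => (key n).1.aestronglyMeasurable) (fun n => (key n).2)
  · exact (by fun_prop : Measurable fun x : ℝ => x ^ α).mul
      ((hψ.comp (contDiff_smoothedPower (α := α) (hε n))).continuous_iteratedDeriv 2
        (by norm_num)).measurable
  · exact (hC0 _).trans (by linarith)
  · rw [generator_comp_smoothedPower hα0 hα2 (hε n) hψ hx]
    set y := smoothedPower α (1 / ((n : ℝ) + 1)) x
    have hr0 : 0 ≤ x ^ 2 / (x ^ 2 + 1 / ((n : ℝ) + 1)) := by positivity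
    have hr1 : x ^ 2 / (x ^ 2 + 1 / ((n : ℝ) + 1)) ≤ 1 :=
      div_le_one_of_le₀ (by linarith [hε n]) (by positivity)
    set r := x ^ 2 / (x ^ 2 + 1 / ((n : ℝ) + 1))
    have a0 : 0 ≤ r ^ (1 + α / 2) := Real.rpow_nonneg hr0 _
    have a1 : r ^ (1 + α / 2) ≤ 1 := Real.rpow_le_one hr0 hr1 (by linarith)
    have b0 : 0 ≤ r ^ (α / 2) := Real.rpow_nonneg hr0 _
    have b1 : r ^ (α / 2) ≤ 1 := Real.rpow_le_one hr0 hr1 (by linarith)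
    have h3 : |(r ^ (α / 2) - α * r ^ (1 + α / 2)) / (2 - α)| ≤ 2 := by
      rw [abs_div, abs_of_pos (show 0 < 2 - α by linarith), div_le_iff₀ (by linarith), abs_le]
      constructor <;> nlinarith [hα.2]
    have h4 : |y * iteratedDeriv 2 ψ y| ≤ C2 := hC2 y
    have h5 : |deriv ψ y| ≤ C1 := hC1 y
    calc _ ≤ |y * iteratedDeriv 2 ψ y| * |r ^ (1 + α / 2)|
          + |deriv ψ y| * |(r ^ (α / 2) - α * r ^ (1 + α / 2)) / (2 - α)| := by
          rw [← abs_mul, ← abs_mul]; exact abs_add_le _ _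
      _ ≤ C2 * 1 + C1 * 2 := by
          refine add_le_add (mul_le_mul h4 (by rwa [abs_of_nonneg a0]) (abs_nonneg _) hC2')
            (mul_le_mul h5 h3 (abs_nonneg _) hC1')
      _ ≤ _ := by linarith
  · exact (hψ.continuous.tendsto _).comp (tendsto_smoothedPower hα2 hx)
  · simp only [generator_comp_smoothedPower hα0 hα2 (hε _) hψ hx.le]
    have hy := tendsto_smoothedPower hα2 hx.le
    have hr : Tendsto (fun n : ℕ => x ^ 2 / (x ^ 2 + 1 / ((n : ℝ) + 1))) atTop (𝓝 1) := by
      have h1 : Tendsto (fun n : ℕ => x ^ 2 + 1 / ((n : ℝ) + 1)) atTop (𝓝 (x ^ 2)) := by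
        simpa using tendsto_const_nhds.add (tendsto_one_div_add_atTop_nhds_zero_nat (𝕜 := ℝ))
      have h2 := (tendsto_const_nhds (x := x ^ 2)).div h1 (by positivity)
      rwa [div_self (by positivity)] at h2
    have hr1 := hr.rpow_const (p := 1 + α / 2) (Or.inl one_ne_zero)
    have hr2 := hr.rpow_const (p := α / 2) (Or.inl one_ne_zero)
    rw [Real.one_rpow] at hr1 hr2
    have := ((hy.mul ((hd2.tendsto _).comp hy)).mul hr1).add
      (((hd1.tendsto _).comp hy).mul ((hr2.sub (hr1.const_mul α)).div_const (2 - α)))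
    refine this.trans_eq ?_
    congr 1; ring

end Limit

theorem mul_exp_neg_mul_le {θ y : ℝ} (hθ : 0 < θ) : y * Real.exp (-(θ * y)) ≤ 1 / θ := by
  rw [Real.exp_neg, ← div_eq_mul_inv, div_le_div_iff₀ (Real.exp_pos _) hθ]
  linarith [Real.add_one_le_exp (θ * y)]

/-! ### Truncated exponentials as test functions -/

section Cutoff

/-- A smooth cutoff function. -/
noncomputable def cutoff : ContDiffBump (0 : ℝ) := ⟨1, 2, one_pos, one_lt_two⟩

theorem contDiff_cutoff {n : ℕ∞} : ContDiff ℝ n (cutoff : ℝ → ℝ) := cutoff.contDiff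

theorem cutoff_zero : cutoff (0 : ℝ) = 1 :=
  cutoff.one_of_mem_closedBall (Metric.mem_closedBall_self cutoff.rIn_pos.le)

theorem hasDerivAt_cutoff (x : ℝ) : HasDerivAt cutoff (deriv cutoff x) x :=
  ((contDiff_cutoff (n := 1)).differentiable (by norm_num)).differentiableAt.hasDerivAt

theorem hasDerivAt_deriv_cutoff (x : ℝ) :
    HasDerivAt (deriv cutoff) (deriv (deriv cutoff) x) x := by
  have := (contDiff_cutoff (n := 2)).differentiable_iteratedDeriv 1 (by norm_num)
  rw [iteratedDeriv_one] at this
  exact this.differentiableAt.hasDerivAt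

theorem exists_bound_cutoff_deriv : ∃ C, 0 ≤ C ∧ (∀ x, |deriv cutoff x| ≤ C) ∧
    ∀ x, |deriv (deriv cutoff) x| ≤ C := by
  have h2 := (contDiff_cutoff (n := 2)).continuous_iteratedDeriv 2 (by norm_num)
  rw [iteratedDeriv_succ, iteratedDeriv_one] at h2
  have hc := cutoff.hasCompactSupport
  obtain ⟨C1, hC1⟩ := hc.deriv.exists_bound_of_continuous
    ((contDiff_cutoff (n := 1)).continuous_deriv (by norm_num))
  obtain ⟨C2, hC2⟩ := hc.deriv.deriv.exists_bound_of_continuous h2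
  have h1 := (norm_nonneg _).trans (hC1 0)
  have h2 := (norm_nonneg _).trans (hC2 0)
  exact ⟨C1 + C2, by positivity, fun x => (hC1 x).trans (by linarith),
    fun x => (hC2 x).trans (by linarith)⟩

variable (c θ : ℝ)

theorem hasDerivAt_cutoff_mul_exp (y : ℝ) :
    HasDerivAt (fun y => cutoff (c * y) * Real.exp (-(θ * y)))
      ((c * deriv cutoff (c * y) - θ * cutoff (c * y)) * Real.exp (-(θ * y))) y := by
  have hl : HasDerivAt (fun y => c * y) c y := by simpa using (hasDerivAt_id y).const_mul c
  have he : HasDerivAt (fun y => Real.exp (-(θ * y))) (Real.exp (-(θ * y)) * -θ) y := by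
    simpa using (((hasDerivAt_id y).const_mul θ).neg).exp
  exact (((hasDerivAt_cutoff (c * y)).comp y hl).mul he).congr_deriv
    (by simp only [Function.comp_apply]; ring)

theorem hasDerivAt_deriv_cutoff_mul_exp (y : ℝ) :
    HasDerivAt (fun y => (c * deriv cutoff (c * y) - θ * cutoff (c * y)) * Real.exp (-(θ * y)))
      ((c ^ 2 * deriv (deriv cutoff) (c * y) - 2 * c * θ * deriv cutoff (c * y)
        + θ ^ 2 * cutoff (c * y)) * Real.exp (-(θ * y))) y := by
  have hl : HasDerivAt (fun y => c * y) c y := by simpa using (hasDerivAt_id y).const_mul c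
  have he : HasDerivAt (fun y => Real.exp (-(θ * y))) (Real.exp (-(θ * y)) * -θ) y := by
    simpa using (((hasDerivAt_id y).const_mul θ).neg).exp
  exact (((((hasDerivAt_deriv_cutoff (c * y)).comp y hl).const_mul c).sub
    (((hasDerivAt_cutoff (c * y)).comp y hl).const_mul θ)).mul he).congr_deriv
    (by simp only [Function.comp_apply, Pi.sub_apply]; ring)

theorem deriv_cutoff_mul_exp :
    deriv (fun y => cutoff (c * y) * Real.exp (-(θ * y))) = fun y =>
      (c * deriv cutoff (c * y) - θ * cutoff (c * y)) * Real.exp (-(θ * y)) :=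
  funext fun y => (hasDerivAt_cutoff_mul_exp c θ y).deriv

theorem iteratedDeriv_two_cutoff_mul_exp :
    iteratedDeriv 2 (fun y => cutoff (c * y) * Real.exp (-(θ * y))) = fun y =>
      (c ^ 2 * deriv (deriv cutoff) (c * y) - 2 * c * θ * deriv cutoff (c * y)
        + θ ^ 2 * cutoff (c * y)) * Real.exp (-(θ * y)) := by
  rw [iteratedDeriv_succ, iteratedDeriv_one, deriv_cutoff_mul_exp]
  exact funext fun y => (hasDerivAt_deriv_cutoff_mul_exp c θ y).deriv

theorem contDiff_cutoff_mul_exp :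
    ContDiff ℝ 2 (fun y => cutoff (c * y) * Real.exp (-(θ * y))) := by
  refine ContDiff.mul ((contDiff_cutoff (n := 2)).comp (by fun_prop)) (by fun_prop)

theorem hasCompactSupport_cutoff_mul_exp {c : ℝ} (hc : c ≠ 0) :
    HasCompactSupport (fun y => cutoff (c * y) * Real.exp (-(θ * y))) :=
  (cutoff.hasCompactSupport.comp_homeomorph (Homeomorph.mulLeft₀ c hc)).mul_right

end Cutoff

section ExpLimit

variable {Ω : Type*} [MeasurableSpace Ω] {α : ℝ} {P : Measure Ω} {Z : ℝ≥0 → Ω → ℝ} {z : ℝ}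

/-- The exponential lacks compact support, so it is multiplied by a cutoff at scale `n + 1`. The
unbounded coefficient `y` of the generator is controlled by `y exp (-θ y) ≤ 1 / θ`, uniformly in
`n`. -/
theorem IsReflectingDiffusion.integral_exp_neg_powerCoord [IsFiniteMeasure P]
    (hZ : IsReflectingDiffusion α P Z z) (hα : α ∈ Ioo (0 : ℝ) 1) {θ : ℝ} (hθ : 0 < θ)
    (t : ℝ≥0) :
    ∫ ω, (Real.exp (-(θ * powerCoord α (Z t ω))) - Real.exp (-(θ * powerCoord α (Z 0 ω)))
      - ∫ s in (0 : ℝ)..(t : ℝ),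
        (θ ^ 2 * powerCoord α (Z s.toNNReal ω) - (1 - α) / (2 - α) * θ)
          * Real.exp (-(θ * powerCoord α (Z s.toNNReal ω)))) ∂P = 0 := by
  have hα2 : α < 2 := by linarith [hα.2]
  obtain ⟨C, hC0, hC1, hC2⟩ := exists_bound_cutoff_deriv
  set c : ℕ → ℝ := fun n => 1 / ((n : ℝ) + 1)
  have hc0 : ∀ n, 0 < c n := fun n => by positivity
  have hc1 : ∀ n, c n ≤ 1 := fun n =>
    div_le_one_of_le₀ (by linarith [(n.cast_nonneg : (0 : ℝ) ≤ n)]) (by positivity)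
  have hct : Tendsto c atTop (𝓝 0) := tendsto_one_div_add_atTop_nhds_zero_nat
  set a := (1 - α) / (2 - α)
  have ha0 : 0 ≤ a := div_nonneg (by linarith [hα.2]) (by linarith)
  set ψ : ℕ → ℝ → ℝ := fun n y => cutoff (c n * y) * Real.exp (-(θ * y))
  have key : ∀ n : ℕ, _ := fun n : ℕ => hZ.integral_comp_powerCoord hα
    (contDiff_cutoff_mul_exp (c n) θ) (hasCompactSupport_cutoff_mul_exp θ (hc0 n).ne') t
  have hχ : ∀ y, |cutoff y| ≤ 1 := fun y => by
    rw [abs_of_nonneg cutoff.nonneg]; exact cutoff.le_one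
  refine (hZ.integral_generator_limit
    -- The summand `1` bounds the test functions, the second bounds `y ψ''` and the third bounds `a
    -- ψ'`.
    (C := 1 + (C + 2 * θ * C + θ ^ 2) * (1 / θ) + a * (C + θ))
    (f := fun n x => ψ n (powerCoord α x))
    (g := fun n x => powerCoord α x * iteratedDeriv 2 (ψ n) (powerCoord α x)
      + a * deriv (ψ n) (powerCoord α x))
    (f₀ := fun x => Real.exp (-(θ * powerCoord α x)))
    (g₀ := fun x => (θ ^ 2 * powerCoord α x - a * θ) * Real.exp (-(θ * powerCoord α x)))
    t (fun n => ?_) (fun n x hx => ?_) (fun n x hx => ?_) (fun x hx => ?_) (fun x hx => ?_)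
    (fun n => (key n).1) (fun n => (key n).2)).2
  · have h1 := (contDiff_cutoff_mul_exp (c n) θ).continuous_deriv (by norm_num)
    have h2 := (contDiff_cutoff_mul_exp (c n) θ).continuous_iteratedDeriv 2 (by norm_num)
    have h3 := measurable_powerCoord (α := α)
    exact (h3.mul (h2.measurable.comp h3)).add ((h1.measurable.comp h3).const_mul _)
  · have h1 : Real.exp (-(θ * powerCoord α x)) ≤ 1 :=
      Real.exp_le_one_iff.2 (neg_nonpos.2 (mul_nonneg hθ.le (powerCoord_nonneg hx)))
    have : |ψ n (powerCoord α x)| ≤ 1 := by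
      simp only [ψ, abs_mul, Real.abs_exp]
      exact mul_le_one₀ (hχ _) (Real.exp_pos _).le h1
    have : 0 ≤ (C + 2 * θ * C + θ ^ 2) * (1 / θ) + a * (C + θ) := by positivity
    linarith
  · have hy := powerCoord_nonneg (α := α) hx
    simp only [ψ, deriv_cutoff_mul_exp, iteratedDeriv_two_cutoff_mul_exp]
    set y := powerCoord α x
    have h1 : Real.exp (-(θ * y)) ≤ 1 :=
      Real.exp_le_one_iff.2 (neg_nonpos.2 (mul_nonneg hθ.le hy))
    have h2 := mul_exp_neg_mul_le (y := y) hθ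
    have h3 : |c n ^ 2 * deriv (deriv cutoff) (c n * y) - 2 * c n * θ * deriv cutoff (c n * y)
        + θ ^ 2 * cutoff (c n * y)| ≤ C + 2 * θ * C + θ ^ 2 := by
      refine (abs_add_le _ _).trans (add_le_add ((abs_sub _ _).trans (add_le_add ?_ ?_)) ?_)
      · rw [abs_mul, abs_of_pos (pow_pos (hc0 n) 2)]
        calc _ ≤ 1 * C := mul_le_mul (pow_le_one₀ (hc0 n).le (hc1 n)) (hC2 _) (abs_nonneg _)
              zero_le_one
          _ = C := one_mul C
      · rw [abs_mul, abs_of_pos (by have := hc0 n; positivity)]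
        refine mul_le_mul ?_ (hC1 _) (abs_nonneg _) (by positivity)
        nlinarith [hc1 n]
      · rw [abs_mul, abs_of_pos (by positivity)]
        exact mul_le_of_le_one_right (by positivity) (hχ _)
    have h4 : |c n * deriv cutoff (c n * y) - θ * cutoff (c n * y)| ≤ C + θ := by
      refine (abs_sub _ _).trans (add_le_add ?_ ?_)
      · rw [abs_mul, abs_of_pos (hc0 n)]
        calc _ ≤ 1 * C := mul_le_mul (hc1 n) (hC1 _) (abs_nonneg _) zero_le_one
          _ = C := one_mul C
      · rw [abs_mul, abs_of_pos hθ]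
        exact mul_le_of_le_one_right hθ.le (hχ _)
    refine (abs_add_le _ _).trans ?_
    have e1 : ∀ A, y * (A * Real.exp (-(θ * y))) = A * (y * Real.exp (-(θ * y))) := by
      intro A; ring
    rw [e1, abs_mul _ (y * _), abs_mul a, abs_mul (c n * _ - _), abs_of_nonneg ha0,
      Real.abs_exp, abs_of_nonneg (mul_nonneg hy (Real.exp_pos _).le)]
    have h5 := mul_le_mul h3 h2 (mul_nonneg hy (Real.exp_pos _).le) (by positivity)
    have h6 := mul_le_mul_of_nonneg_left (mul_le_mul h4 h1 (Real.exp_pos _).le (by positivity)) ha0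
    linarith
  · have h1 : Tendsto (fun n => cutoff (c n * powerCoord α x)) atTop (𝓝 1) := by
      have := (cutoff.continuous.tendsto _).comp (hct.mul_const (powerCoord α x))
      rwa [zero_mul, cutoff_zero] at this
    simpa [ψ] using h1.mul_const (Real.exp (-(θ * powerCoord α x)))
  · have hl : Tendsto (fun n => c n * powerCoord α x) atTop (𝓝 0) := by
      simpa using hct.mul_const (powerCoord α x)
    have h1 : Tendsto (fun n => cutoff (c n * powerCoord α x)) atTop (𝓝 1) := by
      have := (cutoff.continuous.tendsto _).comp hl
      rwa [cutoff_zero] at this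
    have h2 : Tendsto (fun n => deriv cutoff (c n * powerCoord α x)) atTop
        (𝓝 (deriv cutoff 0)) :=
      (((contDiff_cutoff (n := 1)).continuous_deriv (by norm_num)).tendsto _).comp hl
    have h3 : Tendsto (fun n => deriv (deriv cutoff) (c n * powerCoord α x)) atTop
        (𝓝 (deriv (deriv cutoff) 0)) := by
      have := (contDiff_cutoff (n := 2)).continuous_iteratedDeriv 2 (by norm_num)
      rw [iteratedDeriv_succ, iteratedDeriv_one] at this
      exact (this.tendsto _).comp hl
    simp only [ψ, deriv_cutoff_mul_exp, iteratedDeriv_two_cutoff_mul_exp]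
    have := ((((((hct.pow 2).mul h3).sub (((hct.const_mul 2).mul_const θ).mul h2)).add
      (h1.const_mul (θ ^ 2))).mul_const (Real.exp (-(θ * powerCoord α x)))).const_mul
      (powerCoord α x)).add ((((hct.mul h2).sub (h1.const_mul θ)).mul_const
      (Real.exp (-(θ * powerCoord α x)))).const_mul a)
    refine this.trans_eq ?_
    congr 1; ring

end ExpLimit

/-! ### The Laplace transform by the method of characteristics -/

section Laplace

variable {Ω : Type*} [MeasurableSpace Ω] {P : Measure Ω} [IsProbabilityMeasure P]
  {Y : ℝ → Ω → ℝ} {a y : ℝ}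

theorem continuousAt_integral_exp_neg (hc : ∀ ω, Continuous fun t => Y t ω)
    (hm : ∀ t, Measurable (Y t)) (h0 : ∀ t ω, 0 ≤ Y t ω) {p : ℝ × ℝ} (hp : 0 < p.2) :
    ContinuousAt (fun p : ℝ × ℝ => ∫ ω, Real.exp (-(p.2 * Y p.1 ω)) ∂P) p := by
  refine continuousAt_of_dominated (bound := fun _ => 1) (Eventually.of_forall fun q => ?_) ?_
    (integrable_const _) (Eventually.of_forall fun ω => ?_)
  · have := hm q.1
    exact Measurable.aestronglyMeasurable (by fun_prop)
  · filter_upwards [continuous_snd.continuousAt.eventually (lt_mem_nhds hp)] with q hq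
    refine Eventually.of_forall fun ω => ?_
    rw [Real.norm_eq_abs, Real.abs_exp]
    exact Real.exp_le_one_iff.2 (neg_nonpos.2 (mul_nonneg (le_of_lt hq) (h0 _ _)))
  · have := (hc ω).comp (continuous_fst (X := ℝ) (Y := ℝ))
    simp only [Function.comp_def] at this
    exact Continuous.continuousAt (by fun_prop)

theorem norm_mul_exp_neg_le {θ θ₀ x : ℝ} (hθ : 0 < θ₀) (h : θ₀ < θ) (hx : 0 ≤ x) :
    ‖x * Real.exp (-(θ * x))‖ ≤ 1 / θ₀ := by
  rw [Real.norm_of_nonneg (mul_nonneg hx (Real.exp_pos _).le)]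
  refine le_trans ?_ (mul_exp_neg_mul_le (y := x) hθ)
  gcongr

theorem continuousAt_integral_mul_exp_neg (hc : ∀ ω, Continuous fun t => Y t ω)
    (hm : ∀ t, Measurable (Y t)) (h0 : ∀ t ω, 0 ≤ Y t ω) {p : ℝ × ℝ} (hp : 0 < p.2) :
    ContinuousAt (fun p : ℝ × ℝ => ∫ ω, Y p.1 ω * Real.exp (-(p.2 * Y p.1 ω)) ∂P) p := by
  refine continuousAt_of_dominated (bound := fun _ => 1 / (p.2 / 2))
    (Eventually.of_forall fun q => ?_) ?_ (integrable_const _) (Eventually.of_forall fun ω => ?_)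
  · have := hm q.1
    exact Measurable.aestronglyMeasurable (by fun_prop)
  · filter_upwards [continuous_snd.continuousAt.eventually (lt_mem_nhds (half_lt_self hp))]
      with q hq
    exact Eventually.of_forall fun ω => norm_mul_exp_neg_le (half_pos hp) hq (h0 _ _)
  · have := (hc ω).comp (continuous_fst (X := ℝ) (Y := ℝ))
    simp only [Function.comp_def] at this
    exact Continuous.continuousAt (by fun_prop)

theorem hasDerivAt_integral_exp_neg (hm : ∀ t, Measurable (Y t)) (h0 : ∀ t ω, 0 ≤ Y t ω)
    (t : ℝ) {θ : ℝ} (hθ : 0 < θ) :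
    HasDerivAt (fun θ => ∫ ω, Real.exp (-(θ * Y t ω)) ∂P)
      (-∫ ω, Y t ω * Real.exp (-(θ * Y t ω)) ∂P) θ := by
  rw [← integral_neg]
  have hmt := hm t
  refine (hasDerivAt_integral_of_dominated_loc_of_deriv_le (bound := fun _ => 1 / (θ / 2))
    (F' := fun θ ω => -(Y t ω * Real.exp (-(θ * Y t ω))))
    (Ioi_mem_nhds (half_lt_self hθ)) (Eventually.of_forall fun q => ?_) ?_ ?_
    (Eventually.of_forall fun ω q hq => ?_) (integrable_const _)
    (Eventually.of_forall fun ω q hq => ?_)).2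
  · exact Measurable.aestronglyMeasurable (by fun_prop)
  · refine Integrable.of_bound (Measurable.aestronglyMeasurable (by fun_prop)) 1
      (Eventually.of_forall fun ω => ?_)
    rw [Real.norm_eq_abs, Real.abs_exp]
    exact Real.exp_le_one_iff.2 (neg_nonpos.2 (mul_nonneg hθ.le (h0 _ _)))
  · exact Measurable.aestronglyMeasurable (by fun_prop)
  · rw [norm_neg]
    exact norm_mul_exp_neg_le (half_pos hθ) hq (h0 _ _)
  · have : HasDerivAt (fun q => -(q * Y t ω)) (-(Y t ω)) q := by
      simpa using ((hasDerivAt_id q).mul_const (Y t ω)).fun_neg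
    exact this.exp.congr_deriv (by ring)

/-- Fubini moves the expectation inside the time integral. With `V = E exp(-θ Y)` and `W = E [Y
exp(-θ Y)] = -∂_θ V`, this is the integrated form of `∂_t V = θ² W - a θ V`. -/
theorem integral_exp_neg_eq_add_intervalIntegral (hc : ∀ ω, Continuous fun t => Y t ω)
    (hm : ∀ t, Measurable (Y t)) (h0 : ∀ t ω, 0 ≤ Y t ω) {θ t : ℝ} (hθ : 0 < θ)
    (h : ∫ ω, (Real.exp (-(θ * Y t ω)) - Real.exp (-(θ * Y 0 ω))
      - ∫ s in (0 : ℝ)..t, (θ ^ 2 * Y s ω - a * θ) * Real.exp (-(θ * Y s ω))) ∂P = 0) :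
    ∫ ω, Real.exp (-(θ * Y t ω)) ∂P = ∫ ω, Real.exp (-(θ * Y 0 ω)) ∂P
      + ∫ s in (0 : ℝ)..t, (θ ^ 2 * (∫ ω, Y s ω * Real.exp (-(θ * Y s ω)) ∂P)
        - a * θ * ∫ ω, Real.exp (-(θ * Y s ω)) ∂P) := by
  have hi1 : ∀ s, Integrable (fun ω => Real.exp (-(θ * Y s ω))) P := fun s => by
    have := hm s
    refine Integrable.of_bound (Measurable.aestronglyMeasurable (by fun_prop)) 1
      (Eventually.of_forall fun ω => ?_)
    rw [Real.norm_eq_abs, Real.abs_exp]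
    exact Real.exp_le_one_iff.2 (neg_nonpos.2 (mul_nonneg hθ.le (h0 _ _)))
  have hi2 : ∀ s, Integrable (fun ω => Y s ω * Real.exp (-(θ * Y s ω))) P := fun s => by
    have := hm s
    exact Integrable.of_bound (Measurable.aestronglyMeasurable (by fun_prop)) (1 / (θ / 2))
      (Eventually.of_forall fun ω => norm_mul_exp_neg_le (half_pos hθ) (half_lt_self hθ) (h0 _ _))
  have hmu : Measurable (fun p : ℝ × Ω => Y p.1 p.2) :=
    measurable_uncurry_of_continuous_of_measurable hc hm
  have : IsFiniteMeasure (volume.restrict (uIoc 0 t)) := ⟨by simp [uIoc]⟩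
  have hint : Integrable (Function.uncurry fun s ω =>
      (θ ^ 2 * Y s ω - a * θ) * Real.exp (-(θ * Y s ω)))
      ((volume.restrict (uIoc 0 t)).prod P) := by
    refine Integrable.of_bound (Measurable.aestronglyMeasurable ?_)
      (θ ^ 2 * (1 / (θ / 2)) + |a * θ| * 1) (Eventually.of_forall fun p => ?_)
    · simp only [Function.uncurry_def]; fun_prop
    · simp only [Function.uncurry_def, sub_mul]
      refine (norm_sub_le _ _).trans (add_le_add ?_ ?_)
      · rw [mul_assoc, norm_mul, Real.norm_of_nonneg (by positivity)]
        gcongr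
        exact norm_mul_exp_neg_le (half_pos hθ) (half_lt_self hθ) (h0 _ _)
      · rw [norm_mul, Real.norm_eq_abs (Real.exp _), Real.abs_exp]
        refine mul_le_mul_of_nonneg_left ?_ (abs_nonneg _)
        exact Real.exp_le_one_iff.2 (neg_nonpos.2 (mul_nonneg hθ.le (h0 _ _)))
  have hint' : Integrable (fun ω =>
      ∫ s in (0 : ℝ)..t, (θ ^ 2 * Y s ω - a * θ) * Real.exp (-(θ * Y s ω))) P := by
    have := hint.integral_prod_right
    simp only [Function.uncurry_def] at this
    simp only [intervalIntegral.intervalIntegral_eq_integral_uIoc]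
    exact (this.smul (if 0 ≤ t then (1 : ℝ) else -1)).congr (Eventually.of_forall fun ω => rfl)
  have h4 := integral_sub ((hi1 t).sub (hi1 0)) hint'
  simp only [Pi.sub_apply] at h4
  rw [h4, integral_sub (hi1 t) (hi1 0),
    ← intervalIntegral_integral_swap hint] at h
  have h3 : ∀ s, ∫ ω, (θ ^ 2 * Y s ω - a * θ) * Real.exp (-(θ * Y s ω)) ∂P
      = θ ^ 2 * (∫ ω, Y s ω * Real.exp (-(θ * Y s ω)) ∂P)
        - a * θ * ∫ ω, Real.exp (-(θ * Y s ω)) ∂P := fun s => by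
    rw [← integral_const_mul, ← integral_const_mul,
      ← integral_sub ((hi2 s).const_mul _) ((hi1 s).const_mul _)]
    congr 1; ext ω; ring
  simp only [h3] at h
  linarith

/-- Along the solution `τ` of `τ' = τ²` with `τ(T) = θ`, the equation for `V` reduces to `d/ds V(s,
τ(s)) = -a τ V`. The factor `(1 + θ (T - s)) ^ (-a)` compensates this decay, so the product is
constant; its values at `s = T` and `s = 0` are the two sides. -/
theorem integral_exp_neg_eq (hc : ∀ ω, Continuous fun t => Y t ω)
    (hm : ∀ t, Measurable (Y t)) (h0 : ∀ t ω, 0 ≤ Y t ω) (hy : ∀ᵐ ω ∂P, Y 0 ω = y)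
    (h : ∀ t θ : ℝ, 0 ≤ t → 0 < θ → ∫ ω, (Real.exp (-(θ * Y t ω)) - Real.exp (-(θ * Y 0 ω))
      - ∫ s in (0 : ℝ)..t, (θ ^ 2 * Y s ω - a * θ) * Real.exp (-(θ * Y s ω))) ∂P = 0)
    {T θ : ℝ} (hT : 0 < T) (hθ : 0 < θ) :
    ∫ ω, Real.exp (-(θ * Y T ω)) ∂P
      = (1 + θ * T) ^ (-a) * Real.exp (-(θ / (1 + θ * T) * y)) := by
  set V : ℝ → ℝ → ℝ := fun t θ => ∫ ω, Real.exp (-(θ * Y t ω)) ∂P with hV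
  set W : ℝ → ℝ → ℝ := fun t θ => ∫ ω, Y t ω * Real.exp (-(θ * Y t ω)) ∂P with hW
  have cV : ∀ p : ℝ × ℝ, 0 < p.2 → ContinuousAt (fun p : ℝ × ℝ => V p.1 p.2) p :=
    fun p hp => continuousAt_integral_exp_neg hc hm h0 hp
  have cW : ∀ p : ℝ × ℝ, 0 < p.2 → ContinuousAt (fun p : ℝ × ℝ => W p.1 p.2) p :=
    fun p hp => continuousAt_integral_mul_exp_neg hc hm h0 hp
  have dθ : ∀ t θ, 0 < θ → HasDerivAt (V t) (-W t θ) θ := fun t θ hθ =>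
    hasDerivAt_integral_exp_neg hm h0 t hθ
  have cΦ : ∀ p : ℝ × ℝ, 0 < p.2 →
      ContinuousAt (fun p : ℝ × ℝ => p.2 ^ 2 * W p.1 p.2 - a * p.2 * V p.1 p.2) p :=
    fun p hp => ((continuousAt_snd.pow 2).mul (cW p hp)).sub
      ((continuousAt_snd.const_mul a).mul (cV p hp))
  have dt : ∀ t θ, 0 < t → 0 < θ →
      HasDerivAt (fun t => V t θ) (θ ^ 2 * W t θ - a * θ * V t θ) t := by
    intro t θ ht hθ
    have hcont : Continuous fun s => θ ^ 2 * W s θ - a * θ * V s θ :=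
      continuous_iff_continuousAt.2 fun s =>
        ContinuousAt.comp (f := fun s : ℝ => (s, θ)) (x := s) (cΦ (s, θ) hθ)
          (by fun_prop)
    have h1 := (intervalIntegral.integral_hasDerivAt_right (hcont.intervalIntegrable 0 t)
      (hcont.stronglyMeasurableAtFilter _ _) hcont.continuousAt).const_add (V 0 θ)
    refine h1.congr_of_eventuallyEq ?_
    filter_upwards [lt_mem_nhds ht] with s hs
    exact integral_exp_neg_eq_add_intervalIntegral hc hm h0 hθ (h s θ hs.le hθ)
  set τ : ℝ → ℝ := fun s => θ / (1 + θ * (T - s)) with hτ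
  have hpos : ∀ s ≤ T, 0 < 1 + θ * (T - s) := fun s hs => by
    have := mul_nonneg hθ.le (sub_nonneg.2 hs); linarith
  have hτ0 : ∀ s ≤ T, 0 < τ s := fun s hs => div_pos hθ (hpos s hs)
  have dl : ∀ s, HasDerivAt (fun s => 1 + θ * (T - s)) (-θ) s := fun s => by
    simpa using (((hasDerivAt_id s).const_sub T).const_mul θ).const_add 1
  have dτ : ∀ s ≤ T, HasDerivAt τ (τ s ^ 2) s := fun s hs => by
    have := hpos s hs
    refine ((hasDerivAt_const s θ).div (dl s) (hpos s hs).ne').congr_deriv ?_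
    simp only [hτ]; field_simp; ring
  have dc : ∀ s ≤ T, HasDerivAt (fun s => (1 + θ * (T - s)) ^ (-a))
      (a * τ s * (1 + θ * (T - s)) ^ (-a)) s := fun s hs => by
    have := hpos s hs
    refine ((dl s).rpow_const (Or.inl (hpos s hs).ne')).congr_deriv ?_
    rw [Real.rpow_sub_one this.ne']
    simp only [hτ]; field_simp
  have cτ : ∀ s ≤ T, ContinuousAt (fun s => V s (τ s)) s := fun s hs =>
    ContinuousAt.comp (f := fun s : ℝ => (s, τ s)) (x := s) (cV (s, τ s) (hτ0 s hs))
      (continuousAt_id.prodMk (dτ s hs).continuousAt)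
  have dV : ∀ s, 0 < s → s ≤ T → HasDerivAt (fun s => V s (τ s))
      (-a * τ s * V s (τ s)) s := fun s hs0 hs => by
    -- The chain rule along the curve needs joint differentiability of `V`, which follows from
    -- continuity of both partial derivatives.
    have hst := hasStrictFDerivAt_uncurry_coprod (𝕜 := ℝ) (u := (s, τ s)) (f := V)
      (f₁ := fun t θ => ContinuousLinearMap.toSpanSingleton ℝ (θ ^ 2 * W t θ - a * θ * V t θ))
      (f₂ := fun t θ => ContinuousLinearMap.toSpanSingleton ℝ (-W t θ)) ?_ ?_ ?_ ?_
    · have := hst.hasFDerivAt.comp_hasDerivAt s ((hasDerivAt_id s).prodMk (dτ s hs))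
      refine this.congr_deriv ?_
      simp [Function.HasUncurry.uncurry]
      ring
    · have e1 : ∀ᶠ v : ℝ × ℝ in 𝓝 (s, τ s), 0 < v.1 :=
        continuous_fst.continuousAt.eventually (lt_mem_nhds hs0)
      have e2 : ∀ᶠ v : ℝ × ℝ in 𝓝 (s, τ s), 0 < v.2 :=
        continuous_snd.continuousAt.eventually (lt_mem_nhds (hτ0 s hs))
      filter_upwards [e1, e2] with v h1 h2
      exact (dt v.1 v.2 h1 h2).hasFDerivAt
    · have e2 : ∀ᶠ v : ℝ × ℝ in 𝓝 (s, τ s), 0 < v.2 :=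
        continuous_snd.continuousAt.eventually (lt_mem_nhds (hτ0 s hs))
      filter_upwards [e2] with v h2
      exact (dθ v.1 v.2 h2).hasFDerivAt
    · exact ((ContinuousLinearMap.toSpanSingletonCLE (𝕜 := ℝ) (E := ℝ)).continuous.continuousAt).comp
        (cΦ (s, τ s) (hτ0 s hs))
    · exact ((ContinuousLinearMap.toSpanSingletonCLE (𝕜 := ℝ) (E := ℝ)).continuous.continuousAt).comp
        (cW (s, τ s) (hτ0 s hs)).neg
  have dH : ∀ s, 0 < s → s ≤ T →
      HasDerivAt (fun s => (1 + θ * (T - s)) ^ (-a) * V s (τ s)) 0 s := fun s hs0 hs =>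
    ((dc s hs).mul (dV s hs0 hs)).congr_deriv (by ring)
  -- The mean value theorem uses the derivative only inside `(0, T)`, so continuity suffices at `s =
  -- 0`, where the time derivative was not computed.
  obtain ⟨s, hs, hs'⟩ := exists_hasDerivAt_eq_slope
    (fun s => (1 + θ * (T - s)) ^ (-a) * V s (τ s)) (fun _ => 0) hT
    (fun s hs => ((dc s hs.2).continuousAt.mul (cτ s hs.2)).continuousWithinAt)
    (fun s hs => dH s hs.1 hs.2.le)
  rw [eq_comm, div_eq_zero_iff, or_iff_left (by linarith), sub_eq_zero] at hs'
  simp only [hτ, sub_self, mul_zero, add_zero, Real.one_rpow, one_mul, div_one, sub_zero] at hs'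
  refine hs'.trans ?_
  congr 1
  simp only [hV]
  rw [integral_congr_ae (g := fun _ => Real.exp (-(θ / (1 + θ * T) * y)))]
  · simp
  · filter_upwards [hy] with ω hω
    rw [hω]

end Laplace

theorem hasSum_iff_of_eq {f g : ℕ → ℝ} {s : ℝ} (h : ∀ k, f k = g k) :
    HasSum f s ↔ HasSum g s := by
  rw [funext h]

/-! ### The modified Bessel series -/

section BesselSeries

variable {a : ℝ}

/-- The modified Bessel series `∑ w ^ k / (k! Γ(a + k))`. -/
noncomputable def besselSeries (a w : ℝ) : ℝ := ∑' k : ℕ, w ^ k / (k ! * Real.Gamma (a + k))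

theorem Gamma_add_nat_pos (ha : 0 < a) (k : ℕ) : 0 < Real.Gamma (a + k) :=
  Real.Gamma_pos_of_pos (by positivity)

theorem Gamma_add_nat_succ (ha : 0 < a) (k : ℕ) :
    Real.Gamma (a + (k + 1 : ℕ)) = (a + k) * Real.Gamma (a + k) := by
  rw [← Real.Gamma_add_one (by positivity)]
  push_cast; ring_nf

/-- Follows from `Γ(a + k + 1) = (a + k) Γ(a + k)` and `a + k ≥ min a 1 * (k + 1)`. Though crude, it
reduces summability to the exponential series. -/
theorem le_Gamma_add_nat (ha : 0 < a) (k : ℕ) :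
    Real.Gamma a * min a 1 ^ k * k ! ≤ Real.Gamma (a + k) := by
  induction k with
  | zero => simp
  | succ k ih =>
    have hm : 0 < min a 1 := lt_min ha one_pos
    have hG := Real.Gamma_pos_of_pos ha
    rw [Gamma_add_nat_succ ha, Nat.factorial_succ]
    have h1 : min a 1 * (k + 1) ≤ a + k := by
      have := min_le_left a 1
      have h2 := mul_le_mul_of_nonneg_right (min_le_right a 1) (Nat.cast_nonneg (α := ℝ) k)
      linarith
    calc _ = (min a 1 * (k + 1)) * (Real.Gamma a * min a 1 ^ k * k !) := by push_cast; ring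
      _ ≤ _ := mul_le_mul h1 ih (by positivity) (by positivity)

theorem summable_pow_div_Gamma (ha : 0 < a) (w : ℝ) :
    Summable fun k : ℕ => w ^ k / Real.Gamma (a + k) := by
  have hm : 0 < min a 1 := lt_min ha one_pos
  have hG := Real.Gamma_pos_of_pos ha
  refine Summable.of_norm_bounded
    ((Real.summable_pow_div_factorial (|w| / min a 1)).mul_left (1 / Real.Gamma a)) fun k => ?_
  rw [norm_div, norm_pow, Real.norm_eq_abs, Real.norm_of_nonneg (Gamma_add_nat_pos ha k).le]
  calc |w| ^ k / Real.Gamma (a + k) ≤ |w| ^ k / (Real.Gamma a * min a 1 ^ k * k !) := by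
        refine div_le_div_of_nonneg_left (by positivity) (by positivity) (le_Gamma_add_nat ha k)
    _ = _ := by rw [div_pow]; field_simp

theorem summable_besselSeries (ha : 0 < a) (w : ℝ) :
    Summable fun k : ℕ => w ^ k / (k ! * Real.Gamma (a + k)) := by
  refine Summable.of_norm_bounded (summable_pow_div_Gamma ha |w|) fun k => ?_
  have h1 := Gamma_add_nat_pos ha k
  rw [norm_div, norm_pow, Real.norm_eq_abs, Real.norm_of_nonneg (by positivity)]
  refine div_le_div_of_nonneg_left (by positivity) h1 (le_mul_of_one_le_left h1.le ?_)
  exact_mod_cast k.factorial_pos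

theorem hasSum_besselSeries (ha : 0 < a) (w : ℝ) :
    HasSum (fun k : ℕ => w ^ k / (k ! * Real.Gamma (a + k))) (besselSeries a w) :=
  (summable_besselSeries ha w).hasSum

theorem besselSeries_nonneg (ha : 0 < a) {w : ℝ} (hw : 0 ≤ w) : 0 ≤ besselSeries a w :=
  tsum_nonneg fun k => div_nonneg (pow_nonneg hw k)
    (mul_nonneg (by positivity) (Gamma_add_nat_pos ha k).le)

/-- Shifting the index by one absorbs the factor `k` into the factorial and moves the parameter from
`a` to `a + 1`. -/
theorem hasSum_deriv_besselSeries (ha : 0 < a) (w : ℝ) :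
    HasSum (fun k : ℕ => k * w ^ (k - 1) / (k ! * Real.Gamma (a + k)))
      (besselSeries (a + 1) w) := by
  rw [← hasSum_nat_add_iff' 1]
  simp only [Finset.range_one, Finset.sum_singleton, Nat.cast_zero, zero_mul, zero_div, sub_zero]
  refine (hasSum_iff_of_eq fun k => ?_).mpr (hasSum_besselSeries (by positivity : 0 < a + 1) w)
  rw [Nat.add_sub_cancel, Nat.factorial_succ, Nat.cast_mul, mul_assoc,
    mul_div_mul_left _ _ (by positivity)]
  congr 3; push_cast; ring

theorem hasDerivAt_besselSeries (ha : 0 < a) (w : ℝ) :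
    HasDerivAt (besselSeries a) (besselSeries (a + 1) w) w := by
  obtain ⟨R, hR⟩ := exists_gt |w|
  have hR0 : 0 < R := (abs_nonneg w).trans_lt hR
  have h := hasDerivAt_tsum_of_isPreconnected (𝕜 := ℝ) (F := ℝ)
    (u := fun k : ℕ => k * R ^ (k - 1) / (k ! * Real.Gamma (a + k))) (t := Ioo (-R) R)
    (g := fun k w => w ^ k / (k ! * Real.Gamma (a + k)))
    (g' := fun k w => k * w ^ (k - 1) / (k ! * Real.Gamma (a + k))) (y₀ := 0) (y := w)
    (hasSum_deriv_besselSeries ha R).summable isOpen_Ioo isPreconnected_Ioo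
    (fun k y _ => (hasDerivAt_pow k y).div_const _) (fun k y hy => ?_) ⟨by linarith, hR0⟩
    (summable_besselSeries ha 0) (abs_lt.1 hR)
  · rwa [(hasSum_deriv_besselSeries ha w).tsum_eq] at h
  · have h1 := Gamma_add_nat_pos ha k
    rw [norm_div, norm_mul, norm_pow, Real.norm_natCast, Real.norm_eq_abs y,
      Real.norm_of_nonneg (by positivity)]
    gcongr
    exact (abs_lt.2 hy).le

theorem continuous_besselSeries (ha : 0 < a) : Continuous (besselSeries a) :=
  continuous_iff_continuousAt.2 fun w => (hasDerivAt_besselSeries ha w).continuousAt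

/-- The right-hand side is what differentiating the transition density produces. The series form
keeps the centred factor `k - u`, and hence the Poisson cancellation. -/
theorem hasSum_sub_mul_besselSeries (ha : 0 < a) (u v : ℝ) :
    HasSum (fun k : ℕ => (k - u) * (u * v) ^ k / (k ! * Real.Gamma (a + k)))
      (u * (v * besselSeries (a + 1) (u * v) - besselSeries a (u * v))) := by
  have h := ((hasSum_deriv_besselSeries ha (u * v)).mul_left (u * v)).sub
    ((hasSum_besselSeries ha (u * v)).mul_left u)
  rw [show u * (v * besselSeries (a + 1) (u * v) - besselSeries a (u * v))
    = u * v * besselSeries (a + 1) (u * v) - u * besselSeries a (u * v) by ring]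
  refine (hasSum_iff_of_eq fun k => ?_).mpr h
  rcases k with _ | k
  · simp; ring
  · simp only [Nat.add_sub_cancel, pow_succ]; ring

/-- Each `v ^ k exp(-v) / k!` is at most `1`. The bound is independent of `v`, so the density is
bounded in the target point. -/
theorem besselSeries_mul_exp_le (ha : 0 < a) {u v : ℝ} (hu : 0 ≤ u) (hv : 0 ≤ v) :
    besselSeries a (u * v) * Real.exp (-v) ≤ ∑' k : ℕ, u ^ k / Real.Gamma (a + k) := by
  rw [besselSeries, ← tsum_mul_right]
  refine Summable.tsum_le_tsum (fun k => ?_) ((summable_besselSeries ha _).mul_right _)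
    (summable_pow_div_Gamma ha u)
  have h1 := Gamma_add_nat_pos ha k
  have h2 : v ^ k / k ! * Real.exp (-v) ≤ 1 := by
    rw [Real.exp_neg, ← div_eq_mul_inv]
    exact div_le_one_of_le₀ (Real.pow_div_factorial_le_exp _ hv _) (Real.exp_pos _).le
  calc _ = u ^ k / Real.Gamma (a + k) * (v ^ k / k ! * Real.exp (-v)) := by
        rw [mul_pow]; field_simp
    _ ≤ _ := mul_le_of_le_one_right (by positivity) h2

end BesselSeries

/-! ### Mean and variance of the Poisson law -/

section PoissonMoments

variable (u : ℝ)

theorem hasSum_poisson : HasSum (fun k : ℕ => u ^ k / k ! * Real.exp (-u)) 1 := by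
  have := (NormedSpace.expSeries_div_hasSum_exp (u : ℝ)).mul_right (Real.exp (-u))
  rw [← Real.exp_eq_exp_ℝ] at this
  rwa [← Real.exp_add, add_neg_cancel, Real.exp_zero] at this

theorem hasSum_nat_mul_poisson : HasSum (fun k : ℕ => k * (u ^ k / k ! * Real.exp (-u))) u := by
  rw [← hasSum_nat_add_iff' 1]
  have := (hasSum_poisson u).mul_left u
  simp only [Finset.range_one, Finset.sum_singleton, Nat.cast_zero, zero_mul, sub_zero]
  rw [mul_one] at this
  refine (hasSum_iff_of_eq fun k => ?_).mpr this
  rw [Nat.factorial_succ, pow_succ]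
  push_cast
  field_simp

theorem hasSum_sq_sub_mul_poisson :
    HasSum (fun k : ℕ => (k - u) ^ 2 * (u ^ k / k ! * Real.exp (-u))) u := by
  have h2 : HasSum (fun k : ℕ => (k : ℝ) * (k - 1) * (u ^ k / k ! * Real.exp (-u))) (u ^ 2) := by
    rw [← hasSum_nat_add_iff' 2]
    have := (hasSum_poisson u).mul_left (u ^ 2)
    rw [mul_one] at this
    simp only [Finset.sum_range_succ, Finset.range_zero, Finset.sum_empty, Nat.cast_zero,
      Nat.cast_one, zero_mul, sub_self, mul_zero, add_zero, sub_zero]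
    refine (hasSum_iff_of_eq fun k => ?_).mpr this
    rw [Nat.factorial_succ, Nat.factorial_succ, pow_add]
    push_cast
    field_simp
    ring
  have := ((h2.add ((hasSum_nat_mul_poisson u).mul_left (1 - 2 * u))).add
    ((hasSum_poisson u).mul_left (u ^ 2)))
  rw [show u ^ 2 + (1 - 2 * u) * u + u ^ 2 * 1 = u by ring] at this
  exact (hasSum_iff_of_eq fun k => by ring).mpr this

end PoissonMoments

/-! ### Gamma moments of the weighted measure -/

section Moments

variable {α r : ℝ}

/-- The shape parameter of the squared Bessel process associated with `x ^ α f''`. -/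
noncomputable def shape (α : ℝ) : ℝ := (1 - α) / (2 - α)

theorem shape_pos (hα : α < 1) : 0 < shape α := div_pos (by linarith) (by linarith)

theorem shape_le_one (hα : α < 1) : shape α ≤ 1 := by
  rw [shape, div_le_one (by linarith)]; linarith

/-- The one-dimensional factor of the weighted measure. -/
noncomputable def speedMeasure (α : ℝ) : Measure ℝ :=
  (volume.restrict (Ici (0 : ℝ))).withDensity fun s => ENNReal.ofReal (s ^ (-α))

instance : SigmaFinite (speedMeasure α) := by
  unfold speedMeasure; infer_instance

theorem ae_speedMeasure_pos : ∀ᵐ x ∂speedMeasure α, 0 < x := by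
  refine (withDensity_absolutelyContinuous _ _).ae_le ?_
  rw [← restrict_Ioi_eq_restrict_Ici]
  exact ae_restrict_mem measurableSet_Ioi

theorem lintegral_speedMeasure {F : ℝ → ℝ≥0∞} (hF : Measurable F) :
    ∫⁻ z, F z ∂speedMeasure α = ∫⁻ z in Ioi 0, ENNReal.ofReal (z ^ (-α)) * F z := by
  rw [speedMeasure, lintegral_withDensity_eq_lintegral_mul _ (by fun_prop) hF,
    restrict_Ioi_eq_restrict_Ici]
  rfl

theorem lintegral_speedMeasure_ofReal {F : ℝ → ℝ} (hF : Measurable F)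
    (hi : IntegrableOn (fun z => F z * z ^ (-α)) (Ioi 0)) (h0 : ∀ z, 0 < z → 0 ≤ F z) :
    ∫⁻ z, ENNReal.ofReal (F z) ∂speedMeasure α
      = ENNReal.ofReal (∫ z in Ioi 0, F z * z ^ (-α)) := by
  rw [lintegral_speedMeasure (by fun_prop), ofReal_integral_eq_lintegral_ofReal hi]
  · refine setLIntegral_congr_fun measurableSet_Ioi fun z hz => ?_
    rw [ENNReal.ofReal_mul (h0 z hz), mul_comm]
  · filter_upwards [ae_restrict_mem measurableSet_Ioi] with z hz
    exact mul_nonneg (h0 z hz) (Real.rpow_nonneg (le_of_lt hz) _)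

theorem moment_integrand_eq (k : ℕ) {x : ℝ} (hx : 0 < x) :
    (r * x ^ (2 - α)) ^ k * Real.exp (-(r * x ^ (2 - α))) * x ^ (-α)
      = r ^ k * (x ^ ((2 - α) * k - α) * Real.exp (-r * x ^ (2 - α))) := by
  rw [mul_pow, ← Real.rpow_natCast (x ^ (2 - α)) k, ← Real.rpow_mul hx.le,
    sub_eq_add_neg ((2 - α) * k), Real.rpow_add hx, neg_mul]
  ring

theorem integrableOn_moment (hα : α < 1) (hr : 0 < r) (k : ℕ) :
    IntegrableOn (fun x : ℝ => (r * x ^ (2 - α)) ^ k * Real.exp (-(r * x ^ (2 - α))) * x ^ (-α))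
      (Ioi 0) := by
  refine IntegrableOn.congr_fun ?_ (fun x hx => (moment_integrand_eq k hx).symm)
    measurableSet_Ioi
  refine (integrableOn_rpow_mul_exp_neg_mul_rpow ?_ (by linarith) hr).const_mul _
  have : 0 ≤ (2 - α) * k := mul_nonneg (by linarith) k.cast_nonneg
  linarith

/-- In the variable `u = r x ^ (2 - α)` the measure `x ^ (-α) dx` becomes `r ^ (-a) / (2 - α) * u ^
(a - 1) du`, with `a = shape α`. The resulting `Γ(a + k)` is the one in the denominators of the
Bessel series. -/
theorem integral_moment (hα : α < 1) (hr : 0 < r) (k : ℕ) :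
    ∫ x in Ioi (0 : ℝ), (r * x ^ (2 - α)) ^ k * Real.exp (-(r * x ^ (2 - α))) * x ^ (-α)
      = r ^ (-shape α) / (2 - α) * Real.Gamma (shape α + k) := by
  have h2 : 0 < 2 - α := by linarith
  have hk : 0 ≤ (2 - α) * k := mul_nonneg h2.le k.cast_nonneg
  rw [setIntegral_congr_fun measurableSet_Ioi fun x hx => moment_integrand_eq k hx,
    integral_const_mul, integral_rpow_mul_exp_neg_mul_rpow h2 (by linarith) hr]
  have e : ((2 - α) * k - α + 1) / (2 - α) = shape α + k := by
    rw [shape]; field_simp; ring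
  rw [neg_div, e, neg_add, Real.rpow_add hr, Real.rpow_neg hr.le (k : ℝ), Real.rpow_natCast]
  field_simp

theorem lintegral_moment (hα : α < 1) (hr : 0 < r) (k : ℕ) :
    ∫⁻ x, ENNReal.ofReal ((r * x ^ (2 - α)) ^ k * Real.exp (-(r * x ^ (2 - α)))) ∂speedMeasure α
      = ENNReal.ofReal (r ^ (-shape α) / (2 - α) * Real.Gamma (shape α + k)) := by
  rw [lintegral_speedMeasure_ofReal (by fun_prop) (integrableOn_moment hα hr k),
    integral_moment hα hr k]
  intro z hz
  positivity

end Moments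

/-! ### The one-dimensional transition density -/

section Kernel

variable {α r x z : ℝ}

/-- The transition density, at time `1 / ((2 - α) ^ 2 r)`, of the reflecting diffusion associated
with `x ^ α f''`, relative to its speed measure. -/
noncomputable def density (α r x z : ℝ) : ℝ :=
  (2 - α) * r ^ shape α * Real.exp (-(r * x ^ (2 - α) + r * z ^ (2 - α)))
    * besselSeries (shape α) (r * x ^ (2 - α) * (r * z ^ (2 - α)))

/-- The derivative of the transition density with respect to the starting point. -/
noncomputable def densityDeriv (α r x z : ℝ) : ℝ :=
  (2 - α) * r ^ shape α * Real.exp (-(r * x ^ (2 - α) + r * z ^ (2 - α)))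
    * ((2 - α) / x * (r * x ^ (2 - α) *
      (r * z ^ (2 - α) * besselSeries (shape α + 1) (r * x ^ (2 - α) * (r * z ^ (2 - α)))
        - besselSeries (shape α) (r * x ^ (2 - α) * (r * z ^ (2 - α))))))

theorem hasDerivAt_density (hα : α < 1) (hx : 0 < x) :
    HasDerivAt (fun x => density α r x z) (densityDeriv α r x z) x := by
  have hu : HasDerivAt (fun x : ℝ => r * x ^ (2 - α)) ((2 - α) / x * (r * x ^ (2 - α))) x := by
    refine ((Real.hasDerivAt_rpow_const (Or.inl hx.ne')).const_mul r).congr_deriv ?_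
    rw [Real.rpow_sub_one hx.ne']
    field_simp
  have h1 := (((hu.add_const (r * z ^ (2 - α))).fun_neg).exp.const_mul
    ((2 - α) * r ^ shape α)).mul ((hasDerivAt_besselSeries (shape_pos hα) _).comp x
      (hu.mul_const (r * z ^ (2 - α))))
  refine h1.congr_deriv ?_
  simp only [densityDeriv, Function.comp_apply]
  ring

theorem density_nonneg (hα : α < 1) (hr : 0 ≤ r) (hx : 0 ≤ x) (hz : 0 ≤ z) :
    0 ≤ density α r x z := by
  have : 0 < 2 - α := by linarith
  have := besselSeries_nonneg (shape_pos hα)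
    (mul_nonneg (mul_nonneg hr (Real.rpow_nonneg hx (2 - α)))
      (mul_nonneg hr (Real.rpow_nonneg hz (2 - α))))
  unfold density; positivity

theorem measurable_density (hα : α < 1) :
    Measurable fun p : ℝ × ℝ × ℝ => density α p.1 p.2.1 p.2.2 := by
  have h := (continuous_besselSeries (shape_pos hα)).measurable
  unfold density
  fun_prop

theorem measurable_densityDeriv (hα : α < 1) :
    Measurable fun p : ℝ × ℝ × ℝ => densityDeriv α p.1 p.2.1 p.2.2 := by
  have h := (continuous_besselSeries (shape_pos hα)).measurable
  have h' := (continuous_besselSeries (a := shape α + 1)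
    (by linarith [shape_pos hα])).measurable
  unfold densityDeriv
  fun_prop

theorem continuousOn_densityDeriv (hα : α < 1) :
    ContinuousOn (fun x => densityDeriv α r x z) (Ioi 0) := by
  have h := continuous_besselSeries (shape_pos hα)
  have h' := continuous_besselSeries (a := shape α + 1) (by linarith [shape_pos hα])
  have hu : ContinuousOn (fun x : ℝ => r * x ^ (2 - α)) (Ioi 0) :=
    continuousOn_const.mul (continuousOn_id.rpow_const fun x hx => Or.inl (ne_of_gt hx))
  have hd : ContinuousOn (fun x : ℝ => (2 - α) / x) (Ioi 0) :=
    continuousOn_const.div continuousOn_id fun x hx => ne_of_gt hx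
  unfold densityDeriv
  fun_prop

theorem density_comm (α r x z : ℝ) : density α r x z = density α r z x := by
  simp only [density, add_comm, mul_comm]

theorem density_le (hα : α < 1) (hr : 0 < r) (hx : 0 ≤ x) (hz : 0 ≤ z) :
    density α r x z ≤ (2 - α) * r ^ shape α * Real.exp (-(r * x ^ (2 - α)))
      * ∑' k : ℕ, (r * x ^ (2 - α)) ^ k / Real.Gamma (shape α + k) := by
  have : 0 < 2 - α := by linarith
  have h := besselSeries_mul_exp_le (shape_pos hα)
    (mul_nonneg hr.le (Real.rpow_nonneg hx (2 - α)))
    (mul_nonneg hr.le (Real.rpow_nonneg hz (2 - α)))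
  rw [density, neg_add, Real.exp_add]
  calc _ = (2 - α) * r ^ shape α * Real.exp (-(r * x ^ (2 - α)))
      * (besselSeries (shape α) (r * x ^ (2 - α) * (r * z ^ (2 - α)))
        * Real.exp (-(r * z ^ (2 - α)))) := by ring
    _ ≤ _ := by gcongr

/-- The density is a Poisson mixture of Gamma laws. A Gamma law of shape `a + k` contributes `(1 +
s) ^ (-(a + k))`, and the sum over `k` is a Poisson generating function. With `s = θ t` this is the
transform found by characteristics. -/
theorem lintegral_exp_mul_density (hα : α < 1) (hr : 0 < r) (hx : 0 ≤ x) {s : ℝ} (hs : 0 ≤ s) :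
    ∫⁻ z, ENNReal.ofReal (Real.exp (-(s * (r * z ^ (2 - α)))) * density α r x z) ∂speedMeasure α
      = ENNReal.ofReal ((1 + s) ^ (-shape α)
        * Real.exp (-(s / (1 + s) * (r * x ^ (2 - α))))) := by
  have h2 : 0 < 2 - α := by linarith
  have hs1 : 0 < 1 + s := by linarith
  have ha := shape_pos hα
  set u := r * x ^ (2 - α) with hu
  have hu0 : 0 ≤ u := by positivity
  -- The factor `exp (-s r z ^ (2 - α))` is absorbed by replacing the rate `r` with `r (1 + s)`;
  -- division by `(1 + s) ^ k` undoes the change in the `k`-th power.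
  set c : ℕ → ℝ := fun k => (2 - α) * r ^ shape α * Real.exp (-u) * (u ^ k / (k !
      * Real.Gamma (shape α + k))) / (1 + s) ^ k with hc
  have hG : ∀ k : ℕ, 0 < Real.Gamma (shape α + k) := Gamma_add_nat_pos ha
  have hc0 : ∀ k, 0 ≤ c k := fun k => by have := hG k; positivity
  set g : ℕ → ℝ → ℝ := fun k z => (r * (1 + s) * z ^ (2 - α)) ^ k
    * Real.exp (-(r * (1 + s) * z ^ (2 - α))) with hg
  have e1 : ∀ z, 0 < z → ENNReal.ofReal (Real.exp (-(s * (r * z ^ (2 - α)))) * density α r x z)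
      = ∑' k, ENNReal.ofReal (c k) * ENNReal.ofReal (g k z) := by
    intro z hz
    have hsum := (hasSum_besselSeries ha (u * (r * z ^ (2 - α)))).mul_left
      ((2 - α) * r ^ shape α * Real.exp (-u) * Real.exp (-(r * (1 + s) * z ^ (2 - α))))
    have e2 : ∀ k, (2 - α) * r ^ shape α * Real.exp (-u) * Real.exp (-(r * (1 + s) * z ^ (2 - α)))
        * ((u * (r * z ^ (2 - α))) ^ k / (k ! * Real.Gamma (shape α + k))) = c k * g k z := by
      intro k
      simp only [hc, hg]
      have := hG k
      simp only [mul_pow]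
      field_simp
    rw [hasSum_iff_of_eq e2] at hsum
    have e3 : Real.exp (-(s * (r * z ^ (2 - α)))) * density α r x z = ∑' k, c k * g k z := by
      rw [hsum.tsum_eq, density, ← hu, neg_add, Real.exp_add,
        show -(r * (1 + s) * z ^ (2 - α)) = -(r * z ^ (2 - α)) + -(s * (r * z ^ (2 - α))) by ring,
        Real.exp_add]
      ring
    rw [e3, ENNReal.ofReal_tsum_of_nonneg (fun k => mul_nonneg (hc0 k) (by positivity))
      hsum.summable]
    exact tsum_congr fun k => ENNReal.ofReal_mul (hc0 k)
  rw [lintegral_congr_ae (ae_speedMeasure_pos.mono e1),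
    lintegral_tsum fun k => (by fun_prop)]
  have e4 : ∀ k, ∫⁻ z, ENNReal.ofReal (c k) * ENNReal.ofReal (g k z) ∂speedMeasure α
      = ENNReal.ofReal ((1 + s) ^ (-shape α) * Real.exp (-u) * ((u / (1 + s)) ^ k / k !)) := by
    intro k
    rw [lintegral_const_mul _ (by fun_prop), lintegral_moment hα (by positivity),
      ← ENNReal.ofReal_mul (hc0 k)]
    congr 1
    have := hG k
    simp only [hc]
    rw [Real.mul_rpow hr.le hs1.le, Real.rpow_neg hr.le, div_pow]
    have : 0 < r ^ shape α := by positivity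
    field_simp
  simp only [e4]
  have hsum := (hasSum_poisson (u / (1 + s))).mul_left
    ((1 + s) ^ (-shape α) * Real.exp (-u) * Real.exp (u / (1 + s)))
  have e5 : ∀ k : ℕ, (1 + s) ^ (-shape α) * Real.exp (-u) * Real.exp (u / (1 + s))
      * ((u / (1 + s)) ^ k / k ! * Real.exp (-(u / (1 + s))))
      = (1 + s) ^ (-shape α) * Real.exp (-u) * ((u / (1 + s)) ^ k / k !) := by
    intro k
    rw [Real.exp_neg (u / (1 + s))]
    field_simp
  rw [hasSum_iff_of_eq e5] at hsum
  rw [← ENNReal.ofReal_tsum_of_nonneg (fun k => by positivity) hsum.summable, hsum.tsum_eq,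
    mul_one, mul_assoc, ← Real.exp_add]
  congr 3
  field_simp
  ring

theorem lintegral_density (hα : α < 1) (hr : 0 < r) (hx : 0 ≤ x) :
    ∫⁻ z, ENNReal.ofReal (density α r x z) ∂speedMeasure α = 1 := by
  simpa using lintegral_exp_mul_density hα hr hx le_rfl

end Kernel

/-! ### Marginal bounds for the differentiated density -/

section GradientBounds

variable {α r x z : ℝ}

theorem rpow_le_one_add_sqrt {u e : ℝ} (hu : 0 < u) (he : 0 ≤ e) (he' : e ≤ 1 / 2) :
    u ^ e ≤ 1 + √u := by
  rcases le_total u 1 with h | h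
  · linarith [Real.rpow_le_one hu.le h he, Real.sqrt_nonneg u]
  · rw [Real.sqrt_eq_rpow]
    linarith [Real.rpow_le_rpow_of_exponent_le h he']

/-- For a Poisson variable `N` of mean `u`, `E |N - u|` is at most both `2 u` and `√u`. The first is
used for `u ≤ 1` and the second for `u ≥ 1`, so every exponent between `1/2` and `1` is allowed. -/
theorem tsum_abs_sub_mul_poisson_le {u e : ℝ} (hu : 0 < u) (he : 1 / 2 ≤ e) (he' : e ≤ 1) :
    ∑' k : ℕ, ENNReal.ofReal (|k - u| * (u ^ k / k ! * Real.exp (-u)))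
      ≤ ENNReal.ofReal (2 * u ^ e) := by
  have key : ∀ g : ℕ → ℝ, ∀ s, HasSum (fun k : ℕ => g k * (u ^ k / k ! * Real.exp (-u))) s →
      (∀ k : ℕ, |k - u| ≤ g k) → s ≤ 2 * u ^ e →
      ∑' k : ℕ, ENNReal.ofReal (|k - u| * (u ^ k / k ! * Real.exp (-u)))
      ≤ ENNReal.ofReal (2 * u ^ e) := by
    intro g s hs hg hse
    refine le_trans ?_ (ENNReal.ofReal_le_ofReal hse)
    rw [← hs.tsum_eq, ENNReal.ofReal_tsum_of_nonneg (fun k => mul_nonneg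
      ((abs_nonneg _).trans (hg k)) (by positivity)) hs.summable]
    exact ENNReal.tsum_le_tsum fun k => ENNReal.ofReal_le_ofReal (by gcongr; exact hg k)
  rcases le_total u 1 with h | h
  · refine key (fun k => k + u) (u + u * 1) ((hasSum_iff_of_eq fun k => by ring).mpr
      ((hasSum_nat_mul_poisson u).add ((hasSum_poisson u).mul_left u))) (fun k => ?_) ?_
    · rw [abs_le]; constructor <;> linarith [(k.cast_nonneg : (0 : ℝ) ≤ k)]
    · have := Real.rpow_le_rpow_of_exponent_ge hu h he'
      rw [Real.rpow_one] at this
      linarith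
  · have hs : 0 < √u := Real.sqrt_pos.2 hu
    have hs2 : √u ^ 2 = u := Real.sq_sqrt hu.le
    have h1 := ((hasSum_poisson u).mul_left (√u / 2)).add
      ((hasSum_sq_sub_mul_poisson u).mul_left (1 / (2 * √u)))
    -- This majorant is `|k - u| ≤ √u / 2 + (k - u)² / (2 √u)`, which holds because `(|k - u| - √u)²
    -- ≥ 0`; the variance `u` makes its mean equal to `√u`.
    refine key (fun k => √u / 2 + 1 / (2 * √u) * (k - u) ^ 2) _
      ((hasSum_iff_of_eq fun k => by ring).mpr h1) (fun k => ?_) ?_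
    · have := sq_nonneg (|(k : ℝ) - u| - √u)
      rw [← sub_nonneg]
      have e1 : √u / 2 + 1 / (2 * √u) * (k - u) ^ 2 - |(k : ℝ) - u|
          = (|(k : ℝ) - u| - √u) ^ 2 / (2 * √u) := by
        field_simp
        rw [← sq_abs ((k : ℝ) - u)]; ring
      rw [e1]; positivity
    · have h2 : √u ≤ u ^ e := by
        rw [Real.sqrt_eq_rpow]; exact Real.rpow_le_rpow_of_exponent_le h he
      have h3 : √u / 2 * 1 + 1 / (2 * √u) * u = √u := by
        nth_rw 3 [← hs2]; field_simp; ring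
      rw [h3]; linarith

theorem enorm_densityDeriv_le (hα : α < 1) (hr : 0 < r) (hx : 0 < x) (hz : 0 ≤ z) :
    ‖densityDeriv α r x z‖ₑ ≤ ∑' k : ℕ, ENNReal.ofReal ((2 - α) * r ^ shape α * ((2 - α) / x)
      * (|k - r * x ^ (2 - α)| * ((r * x ^ (2 - α)) ^ k / k ! * Real.exp (-(r * x ^ (2 - α)))))
      * ((r * z ^ (2 - α)) ^ k * Real.exp (-(r * z ^ (2 - α))) / Real.Gamma (shape α + k))) := by
  have h2 : 0 < 2 - α := by linarith
  set u := r * x ^ (2 - α)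
  set v := r * z ^ (2 - α)
  have hu0 : 0 ≤ u := by positivity
  have hv0 : 0 ≤ v := by positivity
  have hs := (hasSum_sub_mul_besselSeries (shape_pos hα) u v).mul_left
    ((2 - α) * r ^ shape α * Real.exp (-(u + v)) * ((2 - α) / x))
  have e1 : densityDeriv α r x z = (2 - α) * r ^ shape α * Real.exp (-(u + v)) * ((2 - α) / x)
      * (u * (v * besselSeries (shape α + 1) (u * v) - besselSeries (shape α) (u * v))) := by
    simp only [densityDeriv, u, v]; ring
  rw [e1, ← hs.tsum_eq]
  refine enorm_tsum_le_tsum_enorm.trans (ENNReal.tsum_le_tsum fun k => ?_)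
  have hG := Gamma_add_nat_pos (shape_pos hα) k
  rw [← ofReal_norm, Real.norm_eq_abs,
    abs_mul ((2 - α) * r ^ shape α * Real.exp (-(u + v)) * ((2 - α) / x)), abs_div,
    abs_mul ((k : ℝ) - u),
    abs_of_nonneg (a := (u * v) ^ k) (by positivity),
    abs_of_nonneg (a := k ! * Real.Gamma (shape α + k)) (by positivity),
    abs_of_nonneg (a := (2 - α) * r ^ shape α * Real.exp (-(u + v)) * ((2 - α) / x))
      (by positivity), neg_add, Real.exp_add, mul_pow]
  refine le_of_eq ?_
  congr 1
  field_simp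

/-- Integrating in `z` cancels every Gamma factor and leaves `(2 - α) / x * E |N - u|` with `u = r x
^ (2 - α)`. The Poisson bound with exponent `1 / (2 - α)` is chosen because `u ^ (1 / (2 - α)) = r ^
(1 / (2 - α)) x`, so that `x` cancels. -/
theorem lintegral_enorm_densityDeriv_le (hα0 : 0 < α) (hα : α < 1) (hr : 0 < r) (hx : 0 < x) :
    ∫⁻ z, ‖densityDeriv α r x z‖ₑ ∂speedMeasure α
      ≤ ENNReal.ofReal (2 * (2 - α) * r ^ (1 / (2 - α))) := by
  have h2 : 0 < 2 - α := by linarith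
  set u := r * x ^ (2 - α) with hu
  have hu0 : 0 < u := by positivity
  have hG : ∀ k : ℕ, 0 < Real.Gamma (shape α + k) := Gamma_add_nat_pos (shape_pos hα)
  set A : ℕ → ℝ := fun k => (2 - α) * r ^ shape α * ((2 - α) / x)
      * (|k - u| * (u ^ k / k ! * Real.exp (-u))) / Real.Gamma (shape α + k) with hA
  have hA0 : ∀ k, 0 ≤ A k := fun k => by have := hG k; positivity
  calc ∫⁻ z, ‖densityDeriv α r x z‖ₑ ∂speedMeasure α
      ≤ ∫⁻ z, ∑' k, ENNReal.ofReal (A k) * ENNReal.ofReal ((r * z ^ (2 - α)) ^ k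
          * Real.exp (-(r * z ^ (2 - α)))) ∂speedMeasure α := by
        refine lintegral_mono_ae (ae_speedMeasure_pos.mono fun z hz => ?_)
        refine (enorm_densityDeriv_le hα hr hx hz.le).trans_eq (tsum_congr fun k => ?_)
        rw [← ENNReal.ofReal_mul (hA0 k)]
        congr 1
        simp only [hA]; ring
    _ = ∑' k : ℕ, ENNReal.ofReal ((2 - α) / x)
          * ENNReal.ofReal (|k - u| * (u ^ k / k ! * Real.exp (-u))) := by
        rw [lintegral_tsum fun k => by fun_prop]
        refine tsum_congr fun k => ?_
        rw [lintegral_const_mul _ (by fun_prop), lintegral_moment hα hr,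
          ← ENNReal.ofReal_mul (hA0 k), ← ENNReal.ofReal_mul (by positivity)]
        congr 1
        have := hG k
        have : 0 < r ^ shape α := by positivity
        simp only [hA]
        rw [Real.rpow_neg hr.le]
        field_simp
    _ ≤ ENNReal.ofReal ((2 - α) / x) * ENNReal.ofReal (2 * u ^ (1 / (2 - α))) := by
        rw [ENNReal.tsum_mul_left]
        gcongr
        refine tsum_abs_sub_mul_poisson_le hu0 ?_ ?_
        · rw [div_le_div_iff₀ two_pos h2]; linarith
        · rw [div_le_one h2]; linarith
    _ = _ := by
        rw [← ENNReal.ofReal_mul (by positivity)]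
        congr 1
        rw [hu, Real.mul_rpow hr.le (by positivity), ← Real.rpow_mul hx.le,
          mul_one_div_cancel h2.ne', Real.rpow_one]
        field_simp

theorem lintegral_moments (hα : α < 1) (hr : 0 < r) (j : ℕ) (p₀ p₁ p₂ : ℝ)
    (h : ∀ u : ℝ, 0 ≤ u → 0 ≤ (p₀ + p₁ * u + p₂ * u ^ 2) * u ^ j) :
    ∫⁻ x, ENNReal.ofReal ((p₀ + p₁ * (r * x ^ (2 - α)) + p₂ * (r * x ^ (2 - α)) ^ 2)
        * (r * x ^ (2 - α)) ^ j * Real.exp (-(r * x ^ (2 - α)))) ∂speedMeasure α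
      = ENNReal.ofReal (r ^ (-shape α) / (2 - α) * Real.Gamma (shape α + j)
        * (p₀ + p₁ * (shape α + j) + p₂ * ((shape α + j + 1) * (shape α + j)))) := by
  have ha := shape_pos hα
  have i0 := (integrableOn_moment hα hr j).const_mul p₀
  have i1 := (integrableOn_moment hα hr (j + 1)).const_mul p₁
  have i2 := (integrableOn_moment hα hr (j + 2)).const_mul p₂
  have e1 : ∀ x : ℝ, (p₀ + p₁ * (r * x ^ (2 - α)) + p₂ * (r * x ^ (2 - α)) ^ 2)
        * (r * x ^ (2 - α)) ^ j * Real.exp (-(r * x ^ (2 - α))) * x ^ (-α)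
      = p₀ * ((r * x ^ (2 - α)) ^ j * Real.exp (-(r * x ^ (2 - α))) * x ^ (-α))
        + p₁ * ((r * x ^ (2 - α)) ^ (j + 1) * Real.exp (-(r * x ^ (2 - α))) * x ^ (-α))
        + p₂ * ((r * x ^ (2 - α)) ^ (j + 2) * Real.exp (-(r * x ^ (2 - α))) * x ^ (-α)) := by
    intro x; ring
  rw [lintegral_speedMeasure_ofReal (by fun_prop)]
  · simp only [e1]
    have e3 := integral_add (i0.add i1) i2
    simp only [Pi.add_apply] at e3
    rw [e3, integral_add i0 i1]
    simp only [integral_const_mul, integral_moment hα hr]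
    congr 1
    have e2 : Real.Gamma (shape α + (j + 2 : ℕ)) = (shape α + j + 1) *
        ((shape α + j) * Real.Gamma (shape α + j)) := by
      rw [← Gamma_add_nat_succ ha j, show j + 2 = (j + 1) + 1 from rfl,
        Gamma_add_nat_succ ha (j + 1)]
      push_cast; ring
    rw [e2, Gamma_add_nat_succ ha j]
    ring
  · simp only [e1]
    exact (i0.add i1).add i2
  · intro x hx
    exact mul_nonneg (h _ (by positivity)) (Real.exp_pos _).le

/-- Writing `1 / x` through `u = r x ^ (2 - α)` leaves `u ^ (1 - 1 / (2 - α))`. This exponent lies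
in `[0, 1/2]`, whence the bound by `1 + √u`, which prepares a polynomial majorant. -/
theorem abs_sub_mul_pow_div_le (hα0 : 0 < α) (hα : α < 1) (hr : 0 < r) (hx : 0 < x) (k : ℕ) :
    |k - r * x ^ (2 - α)| * (r * x ^ (2 - α)) ^ k / x
      ≤ r ^ (1 / (2 - α)) * (|k - r * x ^ (2 - α)| * (r * x ^ (2 - α)) ^ k / (r * x ^ (2 - α))
        * (1 + √(r * x ^ (2 - α)))) := by
  have h2 : 0 < 2 - α := by linarith
  set u := r * x ^ (2 - α) with hu
  have hu0 : 0 < u := by positivity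
  have h3 : u ^ (1 - 1 / (2 - α)) ≤ 1 + √u := by
    refine rpow_le_one_add_sqrt hu0 ?_ ?_
    · rw [sub_nonneg, div_le_one h2]; linarith
    · have : 1 / 2 ≤ 1 / (2 - α) := by rw [div_le_div_iff₀ two_pos h2]; linarith
      linarith
  have h4 : u ^ (1 / (2 - α)) = r ^ (1 / (2 - α)) * x := by
    rw [hu, Real.mul_rpow hr.le (by positivity), ← Real.rpow_mul hx.le,
          mul_one_div_cancel h2.ne', Real.rpow_one]
  have h5 : u / x = r ^ (1 / (2 - α)) * u ^ (1 - 1 / (2 - α)) := by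
    rw [Real.rpow_sub hu0, Real.rpow_one, h4]
    have : 0 < r ^ (1 / (2 - α)) := by positivity
    field_simp
  calc |k - u| * u ^ k / x = |k - u| * u ^ k / u * (u / x) := by field_simp
    _ = r ^ (1 / (2 - α)) * (|k - u| * u ^ k / u * u ^ (1 - 1 / (2 - α))) := by rw [h5]; ring
    _ ≤ _ := by gcongr

theorem lintegral_abs_sub_mul_pow_div_le (hα0 : 0 < α) (hα : α < 1) (hr : 0 < r) (k : ℕ) :
    ∫⁻ x, ENNReal.ofReal (|k - r * x ^ (2 - α)| * (r * x ^ (2 - α)) ^ k / x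
        * Real.exp (-(r * x ^ (2 - α)))) ∂speedMeasure α
      ≤ ENNReal.ofReal (r ^ (1 / (2 - α)) * (r ^ (-shape α) / (2 - α)
        * Real.Gamma (shape α + k) * (3 / shape α))) := by
  have h2 : 0 < 2 - α := by linarith
  have ha := shape_pos hα
  have ha1 := shape_le_one hα
  have hR : 0 ≤ r ^ (1 / (2 - α)) := by positivity
  -- A quadratic times `u ^ j` dominates the integrand, so its integral is an exact combination of
  -- Gamma moments. For `k = 0`, use `1 + √u ≤ 3/2 + u/2`. For `k = j + 1`, use `j = k - 1`, the
  -- division by `u` having cost one power.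
  obtain ⟨j, p₀, p₁, p₂, hp, hle, hfin⟩ : ∃ (j : ℕ) (p₀ p₁ p₂ : ℝ),
      (∀ u : ℝ, 0 ≤ u → 0 ≤ (p₀ + p₁ * u + p₂ * u ^ 2) * u ^ j) ∧
      (∀ u : ℝ, 0 < u → |k - u| * u ^ k / u * (1 + √u) ≤ (p₀ + p₁ * u + p₂ * u ^ 2) * u ^ j) ∧
      Real.Gamma (shape α + j)
        * (p₀ + p₁ * (shape α + j) + p₂ * ((shape α + j + 1) * (shape α + j)))
        ≤ Real.Gamma (shape α + k) * (3 / shape α) := by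
    have hsq : ∀ u : ℝ, 0 < u → √u ^ 2 = u := fun u hu => Real.sq_sqrt hu.le
    rcases k with _ | j
    · refine ⟨0, 3 / 2, 1 / 2, 0, fun u hu => by positivity, fun u hu => ?_, ?_⟩
      · have : |((0 : ℕ) : ℝ) - u| * u ^ 0 / u = 1 := by
          rw [Nat.cast_zero, zero_sub, abs_neg, abs_of_pos hu]; field_simp
        rw [this]
        nlinarith [hsq u hu, sq_nonneg (√u - 1)]
      · refine mul_le_mul_of_nonneg_left ?_ (Gamma_add_nat_pos ha 0).le
        rw [le_div_iff₀ ha]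
        push_cast
        nlinarith
    -- The coefficients come from `|k - u| (1 + √u) ≤ (k + u) + ((k - u)² + u) / 2`, with `k = j +
    -- 1`. After integration the terms quadratic in `k` cancel, and the remaining linear growth is
    -- absorbed by `Γ(a + k) = (a + j) Γ(a + j)`.
    · have hcov : ∀ u : ℝ, 0 < u →
          |((j + 1 : ℕ) : ℝ) - u| * u ^ (j + 1) / u * (1 + √u) ≤
          (((j + 1) + (j + 1) ^ 2 / 2) + (3 / 2 - (j + 1)) * u + 1 / 2 * u ^ 2) * u ^ j := by
        intro u hu
        have e1 : |((j + 1 : ℕ) : ℝ) - u| * u ^ (j + 1) / u * (1 + √u)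
            = (|((j + 1 : ℕ) : ℝ) - u| * (1 + √u)) * u ^ j := by
          rw [pow_succ]; field_simp
        rw [e1]
        refine mul_le_mul_of_nonneg_right ?_ (by positivity)
        have h3 : |((j + 1 : ℕ) : ℝ) - u| ≤ (j + 1) + u := by
          rw [abs_le]; push_cast; constructor <;> linarith [(j.cast_nonneg : (0 : ℝ) ≤ j)]
        have h4 : |((j + 1 : ℕ) : ℝ) - u| ^ 2 = (j + 1 - u) ^ 2 := by
          rw [sq_abs]; push_cast; rfl
        nlinarith [sq_nonneg (|((j + 1 : ℕ) : ℝ) - u| - √u), hsq u hu]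
      refine ⟨j, _, _, _, fun u hu => ?_, hcov, ?_⟩
      · rcases hu.eq_or_lt with rfl | hu
        · simp only [mul_zero, add_zero, ne_eq, OfNat.ofNat_ne_zero, not_false_eq_true, zero_pow]
          positivity
        · exact le_trans (by positivity) (hcov u hu)
      · rw [Gamma_add_nat_succ ha, mul_comm (shape α + j), mul_assoc]
        refine mul_le_mul_of_nonneg_left ?_ (Gamma_add_nat_pos ha j).le
        have hj : (0 : ℝ) ≤ j := j.cast_nonneg
        have e1 : (shape α + j) * (3 / shape α) = 3 + 3 * j / shape α := by
          field_simp
        have e2 : 3 * j ≤ 3 * j / shape α := le_div_self (by positivity) ha ha1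
        rw [e1]
        nlinarith
  calc _ ≤ ∫⁻ x, ENNReal.ofReal (r ^ (1 / (2 - α)))
        * ENNReal.ofReal ((p₀ + p₁ * (r * x ^ (2 - α)) + p₂ * (r * x ^ (2 - α)) ^ 2)
        * (r * x ^ (2 - α)) ^ j * Real.exp (-(r * x ^ (2 - α)))) ∂speedMeasure α := by
        refine lintegral_mono_ae (ae_speedMeasure_pos.mono fun x hx => ?_)
        rw [← ENNReal.ofReal_mul hR]
        refine ENNReal.ofReal_le_ofReal ?_
        rw [← mul_assoc]
        refine mul_le_mul_of_nonneg_right ?_ (Real.exp_pos _).le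
        exact (abs_sub_mul_pow_div_le hα0 hα hr hx k).trans
          (mul_le_mul_of_nonneg_left (hle _ (by positivity)) hR)
    _ ≤ _ := by
        rw [lintegral_const_mul _ (by fun_prop), lintegral_moments hα hr j p₀ p₁ p₂ hp,
          ← ENNReal.ofReal_mul hR]
        refine ENNReal.ofReal_le_ofReal (mul_le_mul_of_nonneg_left ?_ hR)
        rw [mul_assoc, mul_assoc]
        exact mul_le_mul_of_nonneg_left hfin (by positivity)

/-- Unlike the density, its derivative is not symmetric in its two points, so this marginal needs
its own estimate. Here the Poisson weights sit at the fixed point `z` and sum to one, once the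
`x`-integral of each term is bounded by a multiple of `Γ(a + k)` uniform in `k`. -/
theorem lintegral_enorm_densityDeriv_le' (hα0 : 0 < α) (hα : α < 1) (hr : 0 < r) (hz : 0 ≤ z) :
    ∫⁻ x, ‖densityDeriv α r x z‖ₑ ∂speedMeasure α
      ≤ ENNReal.ofReal (3 * (2 - α) / shape α * r ^ (1 / (2 - α))) := by
  have h2 : 0 < 2 - α := by linarith
  have ha := shape_pos hα
  set v := r * z ^ (2 - α) with hv
  have hv0 : 0 ≤ v := by positivity
  have hG : ∀ k : ℕ, 0 < Real.Gamma (shape α + k) := Gamma_add_nat_pos ha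
  set B : ℕ → ℝ := fun k => (2 - α) * r ^ shape α * (2 - α)
      * (v ^ k / k ! * Real.exp (-v)) / Real.Gamma (shape α + k) with hB
  have hB0 : ∀ k, 0 ≤ B k := fun k => by have := hG k; positivity
  calc ∫⁻ x, ‖densityDeriv α r x z‖ₑ ∂speedMeasure α
      ≤ ∫⁻ x, ∑' k : ℕ, ENNReal.ofReal (B k) * ENNReal.ofReal (|k - r * x ^ (2 - α)|
          * (r * x ^ (2 - α)) ^ k / x * Real.exp (-(r * x ^ (2 - α)))) ∂speedMeasure α := by
        refine lintegral_mono_ae (ae_speedMeasure_pos.mono fun x hx => ?_)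
        refine (enorm_densityDeriv_le hα hr hx hz).trans_eq (tsum_congr fun k => ?_)
        rw [← ENNReal.ofReal_mul (hB0 k)]
        congr 1
        simp only [hB]; ring
    _ = ∑' k : ℕ, ENNReal.ofReal (B k) * ∫⁻ x, ENNReal.ofReal (|k - r * x ^ (2 - α)|
          * (r * x ^ (2 - α)) ^ k / x * Real.exp (-(r * x ^ (2 - α)))) ∂speedMeasure α := by
        rw [lintegral_tsum fun k => Measurable.aemeasurable (by fun_prop)]
        exact tsum_congr fun k => lintegral_const_mul _ (by fun_prop)
    _ ≤ ∑' k : ℕ, ENNReal.ofReal (3 * (2 - α) / shape α * r ^ (1 / (2 - α)))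
          * ENNReal.ofReal (v ^ k / k ! * Real.exp (-v)) := by
        refine ENNReal.tsum_le_tsum fun k => ?_
        refine (mul_le_mul_right (lintegral_abs_sub_mul_pow_div_le hα0 hα hr k) _).trans_eq ?_
        rw [← ENNReal.ofReal_mul (hB0 k), ← ENNReal.ofReal_mul (by positivity)]
        congr 1
        have := hG k
        have : 0 < r ^ shape α := by positivity
        simp only [hB]
        rw [Real.rpow_neg hr.le]
        field_simp
    _ = _ := by
        rw [ENNReal.tsum_mul_left, ← ENNReal.ofReal_tsum_of_nonneg (fun k => by positivity)
          (hasSum_poisson v).summable, (hasSum_poisson v).tsum_eq, ENNReal.ofReal_one, mul_one]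

end GradientBounds

/-- The polynomials in an injective bounded continuous function form an algebra that separates
points, and such an algebra determines finite measures on a Polish space. -/
theorem measure_ext_of_integral_pow {E : Type*} [MeasurableSpace E] [TopologicalSpace E]
    [PolishSpace E] [BorelSpace E] {ρ ν : Measure E} [IsFiniteMeasure ρ] [IsFiniteMeasure ν]
    (g : E →ᵇ ℝ) (hg : Function.Injective g)
    (h : ∀ n : ℕ, ∫ x, g x ^ n ∂ρ = ∫ x, g x ^ n ∂ν) : ρ = ν := by
  let A : StarSubalgebra ℝ (E →ᵇ ℝ) :=
    { Algebra.adjoin ℝ {g} with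
      star_mem' := fun {a} ha => by
        have : star a = a := by ext x; simp
        rw [this]; exact ha }
  refine ext_of_forall_mem_subalgebra_integral_eq_of_polish (𝕜 := ℝ) (A := A) ?_ ?_
  · intro x y hxy
    refine ⟨g, ⟨_, ⟨g, ?_, rfl⟩, rfl⟩, fun h => hxy (hg h)⟩
    exact Algebra.subset_adjoin (Set.mem_singleton g)
  · intro f hf
    have hf' : f ∈ Algebra.adjoin ℝ {g} := hf
    rw [Algebra.adjoin_singleton_eq_range_aeval] at hf'
    obtain ⟨p, rfl⟩ := hf'
    induction p using Polynomial.induction_on' with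
    | add p q hp hq =>
      have hp := hp (by
        change _ ∈ Algebra.adjoin ℝ {g}
        rw [Algebra.adjoin_singleton_eq_range_aeval]; exact ⟨p, rfl⟩)
      have hq := hq (by
        change _ ∈ Algebra.adjoin ℝ {g}
        rw [Algebra.adjoin_singleton_eq_range_aeval]; exact ⟨q, rfl⟩)
      simp only [RingHom.coe_coe, AlgHom.toRingHom_eq_coe, map_add, BoundedContinuousFunction.coe_add, Pi.add_apply] at hp hq ⊢
      rw [integral_add (BoundedContinuousFunction.integrable _ _)
        (BoundedContinuousFunction.integrable _ _),
        integral_add (BoundedContinuousFunction.integrable _ _)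
        (BoundedContinuousFunction.integrable _ _), hp, hq]
    | monomial n a =>
      simp [Polynomial.aeval_monomial, integral_const_mul, h n, Algebra.algebraMap_eq_smul_one]

/-! ### Identification of the one-dimensional law -/

section Law

variable {α : ℝ}

theorem powerCoord_injOn (hα : α < 2) : InjOn (powerCoord α) (Ici 0) := by
  intro x hx y hy h
  have h2 : (2 - α) ^ 2 ≠ 0 := pow_ne_zero 2 (by linarith)
  exact Real.rpow_left_injOn (by linarith) hx hy ((div_left_inj' h2).1 h)

/-- Finite measures on the half-line are determined by the Laplace transform in the squared Bessel
coordinate. -/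
theorem measure_ext_of_integral_exp_neg_powerCoord (hα : α < 2) {ρ ν : Measure ℝ}
    [IsFiniteMeasure ρ] [IsFiniteMeasure ν] (hρ : ∀ᵐ x ∂ρ, 0 ≤ x) (hν : ∀ᵐ x ∂ν, 0 ≤ x)
    (h : ∀ n : ℕ, ∫ x, Real.exp (-(n * powerCoord α x)) ∂ρ
      = ∫ x, Real.exp (-(n * powerCoord α x)) ∂ν) : ρ = ν := by
  have hc := continuous_powerCoord hα
  -- The function `exp (-y)` is bounded on the half-line and injective, and its powers are `exp (-n
  -- y)`; this is why integer parameters suffice.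
  let g : ℝ≥0 →ᵇ ℝ := BoundedContinuousFunction.ofNormedAddCommGroup
    (fun x : ℝ≥0 => Real.exp (-powerCoord α x)) (by fun_prop) 1 fun x => by
      rw [Real.norm_eq_abs, Real.abs_exp, Real.exp_le_one_iff]
      exact neg_nonpos.2 (powerCoord_nonneg x.coe_nonneg)
  have hgm : ∀ n : ℕ, StronglyMeasurable fun x : ℝ≥0 => g x ^ n := fun n =>
    (g.continuous.pow n).stronglyMeasurable
  have key : ∀ μ : Measure ℝ, (∀ᵐ x ∂μ, 0 ≤ x) → ∀ n : ℕ,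
      ∫ x, g x ^ n ∂(μ.map Real.toNNReal) = ∫ x, Real.exp (-(n * powerCoord α x)) ∂μ := by
    intro μ hμ n
    rw [integral_map measurable_real_toNNReal.aemeasurable (hgm n).aestronglyMeasurable]
    refine integral_congr_ae (hμ.mono fun x hx => ?_)
    change Real.exp (-powerCoord α (x.toNNReal : ℝ)) ^ n = _
    rw [Real.coe_toNNReal x hx, ← Real.exp_nat_mul]
    congr 1; ring
  have hmap : ρ.map Real.toNNReal = ν.map Real.toNNReal := by
    refine measure_ext_of_integral_pow g (fun x y hxy => ?_) fun n => ?_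
    · have hxy' : Real.exp (-powerCoord α x) = Real.exp (-powerCoord α y) := hxy
      exact NNReal.coe_injective (powerCoord_injOn hα x.coe_nonneg y.coe_nonneg
        (neg_injective (Real.exp_injective hxy')))
    · rw [key ρ hρ, key ν hν, h]
  have back : ∀ μ : Measure ℝ, (∀ᵐ x ∂μ, 0 ≤ x) →
      (μ.map Real.toNNReal).map ((↑) : ℝ≥0 → ℝ) = μ := by
    intro μ hμ
    rw [Measure.map_map measurable_coe_nnreal_real measurable_real_toNNReal]
    conv_rhs => rw [← Measure.map_id (μ := μ)]
    exact Measure.map_congr (hμ.mono fun x hx => Real.coe_toNNReal x hx)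
  rw [← back ρ hρ, ← back ν hν, hmap]

/-- The rate parameter of the transition density at time `t`. -/
noncomputable def rate (α t : ℝ) : ℝ := 1 / ((2 - α) ^ 2 * t)

theorem rate_pos (hα : α < 2) {t : ℝ} (ht : 0 < t) : 0 < rate α t := by
  have : 0 < 2 - α := by linarith
  unfold rate; positivity

theorem rate_mul_rpow (hα : α < 2) {t : ℝ} (ht : 0 < t) (x : ℝ) :
    rate α t * x ^ (2 - α) = powerCoord α x / t := by
  have : 0 < 2 - α := by linarith
  unfold rate powerCoord; field_simp

variable {Ω : Type*} [MeasurableSpace Ω] {P : Measure Ω} {Z : ℝ≥0 → Ω → ℝ} {z : ℝ}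

theorem IsReflectingDiffusion.measurable (hZ : IsReflectingDiffusion α P Z z) (t : ℝ≥0) :
    Measurable (Z t) := by
  obtain ⟨F, hF, -⟩ := hZ.submartingale
  exact (hF t).measurable.mono (F.le t) le_rfl

theorem IsReflectingDiffusion.laplace [IsProbabilityMeasure P]
    (hZ : IsReflectingDiffusion α P Z z) (hα : α ∈ Ioo (0 : ℝ) 1) {t : ℝ≥0} (ht : 0 < t)
    {θ : ℝ} (hθ : 0 < θ) :
    ∫ ω, Real.exp (-(θ * powerCoord α (Z t ω))) ∂P
      = (1 + θ * t) ^ (-shape α) * Real.exp (-(θ / (1 + θ * t) * powerCoord α z)) := by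
  have hα2 : α < 2 := by linarith [hα.2]
  have := integral_exp_neg_eq (P := P) (Y := fun s ω => powerCoord α (Z s.toNNReal ω))
    (a := shape α) (y := powerCoord α z) (T := t) (θ := θ)
    (fun ω => (continuous_powerCoord hα2).comp
      ((hZ.continuous_paths ω).comp continuous_real_toNNReal))
    (fun s => measurable_powerCoord.comp (hZ.measurable _))
    (fun s ω => powerCoord_nonneg (hZ.nonneg _ ω))
    (hZ.start.mono fun ω hω => by simp [hω])
    (fun s θ hs hθ => by
      have := hZ.integral_exp_neg_powerCoord hα hθ s.toNNReal
      rw [Real.coe_toNNReal s hs] at this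
      simpa [shape] using this)
    (by exact_mod_cast ht) hθ
  simpa using this

theorem ae_withDensity_speedMeasure_nonneg (f : ℝ → ℝ≥0∞) :
    ∀ᵐ x ∂(speedMeasure α).withDensity f, 0 ≤ x :=
  (withDensity_absolutelyContinuous _ _).ae_le (ae_speedMeasure_pos.mono fun _ hx => hx.le)

theorem isProbabilityMeasure_withDensity_density (hα : α < 1) {r x : ℝ} (hr : 0 < r)
    (hx : 0 ≤ x) : IsProbabilityMeasure
      ((speedMeasure α).withDensity fun y => ENNReal.ofReal (density α r x y)) :=
  ⟨by rw [withDensity_apply _ MeasurableSet.univ, Measure.restrict_univ,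
    lintegral_density hα hr hx]⟩

theorem measurable_density_right (hα : α < 1) (r x : ℝ) : Measurable (density α r x) :=
  (measurable_density hα).comp (by fun_prop : Measurable fun z : ℝ => (r, x, z))

/-- The two Laplace transforms agree with `s = n t`, since `rate α t * z ^ (2 - α) = powerCoord α z
/ t`. For `n = 0` both sides are total masses of probability measures. -/
theorem IsReflectingDiffusion.map_eq [IsProbabilityMeasure P]
    (hZ : IsReflectingDiffusion α P Z z) (hα : α ∈ Ioo (0 : ℝ) 1) (hz : 0 ≤ z) {t : ℝ≥0}
    (ht : 0 < t) :
    P.map (Z t) = (speedMeasure α).withDensity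
      fun y => ENNReal.ofReal (density α (rate α t) z y) := by
  have hα2 : α < 2 := by linarith [hα.2]
  have ht' : (0 : ℝ) < t := by exact_mod_cast ht
  have hr := rate_pos hα2 ht'
  have hmd := measurable_density_right hα.2 (rate α t) z
  have hm := hZ.measurable t
  have : IsProbabilityMeasure (P.map (Z t)) := Measure.isProbabilityMeasure_map hm.aemeasurable
  have := isProbabilityMeasure_withDensity_density hα.2 hr hz
  have hpc := measurable_powerCoord (α := α)
  refine measure_ext_of_integral_exp_neg_powerCoord hα2 ?_
    (ae_withDensity_speedMeasure_nonneg _) fun n => ?_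
  · rw [ae_map_iff hm.aemeasurable measurableSet_Ici]
    exact Eventually.of_forall fun ω => hZ.nonneg t ω
  · rcases n.eq_zero_or_pos with rfl | hn
    · simp
    · have hn' : (0 : ℝ) < n := by exact_mod_cast hn
      rw [integral_map hm.aemeasurable (Measurable.aestronglyMeasurable (by fun_prop)),
        hZ.laplace hα ht hn', integral_eq_lintegral_of_nonneg_ae
          (Eventually.of_forall fun x => (Real.exp_pos _).le)
          (Measurable.aestronglyMeasurable (by fun_prop)),
        lintegral_withDensity_eq_lintegral_mul _ (by fun_prop) (by fun_prop)]
      have e1 : ∀ᵐ y ∂speedMeasure α, ((fun y => ENNReal.ofReal (density α (rate α t) z y))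
          * fun y => ENNReal.ofReal (Real.exp (-(n * powerCoord α y)))) y
          = ENNReal.ofReal (Real.exp (-(n * t * (rate α t * y ^ (2 - α))))
            * density α (rate α t) z y) := by
        filter_upwards [ae_speedMeasure_pos] with y hy
        rw [Pi.mul_apply, ← ENNReal.ofReal_mul (density_nonneg hα.2 hr.le hz hy.le), mul_comm,
          rate_mul_rpow hα2 ht']
        congr 4
        field_simp
      rw [lintegral_congr_ae e1, lintegral_exp_mul_density hα.2 hr hz (by positivity),
        ENNReal.toReal_ofReal (by positivity), rate_mul_rpow hα2 ht']
      congr 3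
      field_simp

end Law

/-! ### Product measures with densities -/

section PiMeasure

theorem lintegral_fin_prod {n : ℕ} (μ : Fin n → Measure ℝ) [∀ i, SigmaFinite (μ i)]
    {f : Fin n → ℝ → ℝ≥0∞} (hf : ∀ i, Measurable (f i)) :
    ∫⁻ x, ∏ i, f i (x i) ∂(Measure.pi μ) = ∏ i, ∫⁻ x, f i x ∂(μ i) := by
  induction n with
  | zero => simp
  | succ n ih =>
    have h1 : Measurable fun x : Fin n → ℝ => ∏ i : Fin n, f i.succ (x i) :=
      Finset.measurable_prod _ fun i _ => (hf i.succ).comp (measurable_pi_apply i)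
    rw [← ((measurePreserving_piFinSuccAbove μ 0).symm).lintegral_comp_emb
      (MeasurableEquiv.measurableEmbedding _)]
    simp_rw [MeasurableEquiv.piFinSuccAbove_symm_apply, Fin.insertNthEquiv,
            Fin.prod_univ_succ, Fin.insertNth_zero, Equiv.coe_fn_mk, Fin.cons_succ,
            Fin.zero_succAbove, cast_eq, Fin.cons_zero]
    rw [lintegral_prod_mul (hf 0).aemeasurable h1.aemeasurable,
      ih (fun i => μ i.succ) fun i => hf i.succ]

theorem pi_withDensity {n : ℕ} (μ : Fin n → Measure ℝ) [∀ i, SigmaFinite (μ i)]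
    {f : Fin n → ℝ → ℝ≥0∞} (hf : ∀ i, Measurable (f i))
    [∀ i, SigmaFinite ((μ i).withDensity (f i))] :
    Measure.pi (fun i => (μ i).withDensity (f i))
      = (Measure.pi μ).withDensity fun x => ∏ i, f i (x i) := by
  refine Measure.pi_eq fun s hs => ?_
  rw [withDensity_apply _ (MeasurableSet.univ_pi hs),
    ← lintegral_indicator (MeasurableSet.univ_pi hs)]
  have : ∀ x : Fin n → ℝ, (univ.pi s).indicator (fun x => ∏ i, f i (x i)) x
      = ∏ i, (s i).indicator (f i) (x i) := by
    intro x
    by_cases hx : x ∈ univ.pi s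
    · rw [indicator_of_mem hx]
      exact Finset.prod_congr rfl fun i _ => (indicator_of_mem (hx i (mem_univ i)) _).symm
    · rw [indicator_of_notMem hx]
      simp only [Set.mem_pi, mem_univ, true_imp_iff, not_forall] at hx
      obtain ⟨i, hi⟩ := hx
      exact (Finset.prod_eq_zero (Finset.mem_univ i) (indicator_of_notMem hi _)).symm
  simp_rw [this]
  rw [lintegral_fin_prod μ fun i => (hf i).indicator (hs i)]
  refine Finset.prod_congr rfl fun i _ => ?_
  rw [lintegral_indicator (hs i), withDensity_apply _ (hs i)]

end PiMeasure

/-! ### The Schur test -/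

section Schur

variable {X Y : Type*} [MeasurableSpace X] [MeasurableSpace Y] {μ : Measure X} {ν : Measure Y}
  [SFinite μ] [SFinite ν]

/-- The Schur test. -/
theorem lintegral_rpow_kernel_le {p : ℝ} (hp : 1 < p) {K : X → Y → ℝ≥0∞} {F : Y → ℝ≥0∞}
    {A : ℝ≥0∞} (hK : Measurable (Function.uncurry K)) (hF : Measurable F)
    (h1 : ∀ᵐ x ∂μ, ∫⁻ y, K x y ∂ν ≤ A) (h2 : ∀ᵐ y ∂ν, ∫⁻ x, K x y ∂μ ≤ A) :
    ∫⁻ x, (∫⁻ y, K x y * F y ∂ν) ^ p ∂μ ≤ A ^ p * ∫⁻ y, F y ^ p ∂ν := by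
  have hp0 : 0 < p := by linarith
  set q := p.conjExponent with hq
  have hpq : p.HolderConjugate q := Real.HolderConjugate.conjExponent hp
  have hq0 : 0 < q := hpq.symm.pos
  have hKx : ∀ x, Measurable (K x) := fun x => hK.comp measurable_prodMk_left
  -- Splitting of the kernel for Hölder's inequality with exponents `p` and `q`: the first factor
  -- carries `F`, the second only the mass of `K x`.
  have e0 : ∀ x, ∀ᵐ y ∂ν, True → K x y * F y = (K x y ^ (1 / p) * F y) * K x y ^ (1 / q) := by
    intro x
    refine Eventually.of_forall fun y _ => ?_
    rw [mul_right_comm, ← ENNReal.rpow_add_of_nonneg _ _ (by positivity) (by positivity),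
      one_div, one_div, hpq.inv_add_inv_eq_one, ENNReal.rpow_one]
  have step : ∀ᵐ x ∂μ, (∫⁻ y, K x y * F y ∂ν) ^ p
      ≤ A ^ (p - 1) * ∫⁻ y, K x y * F y ^ p ∂ν := by
    filter_upwards [h1] with x hx
    have hol := ENNReal.lintegral_mul_le_Lp_mul_Lq ν hpq
      (f := fun y => K x y ^ (1 / p) * F y) (g := fun y => K x y ^ (1 / q))
      (((hKx x).pow_const _).mul hF).aemeasurable ((hKx x).pow_const _).aemeasurable
    simp only [Pi.mul_apply] at hol
    rw [← lintegral_congr_ae ((e0 x).mono fun y hy => hy trivial)] at hol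
    have e1 : ∀ y, (K x y ^ (1 / p) * F y) ^ p = K x y * F y ^ p := fun y => by
      rw [ENNReal.mul_rpow_of_nonneg _ _ hp0.le, ← ENNReal.rpow_mul, one_div_mul_cancel hp0.ne',
        ENNReal.rpow_one]
    have e2 : ∀ y, (K x y ^ (1 / q)) ^ q = K x y := fun y => by
      rw [← ENNReal.rpow_mul, one_div_mul_cancel hq0.ne', ENNReal.rpow_one]
    simp only [e1, e2] at hol
    calc (∫⁻ y, K x y * F y ∂ν) ^ p
        ≤ ((∫⁻ y, K x y * F y ^ p ∂ν) ^ (1 / p) * (∫⁻ y, K x y ∂ν) ^ (1 / q)) ^ p :=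
          ENNReal.rpow_le_rpow hol hp0.le
      _ = (∫⁻ y, K x y ∂ν) ^ (p - 1) * ∫⁻ y, K x y * F y ^ p ∂ν := by
          rw [ENNReal.mul_rpow_of_nonneg _ _ hp0.le, ← ENNReal.rpow_mul, ← ENNReal.rpow_mul,
            one_div_mul_cancel hp0.ne', ENNReal.rpow_one, mul_comm]
          congr 2
          rw [one_div, show q⁻¹ = 1 - p⁻¹ by linarith [hpq.inv_add_inv_eq_one]]
          field_simp
      _ ≤ _ := by
          gcongr
  have hmeas : Measurable (Function.uncurry fun x y => K x y * F y ^ p) :=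
    hK.mul ((hF.pow_const p).comp measurable_snd)
  have hm : Measurable fun x => ∫⁻ y, K x y * F y ^ p ∂ν := hmeas.lintegral_prod_right'
  calc ∫⁻ x, (∫⁻ y, K x y * F y ∂ν) ^ p ∂μ
      ≤ ∫⁻ x, A ^ (p - 1) * ∫⁻ y, K x y * F y ^ p ∂ν ∂μ := lintegral_mono_ae step
    _ = A ^ (p - 1) * ∫⁻ y, (∫⁻ x, K x y ∂μ) * F y ^ p ∂ν := by
        rw [lintegral_const_mul _ hm,
          lintegral_lintegral_swap hmeas.aemeasurable]
        congr 1
        refine lintegral_congr fun y => ?_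
        exact lintegral_mul_const _ (hK.comp measurable_prodMk_right)
    _ ≤ A ^ (p - 1) * ∫⁻ y, A * F y ^ p ∂ν := by
        gcongr 1
        exact lintegral_mono_ae (h2.mono fun y hy => by gcongr)
    _ = _ := by
        rw [lintegral_const_mul _ (hF.pow_const p), ← mul_assoc]
        congr 1
        nth_rw 2 [← ENNReal.rpow_one A]
        rw [← ENNReal.rpow_add_of_nonneg _ _ (by linarith) zero_le_one, sub_add_cancel]

end Schur

/-! ### Differentiation under the integral and primitives on the half-line -/

section Primitive

variable {E : Type*} [MeasurableSpace E] {ν : Measure E} [SFinite ν]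

/-- The fundamental theorem of calculus for almost every parameter, followed by Fubini.
Integrability is assumed only at the base point `s₀`; the bound on `A'` carries it to `s`. -/
theorem integral_sub_eq_intervalIntegral_of_hasDerivAt {A A' : ℝ → E → ℝ}
    (hA' : Measurable (Function.uncurry A'))
    (hd : ∀ᵐ ξ ∂ν, ∀ s, 0 < s → HasDerivAt (fun s => A s ξ) (A' s ξ) s)
    (hc : ∀ᵐ ξ ∂ν, ContinuousOn (fun s => A' s ξ) (Ioi 0)) {s₀ s : ℝ} (hs₀ : 0 < s₀)
    (hs : 0 < s) (hi : Integrable (A s₀) ν)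
    (hfin : ∫⁻ r in uIoc s₀ s, ∫⁻ ξ, ‖A' r ξ‖ₑ ∂ν < ∞) :
    Integrable (A s) ν ∧ IntervalIntegrable (fun r => ∫ ξ, A' r ξ ∂ν) volume s₀ s ∧
      (∫ ξ, A s ξ ∂ν) - ∫ ξ, A s₀ ξ ∂ν = ∫ r in s₀..s, ∫ ξ, A' r ξ ∂ν := by
  have hint : Integrable (Function.uncurry A') ((volume.restrict (uIoc s₀ s)).prod ν) := by
    refine ⟨hA'.aestronglyMeasurable, ?_⟩
    rw [hasFiniteIntegral_iff_enorm, lintegral_prod _ hA'.enorm.aemeasurable]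
    exact hfin
  have hsub : uIcc s₀ s ⊆ Ioi 0 := fun r hr => (lt_min hs₀ hs).trans_le hr.1
  have hftc : ∀ᵐ ξ ∂ν, A s ξ = A s₀ ξ + ∫ r in s₀..s, A' r ξ := by
    filter_upwards [hd, hc] with ξ h1 h2
    rw [intervalIntegral.integral_eq_sub_of_hasDerivAt (fun r hr => h1 r (hsub hr))
      (h2.mono hsub).intervalIntegrable]
    ring
  have hint' : Integrable (fun ξ => ∫ r in s₀..s, A' r ξ) ν := by
    have := hint.integral_prod_right
    simp only [Function.uncurry_def] at this
    simp only [intervalIntegral.intervalIntegral_eq_integral_uIoc]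
    exact (this.smul (if s₀ ≤ s then (1 : ℝ) else -1)).congr (Eventually.of_forall fun ω => rfl)
  refine ⟨(hi.add hint').congr (hftc.mono fun ξ h => h.symm), ?_, ?_⟩
  · rw [intervalIntegrable_iff]
    exact hint.integral_prod_left
  · rw [integral_congr_ae hftc, integral_add hi hint', intervalIntegral_integral_swap hint]
    ring

variable {U G : ℝ → ℝ}

theorem continuousOn_of_sub_eq_intervalIntegral
    (hG : ∀ a b, 0 < a → 0 < b → IntervalIntegrable G volume a b)
    (hU : ∀ a b, 0 < a → 0 < b → U b - U a = ∫ r in a..b, G r) : ContinuousOn U (Ioi 0) := by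
  intro s hs
  have hs' : (0 : ℝ) < s := hs
  have h := intervalIntegral.continuousOn_primitive_interval' (hG (s / 2) (s + 1) (by positivity)
    (by positivity)) left_mem_uIcc
  have hm : uIcc (s / 2) (s + 1) ∈ 𝓝 s := by
    rw [uIcc_of_le (by linarith)]; exact Icc_mem_nhds (by linarith) (by linarith)
  refine ((h.continuousAt hm).const_add (U (s / 2))).congr ?_ |>.continuousWithinAt
  filter_upwards [lt_mem_nhds hs'] with b hb
  linarith [hU (s / 2) b (by positivity) hb]

/-- Lebesgue differentiation on the intervals `[1 / (n + 1), n + 2]`, which exhaust the half-line.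
-/
theorem ae_hasDerivAt_of_sub_eq_intervalIntegral
    (hG : ∀ a b, 0 < a → 0 < b → IntervalIntegrable G volume a b)
    (hU : ∀ a b, 0 < a → 0 < b → U b - U a = ∫ r in a..b, G r) :
    ∀ᵐ s, 0 < s → HasDerivAt U (G s) s := by
  have h : ∀ᵐ s, ∀ n : ℕ, s ∈ uIcc (1 / ((n : ℝ) + 1)) (n + 2) →
      ∀ c ∈ uIcc (1 / ((n : ℝ) + 1)) (n + 2), HasDerivAt (fun x => ∫ r in c..x, G r) (G s) s :=
    ae_all_iff.2 fun n => (hG _ _ (by positivity) (by positivity)).ae_hasDerivAt_integral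
  filter_upwards [h] with s hs h0
  obtain ⟨n, hn⟩ := exists_nat_gt (max s (1 / s))
  have h1 : s < n := (le_max_left _ _).trans_lt hn
  have h2 : 1 / s < n := (le_max_right _ _).trans_lt hn
  have h3 : 1 / ((n : ℝ) + 1) ≤ s := by
    rw [div_le_iff₀ (by positivity)]
    rw [div_lt_iff₀ h0] at h2
    linarith
  have h4 := hs n (by rw [mem_uIcc]; left; exact ⟨h3, by linarith⟩) _ left_mem_uIcc
  refine (h4.const_add (U (1 / ((n : ℝ) + 1)))).congr_of_eventuallyEq ?_
  filter_upwards [lt_mem_nhds h0] with b hb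
  linarith [hU (1 / ((n : ℝ) + 1)) b (by positivity) hb]

/-- On an interval around the support of `η`, `U` coincides with an absolutely continuous primitive
of `G`, for which integration by parts holds; the boundary terms vanish with `η`. -/
theorem integral_mul_deriv_of_sub_eq_intervalIntegral
    (hG : ∀ a b, 0 < a → 0 < b → IntervalIntegrable G volume a b)
    (hU : ∀ a b, 0 < a → 0 < b → U b - U a = ∫ r in a..b, G r) {η : ℝ → ℝ}
    (hη : ContDiff ℝ 1 η) (hc : HasCompactSupport η) (hs : tsupport η ⊆ Ioi 0) :
    ∫ s in Ioi 0, U s * deriv η s = -∫ s in Ioi 0, G s * η s := by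
  obtain ⟨a, b, ha, hab, hsub⟩ : ∃ a b : ℝ, 0 < a ∧ a < b ∧ tsupport η ⊆ Ioo a b := by
    rcases (tsupport η).eq_empty_or_nonempty with h | h
    · exact ⟨1, 2, one_pos, one_lt_two, by simp [h]⟩
    · obtain ⟨m, hm, hm'⟩ := IsCompact.exists_isLeast hc h
      obtain ⟨M, hM, hM'⟩ := IsCompact.exists_isGreatest hc h
      have h0 : 0 < m := hs hm
      have : m ≤ M := hm' hM
      exact ⟨m / 2, M + 1, by positivity, by linarith, fun x hx =>
        ⟨by linarith [hm' hx], by linarith [hM' hx]⟩⟩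
  have hη0 : ∀ x ∉ Ioo a b, η x = 0 := fun x hx => image_eq_zero_of_notMem_tsupport
    fun h => hx (hsub h)
  have hη0' : ∀ x ∉ Ioo a b, deriv η x = 0 := fun x hx => image_eq_zero_of_notMem_tsupport
    fun h => hx (hsub (closure_minimal (support_deriv_subset (f := η)) (isClosed_tsupport _) h))
  have hIoo : Ioc a b ⊆ Ioi 0 := fun x hx => ha.trans hx.1
  have red : ∀ F : ℝ → ℝ, (∀ x ∉ Ioo a b, F x = 0) →
      ∫ s in Ioi 0, F s = ∫ s in a..b, F s := by
    intro F hF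
    rw [intervalIntegral.integral_of_le hab.le]
    exact setIntegral_eq_of_subset_of_forall_sdiff_eq_zero measurableSet_Ioi hIoo
      fun x hx => hF x fun h => hx.2 (Ioo_subset_Ioc_self h)
  rw [red _ fun x hx => by rw [hη0' x hx, mul_zero], red _ fun x hx => by rw [hη0 x hx, mul_zero]]
  set V : ℝ → ℝ := fun s => U a + ∫ r in a..s, G r
  have hGab := hG a b ha (ha.trans hab)
  have hV : AbsolutelyContinuousOnInterval V a b :=
    (ContDiffOn.absolutelyContinuousOnInterval (contDiffOn_const (c := U a))).add
      (hGab.absolutelyContinuousOnInterval_intervalIntegral left_mem_uIcc)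
  have hpos : ∀ s ∈ uIcc a b, 0 < s := fun s hs => by
    rw [uIcc_of_le hab.le] at hs; exact ha.trans_le hs.1
  have hUV : ∀ s ∈ uIcc a b, U s = V s := fun s hs => by
    simp only [V]; linarith [hU a s ha (hpos s hs)]
  have key := hV.integral_mul_deriv_eq_deriv_mul hη.contDiffOn.absolutelyContinuousOnInterval
  rw [hη0 a (by simp), hη0 b (by simp), mul_zero, mul_zero, sub_zero, zero_sub] at key
  rw [intervalIntegral.integral_congr fun s hs => by rw [hUV s hs], key]
  congr 1
  refine intervalIntegral.integral_congr_ae ?_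
  filter_upwards [hGab.ae_hasDerivAt_integral] with s hs hsm
  have := (hs (uIoc_subset_uIcc hsm) a left_mem_uIcc).const_add (U a)
  rw [this.deriv]

end Primitive

/-! ### The product kernel and its time integral -/

section ProductKernel

variable {d : ℕ} {α : Fin d → ℝ}

theorem weightedMeasure_eq : weightedMeasure α = Measure.pi fun i => speedMeasure (α i) := rfl

instance : SigmaFinite (weightedMeasure α) := by
  rw [weightedMeasure_eq]; infer_instance

theorem ae_weightedMeasure_pos : ∀ᵐ x ∂weightedMeasure α, ∀ i, 0 < x i := by
  rw [weightedMeasure_eq, ae_all_iff]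
  intro i
  exact (Measure.quasiMeasurePreserving_eval _ i).ae ae_speedMeasure_pos

/-- The product of the transition densities at time `t`, in which the factors with index in `S`
are differentiated with respect to the starting point. -/
@[irreducible] noncomputable def kernel (α : Fin d → ℝ) (S : Finset (Fin d)) (t : ℝ) (x y : Fin d → ℝ) : ℝ :=
  ∏ i, if i ∈ S then densityDeriv (α i) (rate (α i) t) (x i) (y i)
    else density (α i) (rate (α i) t) (x i) (y i)

theorem measurable_rate (a : ℝ) : Measurable (rate a) := by
  unfold rate; fun_prop

theorem measurable_kernel (hα : ∀ i, α i < 1) (S : Finset (Fin d)) :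
    Measurable fun p : ℝ × (Fin d → ℝ) × (Fin d → ℝ) => kernel α S p.1 p.2.1 p.2.2 := by
  unfold kernel
  refine Finset.measurable_prod _ fun i _ => ?_
  have h : Measurable fun p : ℝ × (Fin d → ℝ) × (Fin d → ℝ) =>
      (rate (α i) p.1, p.2.1 i, p.2.2 i) := by
    have := measurable_rate (α i)
    fun_prop
  split_ifs
  · exact (measurable_densityDeriv (hα i)).comp h
  · exact (measurable_density (hα i)).comp h

/-- The constant in the gradient bound for the one-dimensional transition density. -/
noncomputable def gradConst (a : ℝ) : ℝ := 3 * (2 - a) / shape a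

theorem gradConst_pos {a : ℝ} (ha : a < 1) : 0 < gradConst a :=
  div_pos (by linarith) (shape_pos ha)

/-- Lets one constant serve both marginals: `2 (2 - a)` comes from integrating in the target, `3 (2
- a) / shape a` from integrating in the starting point. -/
theorem two_mul_le_gradConst {a : ℝ} (ha : a < 1) : 2 * (2 - a) ≤ gradConst a := by
  rw [gradConst, le_div_iff₀ (shape_pos ha)]
  nlinarith [shape_le_one ha, shape_pos ha]

theorem enorm_kernel (S : Finset (Fin d)) (t : ℝ) (x y : Fin d → ℝ) :
    ‖kernel α S t x y‖ₑ = ∏ i, if i ∈ S then ‖densityDeriv (α i) (rate (α i) t) (x i) (y i)‖ₑ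
      else ‖density (α i) (rate (α i) t) (x i) (y i)‖ₑ := by
  rw [kernel, enorm_eq_nnnorm, nnnorm_prod, ENNReal.ofNNReal_finsetProd]
  refine Finset.prod_congr rfl fun i _ => ?_
  split_ifs <;> rfl

theorem lintegral_enorm_density {a r x : ℝ} (ha : a < 1) (hr : 0 < r) (hx : 0 ≤ x) :
    ∫⁻ z, ‖density a r x z‖ₑ ∂speedMeasure a = 1 := by
  rw [← lintegral_density ha hr hx]
  refine lintegral_congr_ae (ae_speedMeasure_pos.mono fun z hz => ?_)
  exact Real.enorm_of_nonneg (density_nonneg ha hr.le hx hz.le)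

theorem measurable_densityDeriv_right {a : ℝ} (ha : a < 1) (r x : ℝ) :
    Measurable (densityDeriv a r x) :=
  (measurable_densityDeriv ha).comp (by fun_prop : Measurable fun z : ℝ => (r, x, z))

theorem measurable_densityDeriv_left {a : ℝ} (ha : a < 1) (r z : ℝ) :
    Measurable fun x => densityDeriv a r x z :=
  (measurable_densityDeriv ha).comp (by fun_prop : Measurable fun x : ℝ => (r, x, z))

/-- Tonelli factors the integral; undifferentiated coordinates contribute mass one. -/
theorem lintegral_enorm_kernel_right (hα : ∀ i, α i ∈ Ioo (0 : ℝ) 1) (S : Finset (Fin d)) {t : ℝ}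
    (ht : 0 < t) {x : Fin d → ℝ} (hx : ∀ i, 0 < x i) :
    ∫⁻ y, ‖kernel α S t x y‖ₑ ∂weightedMeasure α
      ≤ ∏ i ∈ S, ENNReal.ofReal (gradConst (α i) * rate (α i) t ^ (1 / (2 - α i))) := by
  have hr : ∀ i, 0 < rate (α i) t := fun i => rate_pos (by linarith [(hα i).2]) ht
  simp_rw [enorm_kernel]
  rw [weightedMeasure_eq, lintegral_fin_prod (fun i => speedMeasure (α i)) (f := fun i y =>
    if i ∈ S then ‖densityDeriv (α i) (rate (α i) t) (x i) y‖ₑ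
      else ‖density (α i) (rate (α i) t) (x i) y‖ₑ), ← Fintype.prod_ite_mem S]
  · refine Finset.prod_le_prod' fun i _ => ?_
    split_ifs
    · refine (lintegral_enorm_densityDeriv_le (hα i).1 (hα i).2 (hr i) (hx i)).trans
        (ENNReal.ofReal_le_ofReal ?_)
      have := two_mul_le_gradConst (hα i).2
      have := (hr i).le
      gcongr
    · exact (lintegral_enorm_density (hα i).2 (hr i) (hx i).le).le
  · intro i
    split_ifs
    · exact (measurable_densityDeriv_right (hα i).2 _ _).enorm
    · exact (measurable_density_right (hα i).2 _ _).enorm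

/-- For the undifferentiated factors, symmetry of the density turns the integral over the starting
point into a total mass. -/
theorem lintegral_enorm_kernel_left (hα : ∀ i, α i ∈ Ioo (0 : ℝ) 1) (S : Finset (Fin d)) {t : ℝ}
    (ht : 0 < t) {y : Fin d → ℝ} (hy : ∀ i, 0 < y i) :
    ∫⁻ x, ‖kernel α S t x y‖ₑ ∂weightedMeasure α
      ≤ ∏ i ∈ S, ENNReal.ofReal (gradConst (α i) * rate (α i) t ^ (1 / (2 - α i))) := by
  have hr : ∀ i, 0 < rate (α i) t := fun i => rate_pos (by linarith [(hα i).2]) ht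
  simp_rw [enorm_kernel]
  rw [weightedMeasure_eq, lintegral_fin_prod (fun i => speedMeasure (α i)) (f := fun i x =>
    if i ∈ S then ‖densityDeriv (α i) (rate (α i) t) x (y i)‖ₑ
      else ‖density (α i) (rate (α i) t) x (y i)‖ₑ), ← Fintype.prod_ite_mem S]
  · refine Finset.prod_le_prod' fun i _ => ?_
    split_ifs
    · exact lintegral_enorm_densityDeriv_le' (hα i).1 (hα i).2 (hr i) (hy i).le
    · simp_rw [density_comm (α i) _ _ (y i)]
      exact (lintegral_enorm_density (hα i).2 (hr i) (hy i).le).le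
  · intro i
    split_ifs
    · exact (measurable_densityDeriv_left (hα i).2 _ _).enorm
    · simp_rw [density_comm (α i) _ _ (y i)]
      exact (measurable_density_right (hα i).2 _ _).enorm

/-- The mass of the time-integrated kernel. -/
noncomputable def kernelMass (α : Fin d → ℝ) (S : Finset (Fin d)) (l : ℝ) : ℝ≥0∞ :=
  ∫⁻ t in Ioi (0 : ℝ), ENNReal.ofReal (Real.exp (-l * t))
    * ∏ i ∈ S, ENNReal.ofReal (gradConst (α i) * rate (α i) t ^ (1 / (2 - α i)))

theorem kernelMass_empty {l : ℝ} (hl : 0 < l) :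
    kernelMass α ∅ l = ENNReal.ofReal (1 / l) := by
  simp only [kernelMass, Finset.prod_empty, mul_one]
  rw [← ofReal_integral_eq_lintegral_ofReal (exp_neg_integrableOn_Ioi 0 hl)
    (Eventually.of_forall fun t => (Real.exp_pos _).le), integral_exp_mul_Ioi (neg_neg_of_pos hl)]
  simp

/-- The constant in the gradient bound for the resolvent. -/
noncomputable def resolventConst (a : ℝ) : ℝ :=
  gradConst a * (1 / (2 - a) ^ 2) ^ (1 / (2 - a)) * Real.Gamma (1 - 1 / (2 - a))

theorem one_div_two_sub_lt_one {a : ℝ} (ha : a < 1) : 1 / (2 - a) < 1 := by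
  rw [div_lt_one (by linarith)]; linarith

theorem resolventConst_pos {a : ℝ} (ha : a < 1) : 0 < resolventConst a := by
  have h2 : 0 < 2 - a := by linarith
  have := gradConst_pos ha
  have := Real.Gamma_pos_of_pos (show 0 < 1 - 1 / (2 - a) by linarith [one_div_two_sub_lt_one ha])
  unfold resolventConst; positivity

/-- The rate is a constant times `1 / t`, so this is a Gamma integral in `t ^ (-1 / (2 - α i))`. It
converges at `0` because `α i < 1`, and rescaling time produces the power of `l` in the final
estimate. -/
theorem kernelMass_singleton (hα : ∀ i, α i < 1) (i : Fin d) {l : ℝ} (hl : 0 < l) :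
    kernelMass α {i} l
      = ENNReal.ofReal (resolventConst (α i) * l ^ (1 / (2 * (1 - α i / 2)) - 1)) := by
  have h1 := one_div_two_sub_lt_one (hα i)
  have h2 : 0 < 2 - α i := by linarith [hα i]
  have hg := gradConst_pos (hα i)
  set e := 1 / (2 - α i) with he
  have e1 : ∀ t ∈ Ioi (0 : ℝ), ENNReal.ofReal (Real.exp (-l * t))
      * ENNReal.ofReal (gradConst (α i) * rate (α i) t ^ e)
      = ENNReal.ofReal (gradConst (α i) * (1 / (2 - α i) ^ 2) ^ e *
        (t ^ ((1 - e) - 1) * Real.exp (-(l * t)))) := by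
    intro t ht
    have ht' : (0 : ℝ) < t := ht
    rw [← ENNReal.ofReal_mul (Real.exp_pos _).le]
    congr 1
    rw [rate, ← div_div, div_eq_mul_inv _ t, Real.mul_rpow (by positivity) (by positivity),
      Real.inv_rpow ht'.le, ← Real.rpow_neg ht'.le, show 1 - e - 1 = -e by ring]
    ring_nf
  have hint : IntegrableOn (fun t : ℝ => t ^ ((1 - e) - 1) * Real.exp (-(l * t))) (Ioi 0) := by
    have := integrableOn_rpow_mul_exp_neg_mul_rpow (p := 1) (s := (1 - e) - 1) (b := l)
      (by linarith) one_pos hl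
    simpa using this
  simp only [kernelMass, Finset.prod_singleton]
  rw [setLIntegral_congr_fun measurableSet_Ioi e1, ← ofReal_integral_eq_lintegral_ofReal
    (hint.const_mul _), integral_const_mul, Real.integral_rpow_mul_exp_neg_mul_Ioi
      (by linarith) hl]
  · congr 1
    rw [resolventConst, one_div l, Real.inv_rpow hl.le, ← Real.rpow_neg hl.le,
      show 2 * (1 - α i / 2) = 2 - α i by ring, ← he, neg_sub]
    ring
  · filter_upwards [ae_restrict_mem measurableSet_Ioi] with t ht
    have ht' : (0 : ℝ) < t := ht
    positivity

variable {S : Finset (Fin d)} {l p : ℝ}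

theorem measurable_enorm_exp_mul_kernel (hα : ∀ i, α i < 1) (S : Finset (Fin d)) (l : ℝ) :
    Measurable fun q : ℝ × (Fin d → ℝ) × (Fin d → ℝ) =>
      ENNReal.ofReal (Real.exp (-l * q.1)) * ‖kernel α S q.1 q.2.1 q.2.2‖ₑ := by
  have := measurable_kernel hα S
  fun_prop

/-- The absolute value of the kernel, integrated in time. -/
noncomputable def timeKernel (α : Fin d → ℝ) (S : Finset (Fin d)) (l : ℝ) (x y : Fin d → ℝ) :
    ℝ≥0∞ :=
  ∫⁻ t in Ioi (0 : ℝ), ENNReal.ofReal (Real.exp (-l * t)) * ‖kernel α S t x y‖ₑ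

theorem measurable_timeKernel (hα : ∀ i, α i < 1) (S : Finset (Fin d)) (l : ℝ) :
    Measurable (Function.uncurry (timeKernel α S l)) :=
  (measurable_enorm_exp_mul_kernel hα S l).lintegral_prod_left'

theorem lintegral_timeKernel_right (hα : ∀ i, α i ∈ Ioo (0 : ℝ) 1) {x : Fin d → ℝ}
    (hx : ∀ i, 0 < x i) :
    ∫⁻ y, timeKernel α S l x y ∂weightedMeasure α ≤ kernelMass α S l := by
  have hm := measurable_enorm_exp_mul_kernel (fun i => (hα i).2) S l
  have hmk := measurable_kernel (fun i => (hα i).2) S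
  have hm' : Measurable (Function.uncurry fun (y : Fin d → ℝ) (t : ℝ) =>
      ENNReal.ofReal (Real.exp (-l * t)) * ‖kernel α S t x y‖ₑ) :=
    hm.comp (by fun_prop : Measurable fun q : (Fin d → ℝ) × ℝ => (q.2, x, q.1))
  simp only [timeKernel]
  rw [lintegral_lintegral_swap hm'.aemeasurable]
  refine lintegral_mono_ae ?_
  filter_upwards [ae_restrict_mem measurableSet_Ioi] with t ht
  have hmt : Measurable fun y : Fin d → ℝ => kernel α S t x y :=
    hmk.comp (by fun_prop : Measurable fun y : Fin d → ℝ => (t, x, y))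
  rw [lintegral_const_mul _ hmt.enorm]
  gcongr
  exact lintegral_enorm_kernel_right hα S ht hx

theorem lintegral_timeKernel_left (hα : ∀ i, α i ∈ Ioo (0 : ℝ) 1) {y : Fin d → ℝ}
    (hy : ∀ i, 0 < y i) :
    ∫⁻ x, timeKernel α S l x y ∂weightedMeasure α ≤ kernelMass α S l := by
  have hm := measurable_enorm_exp_mul_kernel (fun i => (hα i).2) S l
  have hmk := measurable_kernel (fun i => (hα i).2) S
  have hm' : Measurable (Function.uncurry fun (x : Fin d → ℝ) (t : ℝ) =>
      ENNReal.ofReal (Real.exp (-l * t)) * ‖kernel α S t x y‖ₑ) :=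
    hm.comp (by fun_prop : Measurable fun q : (Fin d → ℝ) × ℝ => (q.2, q.1, y))
  simp only [timeKernel]
  rw [lintegral_lintegral_swap hm'.aemeasurable]
  refine lintegral_mono_ae ?_
  filter_upwards [ae_restrict_mem measurableSet_Ioi] with t ht
  have hmt : Measurable fun x : Fin d → ℝ => kernel α S t x y :=
    hmk.comp (by fun_prop : Measurable fun x : Fin d → ℝ => (t, x, y))
  rw [lintegral_const_mul _ hmt.enorm]
  gcongr
  exact lintegral_enorm_kernel_left hα S ht hy

/-- The integrand of the resolvent (and of its derivatives) on time-space. -/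
noncomputable def resolventIntegrand (α : Fin d → ℝ) (S : Finset (Fin d)) (l : ℝ)
    (f : (Fin d → ℝ) → ℝ) (x : Fin d → ℝ) (ξ : ℝ × (Fin d → ℝ)) : ℝ :=
  Real.exp (-l * ξ.1) * (kernel α S ξ.1 x ξ.2 * f ξ.2)

/-- The measure on time-space. -/
noncomputable def timeSpace (α : Fin d → ℝ) : Measure (ℝ × (Fin d → ℝ)) :=
  (volume.restrict (Ioi (0 : ℝ))).prod (weightedMeasure α)

instance : SFinite (timeSpace α) := by unfold timeSpace; infer_instance

variable {f : (Fin d → ℝ) → ℝ}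

theorem measurable_resolventIntegrand (hα : ∀ i, α i < 1) (S : Finset (Fin d)) (l : ℝ)
    (hf : Measurable f) : Measurable (Function.uncurry (resolventIntegrand α S l f)) := by
  have hk := measurable_kernel hα S
  unfold Function.uncurry resolventIntegrand
  generalize kernel α S = k at hk ⊢
  have h : Measurable fun q : (Fin d → ℝ) × ℝ × (Fin d → ℝ) => k q.2.1 q.1 q.2.2 :=
    hk.comp (by fun_prop : Measurable fun q : (Fin d → ℝ) × ℝ × (Fin d → ℝ) => (q.2.1, q.1, q.2.2))
  have h1 : Measurable fun q : (Fin d → ℝ) × ℝ × (Fin d → ℝ) => Real.exp (-l * q.2.1) := by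
    fun_prop
  exact h1.mul (h.mul (hf.comp (measurable_snd.comp measurable_snd)))

theorem lintegral_enorm_resolventIntegrand (hα : ∀ i, α i < 1) (hf : Measurable f)
    (x : Fin d → ℝ) :
    ∫⁻ ξ, ‖resolventIntegrand α S l f x ξ‖ₑ ∂timeSpace α
      = ∫⁻ y, timeKernel α S l x y * ‖f y‖ₑ ∂weightedMeasure α := by
  have hm : Measurable (resolventIntegrand α S l f x) :=
    (measurable_resolventIntegrand hα S l hf).comp measurable_prodMk_left
  rw [timeSpace, lintegral_prod_symm _ hm.enorm.aemeasurable]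
  refine lintegral_congr fun y => ?_
  have hmt : Measurable fun t : ℝ => ENNReal.ofReal (Real.exp (-l * t)) * ‖kernel α S t x y‖ₑ :=
    (measurable_enorm_exp_mul_kernel hα S l).comp (by fun_prop : Measurable fun t : ℝ => (t, x, y))
  rw [timeKernel, ← lintegral_mul_const _ hmt]
  refine lintegral_congr fun t => ?_
  rw [resolventIntegrand, enorm_mul, enorm_mul, Real.enorm_of_nonneg (Real.exp_pos _).le,
    mul_assoc]

theorem measurable_lintegral_enorm_resolventIntegrand (hα : ∀ i, α i < 1) (hf : Measurable f) :
    Measurable fun x => ∫⁻ ξ, ‖resolventIntegrand α S l f x ξ‖ₑ ∂timeSpace α :=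
  (measurable_resolventIntegrand hα S l hf).enorm.lintegral_prod_right'

/-- The Schur test is applied with absolute values inside, so that besides the `L^p` bound it yields
absolute convergence at almost every point. -/
theorem lintegral_rpow_lintegral_resolventIntegrand_le (hα : ∀ i, α i ∈ Ioo (0 : ℝ) 1)
    (hp : 1 < p) (hf : Measurable f) :
    ∫⁻ x, (∫⁻ ξ, ‖resolventIntegrand α S l f x ξ‖ₑ ∂timeSpace α) ^ p ∂weightedMeasure α
      ≤ kernelMass α S l ^ p * ∫⁻ y, ‖f y‖ₑ ^ p ∂weightedMeasure α := by
  simp_rw [lintegral_enorm_resolventIntegrand (fun i => (hα i).2) hf]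
  exact lintegral_rpow_kernel_le hp (measurable_timeKernel (fun i => (hα i).2) S l) hf.enorm
    (ae_weightedMeasure_pos.mono fun x hx => lintegral_timeKernel_right hα hx)
    (ae_weightedMeasure_pos.mono fun y hy => lintegral_timeKernel_left hα hy)

end ProductKernel

/-! ### The law of the process on the orthant and its resolvent -/

section Law

variable {Ω : Type*} [MeasurableSpace Ω] {d : ℕ} {α : Fin d → ℝ} {P : (Fin d → ℝ) → Measure Ω}
  {X : ℝ≥0 → Ω → Fin d → ℝ} {x : Fin d → ℝ}

theorem IsProductDiffusion.measurable (h : IsProductDiffusion α P X) (hx : x ∈ orthant d)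
    (t : ℝ≥0) : Measurable (X t) :=
  measurable_pi_iff.2 fun i => (h.coord x hx i).measurable t

theorem kernel_empty (t : ℝ) (x y : Fin d → ℝ) :
    kernel α ∅ t x y = ∏ i, density (α i) (rate (α i) t) (x i) (y i) := by
  simp [kernel]

theorem ofReal_kernel_empty (hα : ∀ i, α i ∈ Ioo (0 : ℝ) 1) {t : ℝ} (ht : 0 < t)
    (hx : x ∈ orthant d) {y : Fin d → ℝ} (hy : ∀ i, 0 < y i) :
    ENNReal.ofReal (kernel α ∅ t x y)
      = ∏ i, ENNReal.ofReal (density (α i) (rate (α i) t) (x i) (y i)) := by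
  rw [kernel_empty, ENNReal.ofReal_prod_of_nonneg fun i _ => density_nonneg (hα i).2
    (rate_pos (by linarith [(hα i).2]) ht).le (hx i) (hy i).le]

theorem measurable_kernel_right (hα : ∀ i, α i < 1) (S : Finset (Fin d)) (t : ℝ) (x : Fin d → ℝ) :
    Measurable (kernel α S t x) :=
  (measurable_kernel hα S).comp (by fun_prop : Measurable fun y : Fin d → ℝ => (t, x, y))

theorem IsProductDiffusion.map_eq (h : IsProductDiffusion α P X)
    (hα : ∀ i, α i ∈ Ioo (0 : ℝ) 1) (hx : x ∈ orthant d) {t : ℝ≥0} (ht : 0 < t) :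
    (P x).map (X t)
      = (weightedMeasure α).withDensity fun y => ENNReal.ofReal (kernel α ∅ t x y) := by
  have := h.prob x hx
  have ht' : (0 : ℝ) < t := ht
  have hX := h.measurable hx t
  have hind : iIndepFun (fun (i : Fin d) (ω : Ω) => X t ω i) (P x) :=
    (h.indep x hx).comp (fun _ w => w t) fun _ => measurable_pi_apply t
  have h1 := (iIndepFun_iff_map_fun_eq_pi_map
    (fun i => ((h.coord x hx i).measurable t).aemeasurable)).1 hind
  have h2 := fun i => (h.coord x hx i).map_eq (hα i) (hx i) ht
  have h3 : ∀ i, IsProbabilityMeasure ((speedMeasure (α i)).withDensity fun y =>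
      ENNReal.ofReal (density (α i) (rate (α i) t) (x i) y)) := fun i =>
    isProbabilityMeasure_withDensity_density (hα i).2
      (rate_pos (by linarith [(hα i).2]) ht') (hx i)
  calc (P x).map (X t) = Measure.pi fun i => (speedMeasure (α i)).withDensity fun y =>
        ENNReal.ofReal (density (α i) (rate (α i) t) (x i) y) := by
        rw [show X t = fun ω i => X t ω i from rfl, h1]
        simp_rw [h2]
    _ = _ := by
      rw [pi_withDensity _ fun i => (measurable_density_right (hα i).2 _ _).ennreal_ofReal,
        ← weightedMeasure_eq]
      refine withDensity_congr_ae (ae_weightedMeasure_pos.mono fun y hy => ?_)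
      exact (ofReal_kernel_empty hα ht' hx hy).symm

/-- At a fixed time and starting point the density is bounded in the target. Hence `f(X_t)` is
integrable from every point of the orthant when `f` is in `L^p`. -/
theorem exists_map_le_smul (h : IsProductDiffusion α P X)
    (hα : ∀ i, α i ∈ Ioo (0 : ℝ) 1) (hx : x ∈ orthant d) {t : ℝ≥0} (ht : 0 < t) :
    ∃ c : ℝ≥0∞, c ≠ ∞ ∧ (P x).map (X t) ≤ c • weightedMeasure α := by
  have ht' : (0 : ℝ) < t := ht
  have hr : ∀ i, 0 < rate (α i) t := fun i => rate_pos (by linarith [(hα i).2]) ht'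
  choose b hb using fun i => show ∃ b : ℝ, ∀ z, 0 ≤ z → density (α i) (rate (α i) t) (x i) z ≤ b from
    ⟨_, fun z hz => density_le (hα i).2 (hr i) (hx i) hz⟩
  refine ⟨∏ i, ENNReal.ofReal (b i), ENNReal.prod_ne_top fun i _ => ENNReal.ofReal_ne_top, ?_⟩
  rw [h.map_eq hα hx ht, ← withDensity_const]
  refine withDensity_mono (ae_weightedMeasure_pos.mono fun y hy => ?_)
  simp only [ofReal_kernel_empty hα ht' hx hy]
  exact Finset.prod_le_prod' fun i _ => ENNReal.ofReal_le_ofReal (hb i _ (hy i).le)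

variable {f f' : (Fin d → ℝ) → ℝ} {p : ℝ} {l : ℝ}

theorem IsProductDiffusion.integrable (h : IsProductDiffusion α P X)
    (hα : ∀ i, α i ∈ Ioo (0 : ℝ) 1) (hp : 1 < p)
    (hf : MemLp f (ENNReal.ofReal p) (weightedMeasure α)) (hx : x ∈ orthant d) {t : ℝ≥0}
    (ht : 0 < t) : Integrable (fun ω => f (X t ω)) (P x) := by
  have := h.prob x hx
  have hX := h.measurable hx t
  have := Measure.isProbabilityMeasure_map (μ := P x) hX.aemeasurable
  obtain ⟨c, hc, hle⟩ := exists_map_le_smul h hα hx ht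
  have hi : Integrable f ((P x).map (X t)) :=
    (hf.of_measure_le_smul hc hle).integrable (ENNReal.one_le_ofReal.2 hp.le)
  exact hi.comp_measurable hX

/-- The law of `X t` is absolutely continuous, so `f` may be exchanged for a Borel representative
`f'`. -/
theorem IsProductDiffusion.semigroup_eq (h : IsProductDiffusion α P X)
    (hα : ∀ i, α i ∈ Ioo (0 : ℝ) 1) (hf' : Measurable f') (hff' : f =ᵐ[weightedMeasure α] f')
    (hx : x ∈ orthant d) {t : ℝ≥0} (ht : 0 < t) :
    semigroup P X t f x = ∫ y, kernel α ∅ t x y * f' y ∂weightedMeasure α := by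
  have ht' : (0 : ℝ) < t := ht
  have hX := h.measurable hx t
  have hmap := h.map_eq hα hx ht
  have hae : f =ᵐ[(P x).map (X t)] f' := by
    rw [hmap]; exact (withDensity_absolutelyContinuous _ _).ae_le hff'
  have h1 : semigroup P X t f x = ∫ ω, f' (X t ω) ∂P x :=
    integral_congr_ae (ae_of_ae_map hX.aemeasurable hae)
  rw [h1, ← integral_map hX.aemeasurable hf'.aestronglyMeasurable, hmap,
    integral_withDensity_eq_integral_toReal_smul
      (measurable_kernel_right (fun i => (hα i).2) _ _ _).ennreal_ofReal
      (ae_of_all _ fun _ => ENNReal.ofReal_lt_top)]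
  refine integral_congr_ae (ae_weightedMeasure_pos.mono fun y hy => ?_)
  have hk : 0 ≤ kernel α ∅ t x y := by
    rw [kernel_empty]
    exact Finset.prod_nonneg fun i _ => density_nonneg (hα i).2
      (rate_pos (by linarith [(hα i).2]) ht').le (hx i) (hy i).le
  simp only [ENNReal.toReal_ofReal hk, smul_eq_mul]

/-- The integral of `resolventIntegrand` over time-space. -/
noncomputable def resolventIntegral (α : Fin d → ℝ) (S : Finset (Fin d)) (l : ℝ)
    (f : (Fin d → ℝ) → ℝ) (x : Fin d → ℝ) : ℝ :=
  ∫ ξ, resolventIntegrand α S l f x ξ ∂timeSpace α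

theorem measurable_resolventIntegral (hα : ∀ i, α i < 1) (S : Finset (Fin d)) (l : ℝ)
    (hf : Measurable f) : Measurable (resolventIntegral α S l f) :=
  (measurable_resolventIntegrand hα S l hf).stronglyMeasurable.integral_prod_right.measurable

theorem IsProductDiffusion.resolvent_eq (h : IsProductDiffusion α P X)
    (hα : ∀ i, α i ∈ Ioo (0 : ℝ) 1) (hf' : Measurable f') (hff' : f =ᵐ[weightedMeasure α] f')
    (hx : x ∈ orthant d) (hi : Integrable (resolventIntegrand α ∅ l f' x) (timeSpace α)) :
    IntegrableOn (fun t : ℝ => Real.exp (-l * t) * semigroup P X t.toNNReal f x) (Ioi 0) ∧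
      resolvent P X l f x = resolventIntegral α ∅ l f' x := by
  have e : ∀ t ∈ Ioi (0 : ℝ), ∫ y, resolventIntegrand α ∅ l f' x (t, y) ∂weightedMeasure α
      = Real.exp (-l * t) * semigroup P X t.toNNReal f x := by
    intro t ht
    have ht' : (0 : ℝ) < t := ht
    rw [h.semigroup_eq hα hf' hff' hx (Real.toNNReal_pos.2 ht'), Real.coe_toNNReal _ ht'.le,
      ← integral_const_mul]
    rfl
  rw [timeSpace] at hi
  refine ⟨?_, ?_⟩
  · exact (integrable_congr ((ae_restrict_mem measurableSet_Ioi).mono e)).1 hi.integral_prod_left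
  · rw [resolvent, resolventIntegral, timeSpace, integral_prod _ hi]
    exact (setIntegral_congr_fun measurableSet_Ioi e).symm

end Law

/-! ### Slicing along coordinate lines -/

section Slice

variable {n : ℕ} (μ : Fin (n + 1) → Measure ℝ) [∀ j, SigmaFinite (μ j)] (i : Fin (n + 1))

/-- The line in the direction `i` through the point with the other coordinates `x`. -/
def line (i : Fin (n + 1)) (x : Fin n → ℝ) (s : ℝ) : Fin (n + 1) → ℝ :=
  i.insertNth (α := fun _ => ℝ) s x

@[simp] theorem line_same (x : Fin n → ℝ) (s : ℝ) : line i x s i = s :=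
  Fin.insertNth_apply_same (α := fun _ => ℝ) i s x

@[simp] theorem line_succAbove (x : Fin n → ℝ) (s : ℝ) (j : Fin n) :
    line i x s (i.succAbove j) = x j :=
  Fin.insertNth_apply_succAbove (α := fun _ => ℝ) i s x j

theorem update_line (x : Fin n → ℝ) (s r : ℝ) : Function.update (line i x s) i r = line i x r :=
  Fin.update_insertNth (α := fun _ => ℝ) i s r x

theorem line_removeNth (x : Fin (n + 1) → ℝ) (s : ℝ) :
    line i (i.removeNth x) s = Function.update x i s :=
  Fin.insertNth_removeNth (α := fun _ => ℝ) i s x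

theorem measurePreserving_line :
    MeasurePreserving (fun q : ℝ × (Fin n → ℝ) => line i q.2 q.1)
      ((μ i).prod (Measure.pi fun j => μ (i.succAbove j))) (Measure.pi μ) :=
  (measurePreserving_piFinSuccAbove μ i).symm (MeasurableEquiv.piFinSuccAbove (fun _ => ℝ) i)

theorem measurable_line : Measurable fun q : ℝ × (Fin n → ℝ) => line i q.2 q.1 :=
  (MeasurableEquiv.piFinSuccAbove (fun _ => ℝ) i).symm.measurable

theorem measurable_line_right (x : Fin n → ℝ) : Measurable (line i x) :=
  (measurable_line i).comp measurable_prodMk_right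

theorem lintegral_pi_eq_lintegral_line {F : (Fin (n + 1) → ℝ) → ℝ≥0∞} (hF : Measurable F) :
    ∫⁻ x, F x ∂Measure.pi μ
      = ∫⁻ x, ∫⁻ s, F (line i x s) ∂μ i ∂Measure.pi fun j => μ (i.succAbove j) := by
  rw [← (measurePreserving_line μ i).lintegral_comp hF]
  exact lintegral_prod_symm _ (hF.comp (measurable_line i)).aemeasurable

theorem integral_pi_eq_integral_line {F : (Fin (n + 1) → ℝ) → ℝ} (hF : Integrable F (Measure.pi μ)) :
    ∫ x, F x ∂Measure.pi μ
      = ∫ x, ∫ s, F (line i x s) ∂μ i ∂Measure.pi fun j => μ (i.succAbove j) := by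
  have hm := measurePreserving_line μ i
  have he : MeasurableEmbedding (fun q : ℝ × (Fin n → ℝ) => line i q.2 q.1) :=
    (MeasurableEquiv.piFinSuccAbove (fun _ => ℝ) i).symm.measurableEmbedding
  rw [← hm.integral_comp he, integral_prod_symm]
  exact (hm.integrable_comp_emb he).2 hF

/-- Tonelli applied to the indicator of the exceptional set. Measurability of that set is essential,
and it is why differentiability is later expressed through rational increments. -/
theorem ae_pi_of_ae_line {q : (Fin (n + 1) → ℝ) → Prop} (hq : MeasurableSet {x | q x})
    (h : ∀ᵐ x ∂Measure.pi fun j => μ (i.succAbove j), ∀ᵐ s ∂μ i, q (line i x s)) :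
    ∀ᵐ x ∂Measure.pi μ, q x := by
  have hc : MeasurableSet {x | q x}ᶜ := hq.compl
  have h0 : ∫⁻ x, ({x | q x}ᶜ : Set _).indicator (fun _ => (1 : ℝ≥0∞)) x ∂Measure.pi μ = 0 := by
    rw [lintegral_pi_eq_lintegral_line μ i (measurable_const.indicator hc)]
    refine (lintegral_congr_ae (g := 0) ?_).trans (by simp)
    filter_upwards [h] with x hx
    refine (lintegral_congr_ae (g := 0) ?_).trans (by simp)
    filter_upwards [hx] with s hs
    simp [hs]
  rw [lintegral_indicator hc, setLIntegral_one] at h0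
  exact h0

theorem ae_pi_removeNth {q : (Fin n → ℝ) → Prop}
    (h : ∀ᵐ x ∂Measure.pi fun j => μ (i.succAbove j), q x) :
    ∀ᵐ x ∂Measure.pi μ, q (i.removeNth x) := by
  have hm := (measurePreserving_piFinSuccAbove μ i).quasiMeasurePreserving
  exact (Measure.quasiMeasurePreserving_snd.comp hm).ae h

end Slice

/-! ### Differentiability as a countable condition -/

section Derivative

/-- For a continuous function, differentiability can be tested along rational increments. -/
theorem hasDerivAt_iff_forall_rat {U : ℝ → ℝ} {s g : ℝ} (hs : 0 < s)
    (hU : ContinuousOn U (Ioi 0)) :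
    HasDerivAt U g s ↔ ∀ k : ℕ, ∃ m : ℕ, ∀ q : ℚ, |(q : ℝ)| < 1 / ((m : ℝ) + 1) →
      |U (s + q) - U s - q * g| ≤ 1 / ((k : ℝ) + 1) * |(q : ℝ)| := by
  rw [hasDerivAt_iff_isLittleO_nhds_zero, Asymptotics.isLittleO_iff]
  simp only [Real.norm_eq_abs, smul_eq_mul]
  constructor
  · intro h k
    obtain ⟨ε, hε, h⟩ := Metric.eventually_nhds_iff.1 (h (show 0 < 1 / ((k : ℝ) + 1) by positivity))
    obtain ⟨m, hm⟩ := exists_nat_one_div_lt hε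
    refine ⟨m, fun q hq => h ?_⟩
    rw [Real.dist_eq, sub_zero]
    exact hq.trans hm
  · intro h c hc
    obtain ⟨k, hk⟩ := exists_nat_one_div_lt hc
    obtain ⟨m, hm⟩ := h k
    -- The bound `δ ≤ s` keeps `s + r` in the half-line, where `U` is continuous.
    set δ := min (1 / ((m : ℝ) + 1)) s with hδ
    have hδ0 : 0 < δ := lt_min (by positivity) hs
    refine Metric.eventually_nhds_iff.2 ⟨δ, hδ0, fun r hr => ?_⟩
    rw [Real.dist_eq, sub_zero] at hr
    refine le_trans ?_ (mul_le_mul_of_nonneg_right hk.le (abs_nonneg r))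
    -- By continuity a failure at a real increment persists on an open set, which contains a
    -- rational increment.
    by_contra! hlt
    set F : ℝ → ℝ := fun r => |U (s + r) - U s - r * g| - 1 / ((k : ℝ) + 1) * |r| with hF
    have hFc : ContinuousOn F (Ioo (-δ) δ) := by
      have h1 : ContinuousOn (fun r => U (s + r)) (Ioo (-δ) δ) :=
        hU.comp (by fun_prop) fun r hr => by
          have : δ ≤ s := min_le_right _ _
          have := hr.1
          show 0 < s + r
          linarith
      exact ((h1.sub continuousOn_const).sub (by fun_prop)).abs.sub (by fun_prop)
    have hopen := hFc.isOpen_inter_preimage isOpen_Ioo (isOpen_Ioi (a := (0 : ℝ)))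
    obtain ⟨q, hq⟩ := Rat.denseRange_cast.exists_mem_open hopen
      ⟨r, abs_lt.1 hr, by simp only [hF, mem_preimage, mem_Ioi]; linarith⟩
    have h1 : |(q : ℝ)| < δ := abs_lt.2 hq.1
    have h2 : 0 < F q := hq.2
    have h3 := hm q (h1.trans_le (min_le_left _ _))
    simp only [hF] at h2
    linarith

end Derivative

/-! ### The resolvent on almost every line -/

section Line

variable {n : ℕ} {α : Fin (n + 1) → ℝ} (i : Fin (n + 1)) {f : (Fin (n + 1) → ℝ) → ℝ} {p l : ℝ}

theorem kernel_empty_line (t : ℝ) (x : Fin n → ℝ) (s : ℝ) (y : Fin (n + 1) → ℝ) :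
    kernel α ∅ t (line i x s) y = density (α i) (rate (α i) t) s (y i)
      * ∏ j, density (α (i.succAbove j)) (rate (α (i.succAbove j)) t) (x j) (y (i.succAbove j)) := by
  simp [kernel, Fin.prod_univ_succAbove _ i]

theorem kernel_singleton_line (t : ℝ) (x : Fin n → ℝ) (s : ℝ) (y : Fin (n + 1) → ℝ) :
    kernel α {i} t (line i x s) y = densityDeriv (α i) (rate (α i) t) s (y i)
      * ∏ j, density (α (i.succAbove j)) (rate (α (i.succAbove j)) t) (x j) (y (i.succAbove j)) := by
  simp [kernel, Fin.prod_univ_succAbove _ i, Fin.succAbove_ne]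

theorem hasDerivAt_resolventIntegrand_line (hα : α i < 1) (x : Fin n → ℝ)
    (ξ : ℝ × (Fin (n + 1) → ℝ)) {s : ℝ} (hs : 0 < s) :
    HasDerivAt (fun s => resolventIntegrand α ∅ l f (line i x s) ξ)
      (resolventIntegrand α {i} l f (line i x s) ξ) s := by
  simp only [resolventIntegrand, kernel_empty_line, kernel_singleton_line]
  exact (((hasDerivAt_density hα hs).mul_const _).mul_const _).const_mul _

theorem continuousOn_resolventIntegrand_line (hα : α i < 1) (x : Fin n → ℝ)
    (ξ : ℝ × (Fin (n + 1) → ℝ)) :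
    ContinuousOn (fun s => resolventIntegrand α {i} l f (line i x s) ξ) (Ioi 0) := by
  simp only [resolventIntegrand, kernel_singleton_line]
  have := continuousOn_densityDeriv (r := rate (α i) ξ.1) (z := ξ.2 i) hα
  fun_prop

/-- On `[b, c]` the weight is at least `c ^ (-a) > 0`, and `N ≤ 1 + N ^ p`. -/
theorem setLIntegral_lt_top_of_lintegral_rpow {a : ℝ} (ha : 0 ≤ a) (hp : 1 < p) {N : ℝ → ℝ≥0∞}
    (hN : Measurable N) (hfin : ∫⁻ s, N s ^ p ∂speedMeasure a < ∞) {b c : ℝ} (hb : 0 < b)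
    (hbc : b ≤ c) : ∫⁻ s in Icc b c, N s < ∞ := by
  have hc : 0 < c := hb.trans_le hbc
  set w := ENNReal.ofReal (c ^ (-a)) with hw
  have hw0 : w ≠ 0 := by simpa [hw] using Real.rpow_pos_of_pos hc _
  have h1 : ∫⁻ s in Icc b c, w * N s ^ p < ∞ := by
    rw [lintegral_speedMeasure (hN.pow_const p)] at hfin
    refine lt_of_le_of_lt ?_ hfin
    refine (setLIntegral_mono' measurableSet_Icc fun s hs => ?_).trans
      (lintegral_mono_set fun s hs => lt_of_lt_of_le hb hs.1)
    have hs0 : 0 < s := hb.trans_le hs.1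
    gcongr
    exact ENNReal.ofReal_le_ofReal (Real.rpow_le_rpow_of_nonpos hs0 hs.2 (by linarith))
  rw [lintegral_const_mul _ (hN.pow_const p)] at h1
  have h2 : ∫⁻ s in Icc b c, N s ^ p < ∞ := by
    by_contra h
    rw [not_lt_top_iff] at h
    rw [h, ENNReal.mul_top hw0] at h1
    exact h1.ne rfl
  calc ∫⁻ s in Icc b c, N s ≤ ∫⁻ s in Icc b c, (1 + N s ^ p) := by
        refine lintegral_mono fun s => ?_
        rcases le_total (N s) 1 with h | h
        · exact h.trans le_self_add
        · calc N s = N s ^ (1 : ℝ) := (ENNReal.rpow_one _).symm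
            _ ≤ N s ^ p := ENNReal.rpow_le_rpow_of_exponent_le h hp.le
            _ ≤ _ := le_add_self
    _ = volume (Icc b c) + ∫⁻ s in Icc b c, N s ^ p := by
        rw [lintegral_add_left measurable_const, setLIntegral_one]
    _ < ∞ := ENNReal.add_lt_top.2 ⟨by simp, h2⟩

/-- Along almost every line, the resolvent is a primitive of the integrated derivative kernel. -/
theorem ae_line_resolventIntegral (hα : ∀ j, α j ∈ Ioo (0 : ℝ) 1) (hp : 1 < p) (hl : 0 < l)
    (hf : Measurable f) (hfp : ∫⁻ y, ‖f y‖ₑ ^ p ∂weightedMeasure α < ∞) :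
    ∀ᵐ x ∂Measure.pi fun j => speedMeasure (α (i.succAbove j)),
      (∀ s, 0 < s → Integrable (resolventIntegrand α ∅ l f (line i x s)) (timeSpace α)) ∧
      (∀ a b, 0 < a → 0 < b →
        IntervalIntegrable (fun s => resolventIntegral α {i} l f (line i x s)) volume a b) ∧
      ∀ a b, 0 < a → 0 < b → resolventIntegral α ∅ l f (line i x b)
        - resolventIntegral α ∅ l f (line i x a)
        = ∫ s in a..b, resolventIntegral α {i} l f (line i x s) := by
  have hα1 : ∀ j, α j < 1 := fun j => (hα j).2
  have hNm := fun S => measurable_lintegral_enorm_resolventIntegrand (S := S) (l := l) hα1 hf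
  -- Slicing the global `L^p` bound gives a finite `p`-th power integral on almost every line, both
  -- for the kernel and for its derivative.
  have key : ∀ S, kernelMass α S l < ∞ →
      ∀ᵐ x ∂Measure.pi fun j => speedMeasure (α (i.succAbove j)),
        ∫⁻ s, (∫⁻ ξ, ‖resolventIntegrand α S l f (line i x s) ξ‖ₑ ∂timeSpace α) ^ p
          ∂speedMeasure (α i) < ∞ := by
    intro S hS
    have h := (lintegral_rpow_lintegral_resolventIntegrand_le (S := S) (l := l) hα hp hf).trans_lt
      (ENNReal.mul_lt_top (ENNReal.rpow_lt_top_of_nonneg (by linarith) hS.ne) hfp)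
    rw [weightedMeasure_eq, lintegral_pi_eq_lintegral_line (fun j => speedMeasure (α j)) i
      ((hNm S).pow_const p)] at h
    exact ae_lt_top ((((hNm S).pow_const p).comp (measurable_line i)).lintegral_prod_left') h.ne
  filter_upwards [key ∅ (by rw [kernelMass_empty hl]; exact ENNReal.ofReal_lt_top),
    key {i} (by rw [kernelMass_singleton hα1 i hl]; exact ENNReal.ofReal_lt_top)] with x h0 h1
  have hN0 := (hNm ∅).comp (measurable_line_right i x)
  have hN1 := (hNm {i}).comp (measurable_line_right i x)
  have hm : ∀ S s, Measurable (resolventIntegrand α S l f (line i x s)) := fun S s =>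
    (measurable_resolventIntegrand hα1 S l hf).comp measurable_prodMk_left
  -- One point of absolute convergence, found in `[1, 2]`, suffices: the bound on the derivative
  -- extends convergence to every point of the line, not just almost every one.
  obtain ⟨s₀, hs₀, hi₀⟩ : ∃ s₀, 0 < s₀ ∧
      Integrable (resolventIntegrand α ∅ l f (line i x s₀)) (timeSpace α) := by
    have h := ae_lt_top hN0 (setLIntegral_lt_top_of_lintegral_rpow (hα i).1.le hp hN0 h0
      one_pos one_le_two).ne
    have hne : (ae (volume.restrict (Icc (1 : ℝ) 2))).NeBot := by
      rw [ae_neBot, Ne, Measure.restrict_eq_zero]; simp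
    obtain ⟨s, hs, hs'⟩ := (h.and (ae_restrict_mem measurableSet_Icc)).exists
    exact ⟨s, by linarith [hs'.1], (hm ∅ s).aestronglyMeasurable, hs⟩
  have hA' : Measurable (Function.uncurry fun s ξ => resolventIntegrand α {i} l f (line i x s) ξ) :=
    (measurable_resolventIntegrand hα1 {i} l hf).comp
      (((measurable_line_right i x).comp measurable_fst).prodMk measurable_snd)
  have hfin : ∀ a b, 0 < a → 0 < b → ∫⁻ r in uIoc a b, ∫⁻ ξ,
      ‖resolventIntegrand α {i} l f (line i x r) ξ‖ₑ ∂timeSpace α < ∞ := by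
    intro a b ha hb
    refine (lintegral_mono_set (uIoc_subset_uIcc)).trans_lt ?_
    exact setLIntegral_lt_top_of_lintegral_rpow (hα i).1.le hp hN1 h1 (lt_min ha hb) min_le_max
  have main : ∀ a b : ℝ, 0 < a → 0 < b →
      Integrable (resolventIntegrand α ∅ l f (line i x a)) (timeSpace α) → _ := fun a b ha hb hi =>
    integral_sub_eq_intervalIntegral_of_hasDerivAt (ν := timeSpace α)
      (A := fun s ξ => resolventIntegrand α ∅ l f (line i x s) ξ) hA'
      (ae_of_all _ fun ξ s hs => hasDerivAt_resolventIntegrand_line i (hα1 i) x ξ hs)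
      (ae_of_all _ fun ξ => continuousOn_resolventIntegrand_line i (hα1 i) x ξ) ha hb hi
      (hfin a b ha hb)
  have hint := fun s hs => (main s₀ s hs₀ hs hi₀).1
  exact ⟨hint, fun a b ha hb => (main a b ha hb (hint a ha)).2.1,
    fun a b ha hb => (main a b ha hb (hint a ha)).2.2⟩

end Line

/-! ### Comparison of the weighted measure with Lebesgue measure -/

section Volume

variable {d : ℕ} {α : Fin d → ℝ}

theorem openOrthant_eq : openOrthant d = univ.pi fun _ => Ioi (0 : ℝ) := by
  ext x; simp [openOrthant]

theorem isOpen_openOrthant : IsOpen (openOrthant d) := by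
  rw [openOrthant_eq]; exact isOpen_set_pi finite_univ fun _ _ => isOpen_Ioi

theorem volume_restrict_openOrthant :
    (volume : Measure (Fin d → ℝ)).restrict (openOrthant d)
      = Measure.pi fun _ => volume.restrict (Ioi (0 : ℝ)) := by
  rw [openOrthant_eq, volume_pi, Measure.restrict_pi_pi]

theorem speedMeasure_eq_withDensity (a : ℝ) : speedMeasure a
    = (volume.restrict (Ioi (0 : ℝ))).withDensity fun s => ENNReal.ofReal (s ^ (-a)) := by
  rw [speedMeasure, restrict_Ioi_eq_restrict_Ici]

theorem weightedMeasure_eq_withDensity : weightedMeasure α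
    = ((volume : Measure (Fin d → ℝ)).restrict (openOrthant d)).withDensity
      fun x => ∏ i, ENNReal.ofReal (x i ^ (-α i)) := by
  have h : ∀ i, SigmaFinite ((volume.restrict (Ioi (0 : ℝ))).withDensity
      fun s => ENNReal.ofReal (s ^ (-α i))) := fun i => by
    rw [← speedMeasure_eq_withDensity]; infer_instance
  rw [weightedMeasure_eq, volume_restrict_openOrthant,
    ← pi_withDensity (f := fun i s => ENNReal.ofReal (s ^ (-α i))) _ fun i => by fun_prop]
  simp_rw [speedMeasure_eq_withDensity]

theorem volume_restrict_absolutelyContinuous :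
    (volume : Measure (Fin d → ℝ)).restrict (openOrthant d) ≪ weightedMeasure α := by
  rw [weightedMeasure_eq_withDensity]
  refine withDensity_absolutelyContinuous'
    (Finset.measurable_prod _ fun i _ => by fun_prop).aemeasurable ?_
  filter_upwards [ae_restrict_mem isOpen_openOrthant.measurableSet] with x hx
  refine Finset.prod_ne_zero_iff.2 fun i _ => ?_
  simpa using Real.rpow_pos_of_pos (hx i) _

/-- On a set bounded by `M` each weight `x i ^ (-α i)` is at least `M ^ (-α i)`, because `α i ≥ 0`.
-/
theorem exists_volume_restrict_le_smul (hα : ∀ i, 0 ≤ α i) {K : Set (Fin d → ℝ)}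
    (hK : IsCompact K) (hKU : K ⊆ openOrthant d) :
    ∃ c : ℝ≥0∞, c ≠ ∞ ∧ volume.restrict K ≤ c • weightedMeasure α := by
  obtain ⟨M, hM0, hM⟩ := hK.isBounded.exists_pos_norm_le
  set w := ∏ i, ENNReal.ofReal (M ^ (-α i)) with hw
  have hw0 : w ≠ 0 := Finset.prod_ne_zero_iff.2 fun i _ => by
    simpa using Real.rpow_pos_of_pos hM0 _
  have hwt : w ≠ ∞ := ENNReal.prod_ne_top fun i _ => ENNReal.ofReal_ne_top
  refine ⟨w⁻¹, ENNReal.inv_ne_top.2 hw0, ?_⟩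
  have h1 : w • volume.restrict K ≤ weightedMeasure α := by
    refine le_trans ?_ (Measure.restrict_le_self (s := K))
    rw [weightedMeasure_eq_withDensity, restrict_withDensity hK.measurableSet,
      Measure.restrict_restrict hK.measurableSet, inter_eq_self_of_subset_left hKU,
      ← withDensity_const]
    refine withDensity_mono ?_
    filter_upwards [ae_restrict_mem hK.measurableSet] with x hx
    refine Finset.prod_le_prod' fun i _ => ENNReal.ofReal_le_ofReal ?_
    refine Real.rpow_le_rpow_of_nonpos (hKU hx i) ?_ (by linarith [hα i])
    exact (le_abs_self _).trans ((norm_le_pi_norm x i).trans (hM x hx))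
  calc volume.restrict K = w⁻¹ • w • volume.restrict K := by
        rw [smul_smul, ENNReal.inv_mul_cancel hw0 hwt, one_smul]
    _ ≤ _ := by gcongr

theorem integrableOn_of_memLp (hα : ∀ i, 0 ≤ α i) {p : ℝ} (hp : 1 < p) {u : (Fin d → ℝ) → ℝ}
    (hu : MemLp u (ENNReal.ofReal p) (weightedMeasure α)) {K : Set (Fin d → ℝ)}
    (hK : IsCompact K) (hKU : K ⊆ openOrthant d) : IntegrableOn u K := by
  obtain ⟨c, hc, hle⟩ := exists_volume_restrict_le_smul hα hK hKU
  have : IsFiniteMeasure (volume.restrict K) := ⟨by simpa using hK.measure_lt_top⟩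
  exact (hu.of_measure_le_smul hc hle).integrable (ENNReal.one_le_ofReal.2 hp.le)

theorem locallyIntegrableOn_of_memLp (hα : ∀ i, 0 ≤ α i) {p : ℝ} (hp : 1 < p)
    {u : (Fin d → ℝ) → ℝ} (hu : MemLp u (ENNReal.ofReal p) (weightedMeasure α)) :
    LocallyIntegrableOn u (openOrthant d) :=
  (locallyIntegrableOn_iff isOpen_openOrthant.isLocallyClosed).2 fun _ hKU hK =>
    integrableOn_of_memLp hα hp hu hK hKU

theorem integrableOn_mul_of_memLp (hα : ∀ i, 0 ≤ α i) {p : ℝ} (hp : 1 < p)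
    {u ψ : (Fin d → ℝ) → ℝ} (hu : MemLp u (ENNReal.ofReal p) (weightedMeasure α))
    (hψ : Continuous ψ) {K : Set (Fin d → ℝ)} (hK : IsCompact K) (hKU : K ⊆ openOrthant d)
    (hψK : ∀ x ∉ K, ψ x = 0) : IntegrableOn (fun x => u x * ψ x) (openOrthant d) := by
  have h := (integrableOn_of_memLp hα hp hu hK hKU).mul_continuousOn hψ.continuousOn hK
  refine Integrable.integrableOn ((integrableOn_iff_integrable_of_support_subset ?_).1 h)
  intro x hx
  by_contra hxK
  exact hx (by simp [hψK x hxK])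

end Volume

/-! ### Norm bounds and convergence almost everywhere -/

section Bound

variable {d : ℕ} {α : Fin d → ℝ} {S : Finset (Fin d)} {f : (Fin d → ℝ) → ℝ} {p l : ℝ}

theorem eLpNorm_ofReal_eq {u : (Fin d → ℝ) → ℝ} (hp : 1 < p) :
    eLpNorm u (ENNReal.ofReal p) (weightedMeasure α)
      = (∫⁻ x, ‖u x‖ₑ ^ p ∂weightedMeasure α) ^ (1 / p) := by
  rw [eLpNorm_eq_lintegral_rpow_enorm_toReal (by simp; linarith) ENNReal.ofReal_ne_top,
    ENNReal.toReal_ofReal (by linarith)]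

theorem eLpNorm_resolventIntegral_le (hα : ∀ i, α i ∈ Ioo (0 : ℝ) 1) (hp : 1 < p)
    (hf : Measurable f) :
    eLpNorm (resolventIntegral α S l f) (ENNReal.ofReal p) (weightedMeasure α)
      ≤ kernelMass α S l * eLpNorm f (ENNReal.ofReal p) (weightedMeasure α) := by
  have hp0 : 0 < p := by linarith
  rw [eLpNorm_ofReal_eq hp, eLpNorm_ofReal_eq hp]
  calc _ ≤ (kernelMass α S l ^ p * ∫⁻ y, ‖f y‖ₑ ^ p ∂weightedMeasure α) ^ (1 / p) := by
        refine ENNReal.rpow_le_rpow ?_ (by positivity)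
        refine le_trans (lintegral_mono fun x => ?_)
          (lintegral_rpow_lintegral_resolventIntegrand_le hα hp hf)
        exact ENNReal.rpow_le_rpow (enorm_integral_le_lintegral_enorm _) hp0.le
    _ = _ := by
        rw [ENNReal.mul_rpow_of_nonneg _ _ (by positivity), ← ENNReal.rpow_mul,
          mul_one_div_cancel hp0.ne', ENNReal.rpow_one]

theorem memLp_resolventIntegral (hα : ∀ i, α i ∈ Ioo (0 : ℝ) 1) (hp : 1 < p)
    (hf : Measurable f) (hfp : MemLp f (ENNReal.ofReal p) (weightedMeasure α))
    (hS : kernelMass α S l < ∞) :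
    MemLp (resolventIntegral α S l f) (ENNReal.ofReal p) (weightedMeasure α) :=
  ⟨(measurable_resolventIntegral (fun i => (hα i).2) S l hf).aestronglyMeasurable,
    (eLpNorm_resolventIntegral_le hα hp hf).trans_lt (ENNReal.mul_lt_top hS hfp.2)⟩

theorem kernelMass_empty_lt_top (hl : 0 < l) : kernelMass α ∅ l < ∞ := by
  rw [kernelMass_empty hl]; exact ENNReal.ofReal_lt_top

theorem kernelMass_singleton_lt_top (hα : ∀ i, α i < 1) (i : Fin d) (hl : 0 < l) :
    kernelMass α {i} l < ∞ := by
  rw [kernelMass_singleton hα i hl]; exact ENNReal.ofReal_lt_top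

theorem lintegral_rpow_enorm_lt_top (hp : 1 < p)
    (hfp : MemLp f (ENNReal.ofReal p) (weightedMeasure α)) :
    ∫⁻ y, ‖f y‖ₑ ^ p ∂weightedMeasure α < ∞ := by
  have h := hfp.2
  rwa [eLpNorm_ofReal_eq hp, ENNReal.rpow_lt_top_iff_of_pos (by positivity)] at h

theorem ae_integrable_resolventIntegrand (hα : ∀ i, α i ∈ Ioo (0 : ℝ) 1) (hp : 1 < p)
    (hf : Measurable f) (hfp : MemLp f (ENNReal.ofReal p) (weightedMeasure α))
    (hS : kernelMass α S l < ∞) :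
    ∀ᵐ x ∂weightedMeasure α, Integrable (resolventIntegrand α S l f x) (timeSpace α) := by
  have hα1 : ∀ i, α i < 1 := fun i => (hα i).2
  have hp0 : 0 < p := by linarith
  have h := (lintegral_rpow_lintegral_resolventIntegrand_le (S := S) (l := l) hα hp hf).trans_lt
    (ENNReal.mul_lt_top (ENNReal.rpow_lt_top_of_nonneg hp0.le hS.ne)
      (lintegral_rpow_enorm_lt_top hp hfp))
  filter_upwards [ae_lt_top ((measurable_lintegral_enorm_resolventIntegrand hα1 hf).pow_const p)
    h.ne] with x hx
  rw [ENNReal.rpow_lt_top_iff_of_pos hp0] at hx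
  exact ⟨((measurable_resolventIntegrand hα1 S l hf).comp
    measurable_prodMk_left).aestronglyMeasurable, hx⟩

end Bound

/-! ### Pointwise and weak partial derivatives -/

section PartialDerivative

variable {n : ℕ} {α : Fin (n + 1) → ℝ} (i : Fin (n + 1)) {f : (Fin (n + 1) → ℝ) → ℝ} {p l : ℝ}

/-- Lebesgue differentiation gives the derivative at almost every point of almost every line. The
rational criterion describes a measurable set, so Fubini converts this into a statement almost
everywhere on the orthant; continuity on lines then restores the true derivative. -/
theorem ae_hasDerivAt_resolventIntegral (hα : ∀ j, α j ∈ Ioo (0 : ℝ) 1) (hp : 1 < p) (hl : 0 < l)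
    (hf : Measurable f) (hfp : MemLp f (ENNReal.ofReal p) (weightedMeasure α)) :
    ∀ᵐ x ∂weightedMeasure α,
      HasDerivAt (fun s => resolventIntegral α ∅ l f (Function.update x i s))
        (resolventIntegral α {i} l f x) (x i) := by
  have hα1 : ∀ i, α i < 1 := fun i => (hα i).2
  have hline := ae_line_resolventIntegral i hα hp hl hf (lintegral_rpow_enorm_lt_top hp hfp)
  have hm0 := measurable_resolventIntegral hα1 ∅ l hf
  have hm1 := measurable_resolventIntegral hα1 {i} l hf
  have hup : ∀ q : ℝ, Measurable fun x : Fin (n + 1) → ℝ => Function.update x i (x i + q) := by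
    intro q
    refine measurable_pi_iff.2 fun j => ?_
    by_cases h : j = i
    · subst h; simp only [Function.update_self]; fun_prop
    · simp only [Function.update_of_ne h]; fun_prop
  have hrat : ∀ᵐ x ∂weightedMeasure α, ∀ k : ℕ, ∃ m : ℕ, ∀ q : ℚ,
      |(q : ℝ)| < 1 / ((m : ℝ) + 1) →
      |resolventIntegral α ∅ l f (Function.update x i (x i + q)) - resolventIntegral α ∅ l f x
        - q * resolventIntegral α {i} l f x| ≤ 1 / ((k : ℝ) + 1) * |(q : ℝ)| := by
    rw [weightedMeasure_eq]
    refine ae_pi_of_ae_line _ i ?_ ?_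
    · refine Measurable.setOf (Measurable.forall fun k => Measurable.exists fun m =>
        Measurable.forall fun q => measurable_const.imp (measurableSet_setOfPred.1
          (measurableSet_le ?_ measurable_const)))
      exact (((hm0.comp (hup q)).sub hm0).sub (hm1.const_mul _)).abs
    · filter_upwards [hline] with x hx
      have hac : speedMeasure (α i) ≪ volume :=
        (withDensity_absolutelyContinuous _ _).trans Measure.restrict_le_self.absolutelyContinuous
      have hd := ae_hasDerivAt_of_sub_eq_intervalIntegral hx.2.1 hx.2.2
      have hc := continuousOn_of_sub_eq_intervalIntegral hx.2.1 hx.2.2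
      filter_upwards [ae_speedMeasure_pos, hac.ae_le hd]
        with s hs hd
      simpa only [line_same, update_line] using (hasDerivAt_iff_forall_rat hs hc).1 (hd hs)
  filter_upwards [hrat, ae_weightedMeasure_pos, ae_pi_removeNth (fun j => speedMeasure (α j)) i hline]
    with x hx hx0 hl
  have hc := continuousOn_of_sub_eq_intervalIntegral hl.2.1 hl.2.2
  simp only [line_removeNth] at hc
  refine (hasDerivAt_iff_forall_rat (hx0 i) hc).2 ?_
  simpa only [Function.update_eq_self] using hx

/-- Integration by parts on each line in the direction `i`, where the slice of `η` is a compactly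
supported test function on the half-line. -/
theorem integral_resolventIntegral_mul_fderiv (hα : ∀ j, α j ∈ Ioo (0 : ℝ) 1) (hp : 1 < p)
    (hl : 0 < l) (hf : Measurable f) (hfp : MemLp f (ENNReal.ofReal p) (weightedMeasure α))
    {η : (Fin (n + 1) → ℝ) → ℝ} (hη : ContDiff ℝ (⊤ : ℕ∞) η) (hηc : HasCompactSupport η)
    (hηs : tsupport η ⊆ openOrthant (n + 1)) :
    ∫ x in openOrthant (n + 1), resolventIntegral α ∅ l f x * fderiv ℝ η x (Pi.single i 1)
      = -∫ x in openOrthant (n + 1), resolventIntegral α {i} l f x * η x := by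
  have hα1 : ∀ i, α i < 1 := fun i => (hα i).2
  have hα0 : ∀ i, 0 ≤ α i := fun i => (hα i).1.le
  have hη1 : ContDiff ℝ 1 η := hη.of_le (by exact_mod_cast le_top)
  have hline := ae_line_resolventIntegral i hα hp hl hf (lintegral_rpow_enorm_lt_top hp hfp)
  have hi0 := integrableOn_mul_of_memLp hα0 hp
    (memLp_resolventIntegral hα hp hf hfp (kernelMass_empty_lt_top hl))
    (ψ := fun x => fderiv ℝ η x (Pi.single i 1))
    ((hη1.continuous_fderiv one_ne_zero).clm_apply continuous_const) hηc hηs fun x hx => by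
      rw [fderiv_of_notMem_tsupport ℝ hx]; rfl
  have hi1 := integrableOn_mul_of_memLp hα0 hp
    (memLp_resolventIntegral hα hp hf hfp (kernelMass_singleton_lt_top hα1 i hl))
    hη1.continuous hηc hηs fun x hx => image_eq_zero_of_notMem_tsupport hx
  rw [IntegrableOn, volume_restrict_openOrthant] at hi0 hi1
  rw [volume_restrict_openOrthant, integral_pi_eq_integral_line _ i hi0,
    integral_pi_eq_integral_line _ i hi1, ← integral_neg]
  have hac : (Measure.pi fun _ : Fin n => volume.restrict (Ioi (0 : ℝ)))
      ≪ Measure.pi fun j => speedMeasure (α (i.succAbove j)) := by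
    rw [← volume_restrict_openOrthant]
    exact volume_restrict_absolutelyContinuous (α := fun j => α (i.succAbove j))
  refine integral_congr_ae ?_
  filter_upwards [hac.ae_le hline] with x hx
  have hu : line i x = Function.update (line i x 0) i := by
    ext s : 1; rw [update_line]
  have hd : ∀ s, deriv (fun s => η (line i x s)) s = fderiv ℝ η (line i x s) (Pi.single i 1) := by
    intro s
    have h1 : HasDerivAt (line i x) (Pi.single i 1) s := by
      rw [hu]; exact hasDerivAt_update _ _ _
    exact (((hη1.differentiable one_ne_zero) _).hasFDerivAt.comp_hasDerivAt s h1).deriv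
  have hψ : ContDiff ℝ 1 fun s => η (line i x s) := by
    refine hη1.comp ?_
    rw [hu]; exact contDiff_update 1 _ i
  have hcl : Continuous (line i x) := by rw [hu]; fun_prop
  have hts : tsupport (fun s => η (line i x s)) ⊆ line i x ⁻¹' tsupport η :=
    closure_minimal (fun s hs => subset_tsupport η hs) ((isClosed_tsupport η).preimage hcl)
  have hcs : HasCompactSupport fun s => η (line i x s) := by
    refine HasCompactSupport.intro (hηc.isCompact.image (continuous_apply i)) fun s hs => ?_
    refine image_eq_zero_of_notMem_tsupport fun h => hs ⟨_, h, line_same i x s⟩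
  simp only [← hd]
  refine integral_mul_deriv_of_sub_eq_intervalIntegral hx.2.1 hx.2.2 hψ hcs fun s hs => ?_
  simpa using hηs (hts hs) i

theorem hasWeakPartialDeriv_of_ae_eq (hα : ∀ j, α j ∈ Ioo (0 : ℝ) 1) (hp : 1 < p)
    (hl : 0 < l) (hf : Measurable f) (hfp : MemLp f (ENNReal.ofReal p) (weightedMeasure α))
    {u : (Fin (n + 1) → ℝ) → ℝ} (hu : u =ᵐ[weightedMeasure α] resolventIntegral α ∅ l f) :
    HasWeakPartialDeriv (openOrthant (n + 1)) i u (resolventIntegral α {i} l f) := by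
  have hα0 : ∀ i, 0 ≤ α i := fun i => (hα i).1.le
  refine ⟨locallyIntegrableOn_of_memLp hα0 hp ((memLp_congr_ae hu).2
    (memLp_resolventIntegral hα hp hf hfp (kernelMass_empty_lt_top hl))),
    locallyIntegrableOn_of_memLp hα0 hp (memLp_resolventIntegral hα hp hf hfp
      (kernelMass_singleton_lt_top (fun i => (hα i).2) i hl)), fun η hη hηc hηs => ?_⟩
  rw [← integral_resolventIntegral_mul_fderiv i hα hp hl hf hfp hη hηc hηs]
  refine integral_congr_ae ?_
  filter_upwards [volume_restrict_absolutelyContinuous.ae_le hu] with x hx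
  rw [hx]

end PartialDerivative

end DegenerateOrthant

theorem theorem5p4 (d : ℕ) (α : Fin d → ℝ) (hα : ∀ i, α i ∈ Ioo (0 : ℝ) 1)
    (p : ℝ) (hp : 1 < p) :
    ∃ c : ℝ, 0 < c ∧
      ∀ (Ω : Type*) [MeasurableSpace Ω] (P : (Fin d → ℝ) → Measure Ω)
        (X : ℝ≥0 → Ω → Fin d → ℝ), DegenerateOrthant.IsProductDiffusion α P X →
      ∀ l : ℝ, 0 < l → ∀ f : (Fin d → ℝ) → ℝ,
        MemLp f (ENNReal.ofReal p) (DegenerateOrthant.weightedMeasure α) →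
        -- the integrals that define the resolvent converge at almost every point
        (∀ᵐ x ∂(DegenerateOrthant.weightedMeasure α),
          (∀ t : ℝ≥0, 0 < t → Integrable (fun ω => f (X t ω)) (P x)) ∧
          IntegrableOn
            (fun t : ℝ => Real.exp (-l * t) * DegenerateOrthant.semigroup P X t.toNNReal f x)
            (Ioi 0)) ∧
        ∀ i : Fin d, ∃ g : (Fin d → ℝ) → ℝ,
          -- `g` is the `i`-th partial derivative, both weakly and pointwise almost everywhere
          DegenerateOrthant.HasWeakPartialDeriv (DegenerateOrthant.openOrthant d) i
            (DegenerateOrthant.resolvent P X l f) g ∧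
          (∀ᵐ x ∂(DegenerateOrthant.weightedMeasure α),
            HasDerivAt (fun s : ℝ => DegenerateOrthant.resolvent P X l f (Function.update x i s))
              (g x) (x i)) ∧
          MemLp g (ENNReal.ofReal p) (DegenerateOrthant.weightedMeasure α) ∧
          eLpNorm g (ENNReal.ofReal p) (DegenerateOrthant.weightedMeasure α)
            ≤ ENNReal.ofReal (c * l ^ (1 / (2 * (1 - α i / 2)) - 1))
              * eLpNorm f (ENNReal.ofReal p) (DegenerateOrthant.weightedMeasure α) := by
  open DegenerateOrthant in
  have hα1 : ∀ i, α i < 1 := fun i => (hα i).2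
  have hc0 : ∀ i, 0 ≤ resolventConst (α i) := fun i => (resolventConst_pos (hα1 i)).le
  -- The sum dominates each coordinate's constant, and the `1` keeps it positive when `d = 0`.
  refine ⟨1 + ∑ i, resolventConst (α i),
    add_pos_of_pos_of_nonneg one_pos (Finset.sum_nonneg fun i _ => hc0 i), ?_⟩
  intro Ω _ P X hX l hl f hf
  obtain ⟨f', hf', hff'⟩ : ∃ f', Measurable f' ∧ f =ᵐ[weightedMeasure α] f' :=
    ⟨hf.1.mk f, hf.1.stronglyMeasurable_mk.measurable, hf.1.ae_eq_mk⟩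
  have hfp : MemLp f' (ENNReal.ofReal p) (weightedMeasure α) := (memLp_congr_ae hff').1 hf
  have hae := ae_integrable_resolventIntegrand hα hp hf' hfp (kernelMass_empty_lt_top hl)
  have hres : ∀ x : Fin d → ℝ, (∀ j, 0 < x j) →
      Integrable (resolventIntegrand α ∅ l f' x) (timeSpace α) → _ := fun x hx hi =>
    hX.resolvent_eq hα hf' hff' (fun j => (hx j).le) hi
  refine ⟨?_, fun i => ⟨resolventIntegral α {i} l f', ?_, ?_, ?_, ?_⟩⟩
  · filter_upwards [hae, ae_weightedMeasure_pos] with x hx hx0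
    exact ⟨fun t ht => hX.integrable hα hp hf (fun j => (hx0 j).le) ht, (hres x hx0 hx).1⟩
  · cases d with
    | zero => exact i.elim0
    | succ n =>
      refine hasWeakPartialDeriv_of_ae_eq i hα hp hl hf' hfp ?_
      filter_upwards [hae, ae_weightedMeasure_pos] with x hx hx0
      exact (hres x hx0 hx).2
  · cases d with
    | zero => exact i.elim0
    | succ n =>
      filter_upwards [ae_hasDerivAt_resolventIntegral i hα hp hl hf' hfp, ae_weightedMeasure_pos,
        ae_pi_removeNth (fun j => speedMeasure (α j)) i
          (ae_line_resolventIntegral i hα hp hl hf' (lintegral_rpow_enorm_lt_top hp hfp))]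
        with x hx hx0 hline
      -- The derivative requires the two functions to agree at every nearby point of the line. This
      -- is supplied by absolute convergence at all `s > 0` on almost every line.
      refine hx.congr_of_eventuallyEq ?_
      filter_upwards [lt_mem_nhds (hx0 i)] with s hs
      refine (hres _ (fun j => ?_) ?_).2
      · by_cases h : j = i
        · subst h; simpa using hs
        · simpa [Function.update_of_ne h] using hx0 j
      · rw [← line_removeNth]; exact hline.1 s hs
  · exact memLp_resolventIntegral hα hp hf' hfp (kernelMass_singleton_lt_top hα1 i hl)
  · refine (eLpNorm_resolventIntegral_le hα hp hf').trans ?_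
    rw [kernelMass_singleton hα1 i hl, eLpNorm_congr_ae hff']
    gcongr
    have := Finset.single_le_sum (f := fun i => resolventConst (α i)) (fun i _ => hc0 i)
      (Finset.mem_univ i)
    linarith
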